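/- **Theorem 3.1.** Let $\mathfrak A$ be an associative algebra over $\mathbb C$ (not necessarily unital), regarded also as a Lie algebra with $[a,b]=ab-ba$. Let $\mathrm{Tr}\colon\mathfrak A\to\mathbb C$ be a trace (a linear map with $\mathrm{Tr}(ab)=\mathrm{Tr}(ba)$), let $D_1,\dots,D_4$ be derivations of $\mathfrak A$, and let $Q_{ij}\in\mathfrak A$ $(1\le i,j\le 4)$, such that for all $i,j,k$ (i) $\mathrm{Tr}\circ D_i=0$; (ii) $[D_i,D_j]=\mathrm{ad}\,Q_{ij}$; (iii) $\mathrm{Alt}_{i,j,k}\,D_k(Q_{ij})=0$. Here and below $\mathrm{Alt}$ is the signed sum over all permutations, without normalization; $\mathrm{Alt}_{A,D}$ is the signed sum over the permutations of the $A$'s and the permutations of $\{1,2,3,4\}$ acting on the indices of the $D$'s and $Q$'s. Put $$\begin{aligned}\Psi_5(A_1,\dots,A_5)=\mathrm{Alt}_{A,D}\,\mathrm{Tr}\Big(&D_1A_1\,D_2A_2\,D_3A_3\,D_4A_4\,A_5\\&+\tfrac12A_1Q_{12}A_2\,D_3A_3\,D_4A_4\,A_5+\tfrac12D_1A_1\,A_2Q_{23}A_3\,D_4A_4\,A_5+\tfrac12D_1A_1\,D_2A_2\,A_3Q_{34}A_4\,A_5\\&+\tfrac14A_1Q_{12}A_2A_3Q_{34}A_4A_5\Big)\end{aligned}$$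 (the factor $\tfrac12$ for each $Q$ means that the two indices of $Q_{ij}$ are not alternated: for $Q_{ji}=-Q_{ij}$, each pair $\{i,j\}$ is counted once). Then $\Psi_5$ is a $5$-cocycle on the Lie algebra $\mathfrak A$ with trivial coefficients $\mathbb C$. It lifts the class of the $4$-cocycle with values in the coadjoint module $\mathfrak A^*$ $$\alpha^*_{D_1,\dots,D_4}(A_1,\dots,A_4)(A_5)=\mathrm{Tr}\big(\mathrm{Alt}_{A_1,\dots,A_4;\,D}(D_1A_1\,D_2A_2\,D_3A_3\,D_4A_4)\cdot A_5\big)$$ in the following sense: if $\theta_5\colon H^5(\mathfrak A;\mathbb C)\to H^4(\mathfrak A;\mathfrak A^*)$ is the canonical map induced by $\theta_5(\Psi)(A_1,\dots,A_4)(A_5)=\Psi(A_1,\dots,A_5)$, then $\theta_5([\Psi_5])=5\,[\alpha^*_{D_1,\dots,D_4}]$ (so $\tfrac15\Psi_5$ is sent to $\alpha^*_{D_1,\dots,D_4}$ exactly). Let now $\mathfrak A=\Psi\mathrm{Dif}_2(S^1)$ be the algebra of formal pseudodifferential operators $\sum_{b_1,b_2\le N}f_{b_1b_2}(x_1,x_2)\,\partial_1^{b_1}\partial_2^{b_2}$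 with coefficients in $\mathbb C[x_1^{\pm1},x_2^{\pm1}]$; let $\mathrm{Tr}$ be the noncommutative residue (the coefficient of $x_1^{-1}x_2^{-1}\partial_1^{-1}\partial_2^{-1}$), and $D_1=\ln\partial_1$, $D_2=\ln x_1$, $D_3=\ln\partial_2$, $D_4=\ln x_2$, acting by commutators: $$[\ln\partial_i,\,x^a\partial^b]=\sum_{m\ge1}\frac{(-1)^{m-1}}m\,a_i(a_i-1)\cdots(a_i-m+1)\,x^{a-me_i}\partial^{b-me_i},$$ $$[\ln x_i,\,x^a\partial^b]=\sum_{m\ge1}\frac{(-1)^{m}}m\,b_i(b_i-1)\cdots(b_i-m+1)\,x^{a-me_i}\partial^{b-me_i}.$$ Then $\mathrm{Tr}$ is a trace, the $D_i$ are derivations, and there are $Q_{ij}$ for which (i)–(iii) hold. For every such choice of the $Q_{ij}$, $\Psi_5(1\wedge x_1\wedge x_2\wedge\partial_1\wedge\partial_2)\ne0$, and the cocycle $\Psi_5$ is not cohomologous to zero. -/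

import Mathlib

noncomputable section

namespace LiftingFormula

section FallingFactorials

open Finset hiding mem_antidiagonal

/-- The falling factorial `x (x - 1) ⋯ (x - k + 1)`. -/
def fallFact (x : ℂ) (k : ℕ) : ℂ := ∏ j ∈ range k, (x - j)

theorem fallFact_add (x : ℂ) (k l : ℕ) :
    fallFact x (k + l) = fallFact x k * fallFact (x - k) l := by
  unfold fallFact
  rw [prod_range_add]
  congr 1
  refine prod_congr rfl fun j _ => ?_
  push_cast; ring

theorem fallFact_vandermonde (x y : ℂ) (k : ℕ) :
    fallFact (x + y) k / k.factorial =
      ∑ p ∈ antidiagonal k,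
        fallFact x p.1 / p.1.factorial * (fallFact y p.2 / p.2.factorial) := by
  have h : ∀ (z : ℂ) (m : ℕ), fallFact z m / m.factorial = Ring.choose z m := by
    intro z m
    rw [Ring.choose_eq_smul, fallFact, ← descPochhammer_eval_eq_prod_range, smul_eq_mul,
      div_eq_inv_mul, ← descPochhammer_map (Int.castRingHom ℂ), Polynomial.eval_map,
      ← Polynomial.eval₂_smulOneHom_eq_smeval]
    congr 2
    exact Subsingleton.elim _ _
  simp only [h]
  exact Ring.add_choose_eq k (Commute.all _ _)

/-- The identity between falling factorials behind the associativity of the product of symbols. -/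
theorem fallFact_assoc (b c d e : ℂ) (N : ℕ) :
    ∑ p ∈ antidiagonal N,
      (fallFact b p.1 * fallFact c p.1 / p.1.factorial) *
      (fallFact (b + d - p.1) p.2 * fallFact e p.2 / p.2.factorial) =
    ∑ p ∈ antidiagonal N,
      (fallFact b p.1 * fallFact (c + e - p.2) p.1 / p.1.factorial) *
      (fallFact d p.2 * fallFact e p.2 / p.2.factorial) := by
  set T : ℕ → ℕ → ℕ → ℂ := fun k j r =>
    fallFact b (k + j) * fallFact c k * fallFact d r * fallFact e (r + j) /
      (k.factorial * j.factorial * r.factorial) with hT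
  have h1 : ∀ p ∈ antidiagonal N,
      (fallFact b p.1 * fallFact c p.1 / p.1.factorial) *
      (fallFact (b + d - p.1) p.2 * fallFact e p.2 / p.2.factorial) =
      ∑ q ∈ antidiagonal p.2, T p.1 q.1 q.2 := by
    intro p _
    have := fallFact_vandermonde (b - p.1) d p.2
    rw [show b - p.1 + d = b + d - p.1 by ring] at this
    rw [show fallFact (b + d - p.1) p.2 * fallFact e p.2 / p.2.factorial =
      fallFact (b + d - p.1) p.2 / p.2.factorial * fallFact e p.2 by ring, this, sum_mul, mul_sum]
    refine sum_congr rfl fun q hq => ?_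
    rw [HasAntidiagonal.mem_antidiagonal] at hq
    simp only [hT]
    rw [fallFact_add, add_comm q.2 q.1, hq]
    field_simp
  have h2 : ∀ p ∈ antidiagonal N,
      (fallFact b p.1 * fallFact (c + e - p.2) p.1 / p.1.factorial) *
      (fallFact d p.2 * fallFact e p.2 / p.2.factorial) =
      ∑ q ∈ antidiagonal p.1, T q.1 q.2 p.2 := by
    intro p _
    have := fallFact_vandermonde c (e - p.2) p.1
    rw [show c + (e - p.2) = c + e - p.2 by ring] at this
    rw [show fallFact b p.1 * fallFact (c + e - p.2) p.1 / p.1.factorial =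
      fallFact b p.1 * (fallFact (c + e - p.2) p.1 / p.1.factorial) by ring, this, mul_sum, sum_mul]
    refine sum_congr rfl fun q hq => ?_
    rw [HasAntidiagonal.mem_antidiagonal] at hq
    simp only [hT]
    rw [fallFact_add e, hq]
    field_simp
  rw [sum_congr rfl h1, sum_congr rfl h2]
  rw [sum_sigma', sum_sigma']
  refine sum_nbij' (fun x => ⟨(x.1.1 + x.2.1, x.2.2), (x.1.1, x.2.1)⟩)
    (fun x => ⟨(x.2.1, x.2.2 + x.1.2), (x.2.2, x.1.2)⟩) ?_ ?_ ?_ ?_ ?_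
  · rintro ⟨⟨k, l⟩, ⟨j, r⟩⟩ h
    simp at h ⊢; omega
  · rintro ⟨⟨k, l⟩, ⟨j, r⟩⟩ h
    simp at h ⊢; omega
  · rintro ⟨⟨k, l⟩, ⟨j, r⟩⟩ h
    simp at h ⊢; omega
  · rintro ⟨⟨k, l⟩, ⟨j, r⟩⟩ h
    simp at h ⊢; omega
  · rintro ⟨⟨k, l⟩, ⟨j, r⟩⟩ h
    rfl

end FallingFactorials

/-! ### Formal pseudodifferential operators on the torus -/

/-- Pairs `(a, b)` of multi-exponents of the monomials `x ^ a ∂ ^ b`. -/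
abbrev MonExp (n : ℕ) : Type := (Fin n → ℤ) × (Fin n → ℤ)

/-- The pair of multi-exponents `(k, k)`. -/
def diagExp {n : ℕ} (k : Fin n → ℕ) : MonExp n := (fun i => (k i : ℤ), fun i => (k i : ℤ))

/-- The space of formal pseudodifferential operators on `(S¹)ⁿ`: the formal series
`∑_b f_b(x) ∂ ^ b`, `b ∈ ℤⁿ`, with Laurent polynomials `f_b ∈ ℂ[x₁^±1, …, xₙ^±1]` as coefficients
and with the order in each `∂_i` bounded above. An element is stored as the family of its
coefficients, `f (a, b)` being the coefficient of `x ^ a ∂ ^ b`. -/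
def PsiDif (n : ℕ) : Submodule ℂ (MonExp n → ℂ) where
  carrier := {f | (∃ N : ℤ, ∀ P, f P ≠ 0 → ∀ i, P.2 i ≤ N) ∧
    ∀ b : Fin n → ℤ, {a : Fin n → ℤ | f (a, b) ≠ 0}.Finite}
  zero_mem' := ⟨⟨0, fun P h => absurd rfl h⟩, fun b => by simp⟩
  add_mem' := by
    rintro f g ⟨⟨N, hN⟩, hf⟩ ⟨⟨M, hM⟩, hg⟩
    refine ⟨⟨max N M, fun P h i => ?_⟩, fun b => ((hf b).union (hg b)).subset ?_⟩
    · by_cases hP : f P = 0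
      · exact le_max_of_le_right (hM P (fun h0 => h (by simp [hP, h0])) i)
      · exact le_max_of_le_left (hN P hP i)
    · intro a h
      by_contra h0
      simp only [Set.mem_union, Set.mem_ofPred_eq, not_or, not_not] at h0
      exact h (by simp [h0.1, h0.2])
  smul_mem' := by
    rintro c f ⟨⟨N, hN⟩, hf⟩
    refine ⟨⟨N, fun P h i => hN P (fun h0 => h (by simp [h0])) i⟩,
      fun b => (hf b).subset fun a h h0 => h (by simp [h0])⟩

namespace PsiDif

variable {n : ℕ}

theorem finite_ge (f : PsiDif n) (B : ℤ) :
    {P : MonExp n | f.1 P ≠ 0 ∧ ∀ i, B ≤ P.2 i}.Finite := by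
  obtain ⟨⟨N, hN⟩, hf⟩ := f.2
  have hfin : (Set.Icc (fun _ : Fin n => B) (fun _ => N)).Finite := Set.finite_Icc _ _
  refine (hfin.biUnion fun b _ => (hf b).image fun a => (a, b)).subset ?_
  rintro ⟨a, b⟩ ⟨h1, h2⟩
  simp only [Set.mem_iUnion]
  exact ⟨b, ⟨fun i => h2 i, fun i => hN _ h1 i⟩, a, h1, rfl⟩

/-- The coefficient of `x ^ (a + c - k) ∂ ^ (b + d - k)` in the product
`x ^ a ∂ ^ b * x ^ c ∂ ^ d`, namely `∏ i, (b_i)_{k_i} (c_i)_{k_i} / k_i !` with falling factorials: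
this is the Leibniz rule `∂ ^ b ∘ g = ∑_k (1 / k!) (∂_ξ ^ k ξ ^ b) (∂_x ^ k g)`,
extended to negative `b`. -/
def structConst (b c : Fin n → ℤ) (k : Fin n → ℕ) : ℂ :=
  ∏ i, fallFact (b i) (k i) * fallFact (c i) (k i) / (k i).factorial

/-- The contribution to the coefficient of `x ^ L.1 ∂ ^ L.2` in `f * g` of the monomial `t.1` of `f`
and of the monomial `L - t.1 + (k, k)` of `g`, where `k = t.2`. -/
def mulTerm (f g : MonExp n → ℂ) (L : MonExp n) (t : MonExp n × (Fin n → ℕ)) : ℂ :=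
  f t.1 * g (L - t.1 + diagExp t.2) * structConst t.1.2 (L - t.1 + diagExp t.2).1 t.2

theorem finite_pair (f g : PsiDif n) (B : ℤ) :
    {t : (MonExp n × MonExp n) × (Fin n → ℕ) | f.1 t.1.1 ≠ 0 ∧ g.1 t.1.2 ≠ 0 ∧
      ∀ i, B ≤ (t.1.1 + t.1.2 - diagExp t.2).2 i}.Finite := by
  obtain ⟨⟨N, hN⟩, hf⟩ := f.2
  obtain ⟨⟨M, hM⟩, hg⟩ := g.2
  refine (((finite_ge f (B - M)).prod (finite_ge g (B - N))).prod
    (Set.finite_Iic (fun _ : Fin n => (N + M - B).toNat))).subset ?_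
  rintro ⟨⟨P, Q⟩, k⟩ ⟨h1, h2, h3⟩
  simp only [diagExp, Prod.snd_add, Prod.snd_sub, Pi.add_apply, Pi.sub_apply] at h3
  refine ⟨⟨⟨h1, fun i => ?_⟩, ⟨h2, fun i => ?_⟩⟩, fun i => ?_⟩ <;>
  · have a1 := hN P h1 i
    have a2 := hM Q h2 i
    have a3 := h3 i
    simp only at *
    omega

theorem finite_triple (f g h : PsiDif n) (B : ℤ) :
    {t : (MonExp n × MonExp n × MonExp n) × (Fin n → ℕ) | f.1 t.1.1 ≠ 0 ∧ g.1 t.1.2.1 ≠ 0 ∧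
      h.1 t.1.2.2 ≠ 0 ∧ ∀ i, B ≤ (t.1.1 + t.1.2.1 + t.1.2.2 - diagExp t.2).2 i}.Finite := by
  obtain ⟨⟨N, hN⟩, hf⟩ := f.2
  obtain ⟨⟨M, hM⟩, hg⟩ := g.2
  obtain ⟨⟨K, hK⟩, hh⟩ := h.2
  refine (((finite_ge f (B - M - K)).prod ((finite_ge g (B - N - K)).prod
    (finite_ge h (B - N - M)))).prod
    (Set.finite_Iic (fun _ : Fin n => (N + M + K - B).toNat))).subset ?_
  rintro ⟨⟨P, Q, R⟩, k⟩ ⟨h1, h2, h3, h4⟩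
  simp only [diagExp, Prod.snd_add, Prod.snd_sub, Pi.add_apply, Pi.sub_apply] at h4
  refine ⟨⟨⟨h1, fun i => ?_⟩, ⟨h2, fun i => ?_⟩, ⟨h3, fun i => ?_⟩⟩, fun i => ?_⟩ <;>
  · have a1 := hN P h1 i
    have a2 := hM Q h2 i
    have a3 := hK R h3 i
    have a4 := h4 i
    simp only at *
    omega

theorem mulTerm_support_finite (f g : PsiDif n) (L : MonExp n) :
    (Function.support (mulTerm f.1 g.1 L)).Finite := by
  obtain ⟨B, hB⟩ : ∃ B : ℤ, ∀ i, B ≤ L.2 i := by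
    obtain ⟨B, hB⟩ := (Set.finite_range L.2).bddBelow
    exact ⟨B, fun i => hB ⟨i, rfl⟩⟩
  refine ((finite_pair f g B).image fun t => (t.1.1, t.2)).subset ?_
  rintro ⟨P, k⟩ h
  refine ⟨((P, L - P + diagExp k), k), ⟨?_, ?_, fun i => ?_⟩, rfl⟩
  · exact left_ne_zero_of_mul (left_ne_zero_of_mul h)
  · exact right_ne_zero_of_mul (left_ne_zero_of_mul h)
  · have : P + (L - P + diagExp k) - diagExp k = L := by abel
    simpa [this] using hB i

theorem mul_mem (f g : PsiDif n) :
    (fun L => ∑ᶠ t, mulTerm f.1 g.1 L t) ∈ PsiDif n := by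
  have key : ∀ L, (∑ᶠ t, mulTerm f.1 g.1 L t) ≠ 0 →
      ∃ P Q k, f.1 P ≠ 0 ∧ g.1 Q ≠ 0 ∧ P + Q - diagExp k = L := by
    intro L h
    obtain ⟨⟨P, k⟩, ht⟩ : ∃ t, mulTerm f.1 g.1 L t ≠ 0 := by
      by_contra! h0
      exact h (by simp [h0])
    exact ⟨P, L - P + diagExp k, k, left_ne_zero_of_mul (left_ne_zero_of_mul ht),
      right_ne_zero_of_mul (left_ne_zero_of_mul ht), by abel⟩
  constructor
  · obtain ⟨⟨N, hN⟩, hf⟩ := f.2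
    obtain ⟨⟨M, hM⟩, hg⟩ := g.2
    refine ⟨N + M, fun L h i => ?_⟩
    obtain ⟨P, Q, k, h1, h2, rfl⟩ := key L h
    have a1 := hN P h1 i
    have a2 := hM Q h2 i
    simp only [diagExp, Prod.snd_add, Prod.snd_sub, Pi.add_apply, Pi.sub_apply]
    omega
  · intro b
    obtain ⟨B, hB⟩ : ∃ B : ℤ, ∀ i, B ≤ b i := by
      obtain ⟨B, hB⟩ := (Set.finite_range b).bddBelow
      exact ⟨B, fun i => hB ⟨i, rfl⟩⟩
    refine ((finite_pair f g B).image fun t => (t.1.1 + t.1.2 - diagExp t.2).1).subset ?_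
    intro a h
    obtain ⟨P, Q, k, h1, h2, h3⟩ := key (a, b) h
    exact ⟨((P, Q), k), ⟨h1, h2, fun i => by simpa [h3] using hB i⟩, by simp [h3]⟩

/-- The product of pseudodifferential operators: the bilinear extension of
`x ^ a ∂ ^ b * x ^ c ∂ ^ d = ∑_k structConst b c k • x ^ (a + c - k) ∂ ^ (b + d - k)`
to formal series (every coefficient of the product is a finite sum). -/
instance : Mul (PsiDif n) := ⟨fun f g => ⟨fun L => ∑ᶠ t, mulTerm f.1 g.1 L t, mul_mem f g⟩⟩

theorem mul_apply (f g : PsiDif n) (L : MonExp n) :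
    (f * g).1 L = ∑ᶠ t, mulTerm f.1 g.1 L t := rfl

/-- The operator `c x ^ a ∂ ^ b`. -/
def monomial (a b : Fin n → ℤ) (c : ℂ) : PsiDif n :=
  ⟨Pi.single (a, b) c, by
    classical
    have h : ∀ P, (Pi.single (a, b) c : MonExp n → ℂ) P ≠ 0 → P = (a, b) := by
      intro P hP
      by_contra h0
      exact hP (by simp [h0])
    constructor
    · obtain ⟨N, hN⟩ := (Set.finite_range b).bddAbove
      exact ⟨N, fun P hP i => by rw [h P hP]; exact hN ⟨i, rfl⟩⟩
    · intro d
      exact (Set.finite_singleton a).subset fun e he => congrArg Prod.fst (h _ he)⟩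

instance : One (PsiDif n) := ⟨monomial 0 0 1⟩

theorem one_apply (L : MonExp n) : (1 : PsiDif n).1 L = if L = 0 then 1 else 0 := by
  change (Pi.single ((0 : Fin n → ℤ), (0 : Fin n → ℤ)) (1 : ℂ) : MonExp n → ℂ) L = _
  rw [Pi.single_apply]; rfl

theorem fallFact_zero_left (k : ℕ) (hk : k ≠ 0) : fallFact 0 k = 0 := by
  unfold fallFact
  exact Finset.prod_eq_zero (Finset.mem_range.mpr (Nat.pos_of_ne_zero hk)) (by simp)

theorem structConst_zero (b c : Fin n → ℤ) : structConst b c 0 = 1 := by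
  simp [structConst, fallFact]

theorem structConst_zero_left (c : Fin n → ℤ) (k : Fin n → ℕ) (hk : k ≠ 0) :
    structConst 0 c k = 0 := by
  obtain ⟨i, hi⟩ := Function.ne_iff.mp hk
  exact Finset.prod_eq_zero (Finset.mem_univ i) (by simp [fallFact_zero_left _ hi])

theorem structConst_zero_right (b : Fin n → ℤ) (k : Fin n → ℕ) (hk : k ≠ 0) :
    structConst b 0 k = 0 := by
  obtain ⟨i, hi⟩ := Function.ne_iff.mp hk
  exact Finset.prod_eq_zero (Finset.mem_univ i) (by simp [fallFact_zero_left _ hi])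

theorem diagExp_zero : diagExp (0 : Fin n → ℕ) = 0 := by
  ext <;> simp [diagExp]

theorem diagExp_add (k l : Fin n → ℕ) : diagExp (k + l) = diagExp k + diagExp l := by
  ext <;> simp [diagExp]

protected theorem one_mul (f : PsiDif n) : 1 * f = f := by
  ext L
  rw [mul_apply, finsum_eq_single _ (0, 0)]
  · simp [mulTerm, one_apply, diagExp_zero, structConst_zero]
  · rintro ⟨P, k⟩ h
    by_cases hP : P = 0
    · have hk : k ≠ 0 := fun hk => h (by rw [hP, hk])
      simp [mulTerm, hP, structConst_zero_left _ _ hk]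
    · simp [mulTerm, one_apply, hP]

protected theorem mul_one (f : PsiDif n) : f * 1 = f := by
  ext L
  rw [mul_apply, finsum_eq_single _ (L, 0)]
  · simp [mulTerm, one_apply, diagExp_zero, structConst_zero]
  · rintro ⟨P, k⟩ h
    by_cases hP : L - P + diagExp k = 0
    · have hk : k ≠ 0 := by
        rintro rfl
        refine h ?_
        rw [diagExp_zero, add_zero, sub_eq_zero] at hP
        rw [hP]
      simp [mulTerm, hP, structConst_zero_right _ _ hk]
    · simp [mulTerm, one_apply, hP]

protected theorem add_mul (f g h : PsiDif n) : (f + g) * h = f * h + g * h := by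
  ext L
  change _ = (f * h).1 L + (g * h).1 L
  rw [mul_apply, mul_apply, mul_apply,
    ← finsum_add_distrib (mulTerm_support_finite f h L) (mulTerm_support_finite g h L)]
  refine finsum_congr fun t => ?_
  simp [mulTerm, add_mul]

protected theorem mul_add (f g h : PsiDif n) : f * (g + h) = f * g + f * h := by
  ext L
  change _ = (f * g).1 L + (f * h).1 L
  rw [mul_apply, mul_apply, mul_apply,
    ← finsum_add_distrib (mulTerm_support_finite f g L) (mulTerm_support_finite f h L)]
  refine finsum_congr fun t => ?_
  simp [mulTerm, add_mul, mul_add]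

protected theorem smul_mul (c : ℂ) (f g : PsiDif n) : (c • f) * g = c • (f * g) := by
  ext L
  change _ = c • (f * g).1 L
  rw [mul_apply, mul_apply, smul_finsum]
  refine finsum_congr fun t => ?_
  simp [mulTerm, mul_assoc]

protected theorem mul_smul (c : ℂ) (f g : PsiDif n) : f * (c • g) = c • (f * g) := by
  ext L
  change _ = c • (f * g).1 L
  rw [mul_apply, mul_apply, smul_finsum]
  refine finsum_congr fun t => ?_
  simp only [mulTerm, SetLike.val_smul, Pi.smul_apply, smul_eq_mul]
  ring

theorem tsum_eq_of_fiber (u v : (Fin n → ℕ) × (Fin n → ℕ) → ℂ)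
    (hu : (Function.support u).Finite) (hv : (Function.support v).Finite)
    (huv : ∀ N : Fin n → ℕ,
      ∑ q ∈ Fintype.piFinset (fun i => Finset.HasAntidiagonal.antidiagonal (N i)),
        u (fun i => (q i).1, fun i => (q i).2) =
      ∑ q ∈ Fintype.piFinset (fun i => Finset.HasAntidiagonal.antidiagonal (N i)),
        v (fun i => (q i).1, fun i => (q i).2)) :
    ∑' p, u p = ∑' p, v p := by
  have key : ∀ w : (Fin n → ℕ) × (Fin n → ℕ) → ℂ, (Function.support w).Finite →
      ∑' p, w p = ∑' N : Fin n → ℕ,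
        ∑ q ∈ Fintype.piFinset (fun i => Finset.HasAntidiagonal.antidiagonal (N i)),
        w (fun i => (q i).1, fun i => (q i).2) := by
    intro w hw
    have hs : Summable w := summable_of_hasFiniteSupport hw
    let e : (Fin n → ℕ × ℕ) ≃ (Fin n → ℕ) × (Fin n → ℕ) :=
      ⟨fun q => (fun i => (q i).1, fun i => (q i).2), fun p i => (p.1 i, p.2 i),
        fun _ => rfl, fun _ => rfl⟩
    let φ : (Fin n → ℕ × ℕ) → (Fin n → ℕ) := fun q i => (q i).1 + (q i).2
    have hs1 : Summable (fun q => w (e q)) := e.summable_iff.mpr hs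
    have hs2 : Summable (fun z => w (e (Equiv.sigmaFiberEquiv φ z))) :=
      (Equiv.sigmaFiberEquiv φ).summable_iff.mpr hs1
    rw [← e.tsum_eq w, ← (Equiv.sigmaFiberEquiv φ).tsum_eq (fun q => w (e q)), hs2.tsum_sigma]
    refine tsum_congr fun N => ?_
    have hset : {q | φ q = N} =
        ↑(Fintype.piFinset (fun i => Finset.HasAntidiagonal.antidiagonal (N i))) := by
      ext q
      simp [φ, funext_iff]
    change ∑' c : {q | φ q = N}, (fun q => w (e q)) c = _
    rw [hset, Finset.tsum_subtype' _ (fun q => w (e q))]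
    rfl
  rw [key u hu, key v hv]
  exact tsum_congr huv

theorem structConst_assoc (b d c e : Fin n → ℤ) (M : Fin n → ℕ) :
    ∑ q ∈ Fintype.piFinset (fun i => Finset.HasAntidiagonal.antidiagonal (M i)),
      structConst b c (fun i => (q i).1) *
        structConst (fun i => b i + d i - (q i).1) e (fun i => (q i).2) =
    ∑ q ∈ Fintype.piFinset (fun i => Finset.HasAntidiagonal.antidiagonal (M i)),
      structConst b (fun i => c i + e i - (q i).2) (fun i => (q i).1) *
        structConst d e (fun i => (q i).2) := by
  simp only [structConst, ← Finset.prod_mul_distrib]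
  rw [← Finset.prod_univ_sum (fun i => Finset.HasAntidiagonal.antidiagonal (M i))
    (fun i (p : ℕ × ℕ) => fallFact (b i) p.1 * fallFact (c i) p.1 / p.1.factorial *
      (fallFact ((b i + d i - p.1 : ℤ) : ℂ) p.2 * fallFact (e i) p.2 / p.2.factorial)),
    ← Finset.prod_univ_sum (fun i => Finset.HasAntidiagonal.antidiagonal (M i))
    (fun i (p : ℕ × ℕ) => fallFact (b i) p.1 * fallFact ((c i + e i - p.2 : ℤ) : ℂ) p.1 /
      p.1.factorial * (fallFact (d i) p.2 * fallFact (e i) p.2 / p.2.factorial))]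
  refine Finset.prod_congr rfl fun i _ => ?_
  push_cast
  exact fallFact_assoc _ _ _ _ _

theorem finite_quad (f g h : PsiDif n) (L : MonExp n) :
    {t : (MonExp n × MonExp n) × ((Fin n → ℕ) × (Fin n → ℕ)) | f.1 t.1.1 ≠ 0 ∧ g.1 t.1.2 ≠ 0 ∧
      h.1 (L - t.1.1 - t.1.2 + diagExp (t.2.1 + t.2.2)) ≠ 0}.Finite := by
  obtain ⟨B, hB⟩ : ∃ B : ℤ, ∀ i, B ≤ L.2 i := by
    obtain ⟨B, hB⟩ := (Set.finite_range L.2).bddBelow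
    exact ⟨B, fun i => hB ⟨i, rfl⟩⟩
  refine ((finite_triple f g h B).biUnion fun t _ =>
    ((Set.finite_singleton (t.1.1, t.1.2.1)).prod
      ((Set.finite_Iic t.2).prod (Set.finite_Iic t.2)))).subset ?_
  rintro ⟨⟨P, Q⟩, ⟨k, l⟩⟩ ⟨h1, h2, h3⟩
  simp only [Set.mem_iUnion]
  refine ⟨((P, Q, L - P - Q + diagExp (k + l)), k + l), ⟨h1, h2, h3, fun i => ?_⟩, rfl, ?_, ?_⟩
  · have : P + Q + (L - P - Q + diagExp (k + l)) - diagExp (k + l) = L := by abel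
    simpa [this] using hB i
  · exact fun i => Nat.le_add_right _ _
  · exact fun i => Nat.le_add_left _ _

protected theorem mul_assoc (f g h : PsiDif n) : f * g * h = f * (g * h) := by
  ext L
  set U : (MonExp n × MonExp n) × ((Fin n → ℕ) × (Fin n → ℕ)) → ℂ := fun t =>
    f.1 t.1.1 * g.1 t.1.2 * h.1 (L - t.1.1 - t.1.2 + diagExp (t.2.1 + t.2.2)) *
      (structConst t.1.1.2 t.1.2.1 t.2.1 *
        structConst (fun i => t.1.1.2 i + t.1.2.2 i - t.2.1 i)
          (L - t.1.1 - t.1.2 + diagExp (t.2.1 + t.2.2)).1 t.2.2) with hU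
  set V : (MonExp n × MonExp n) × ((Fin n → ℕ) × (Fin n → ℕ)) → ℂ := fun t =>
    f.1 t.1.1 * g.1 t.1.2 * h.1 (L - t.1.1 - t.1.2 + diagExp (t.2.1 + t.2.2)) *
      (structConst t.1.1.2
        (fun i => t.1.2.1 i + (L - t.1.1 - t.1.2 + diagExp (t.2.1 + t.2.2)).1 i - t.2.2 i) t.2.1 *
        structConst t.1.2.2 (L - t.1.1 - t.1.2 + diagExp (t.2.1 + t.2.2)).1 t.2.2) with hV
  have hUf : (Function.support U).Finite := (finite_quad f g h L).subset fun t ht =>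
    ⟨left_ne_zero_of_mul (left_ne_zero_of_mul (left_ne_zero_of_mul ht)),
      right_ne_zero_of_mul (left_ne_zero_of_mul (left_ne_zero_of_mul ht)),
      right_ne_zero_of_mul (left_ne_zero_of_mul ht)⟩
  have hVf : (Function.support V).Finite := (finite_quad f g h L).subset fun t ht =>
    ⟨left_ne_zero_of_mul (left_ne_zero_of_mul (left_ne_zero_of_mul ht)),
      right_ne_zero_of_mul (left_ne_zero_of_mul (left_ne_zero_of_mul ht)),
      right_ne_zero_of_mul (left_ne_zero_of_mul ht)⟩
  have hUs : Summable U := summable_of_hasFiniteSupport hUf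
  have hVs : Summable V := summable_of_hasFiniteSupport hVf
  have hUV : ∑' t, U t = ∑' t, V t := by
    rw [hUs.tsum_prod, hVs.tsum_prod]
    refine tsum_congr fun ⟨P, Q⟩ => ?_
    refine tsum_eq_of_fiber (fun p => U ((P, Q), p)) (fun p => V ((P, Q), p))
      (hUf.preimage (Prod.mk_right_injective _).injOn)
      (hVf.preimage (Prod.mk_right_injective _).injOn) fun M => ?_
    have hM : ∀ q ∈ Fintype.piFinset (fun i => Finset.HasAntidiagonal.antidiagonal (M i)),
        ((fun i => (q i).1) + fun i => (q i).2 : Fin n → ℕ) = M := by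
      intro q hq
      ext i
      simpa using Fintype.mem_piFinset.mp hq i
    have e1 : ∀ q ∈ Fintype.piFinset (fun i => Finset.HasAntidiagonal.antidiagonal (M i)),
        U ((P, Q), (fun i => (q i).1, fun i => (q i).2)) =
        f.1 P * g.1 Q * h.1 (L - P - Q + diagExp M) *
          (structConst P.2 Q.1 (fun i => (q i).1) *
            structConst (fun i => P.2 i + Q.2 i - (q i).1) (L - P - Q + diagExp M).1
              (fun i => (q i).2)) := by
      intro q hq
      simp only [hU, hM q hq]
    have e2 : ∀ q ∈ Fintype.piFinset (fun i => Finset.HasAntidiagonal.antidiagonal (M i)),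
        V ((P, Q), (fun i => (q i).1, fun i => (q i).2)) =
        f.1 P * g.1 Q * h.1 (L - P - Q + diagExp M) *
          (structConst P.2 (fun i => Q.1 i + (L - P - Q + diagExp M).1 i - (q i).2)
            (fun i => (q i).1) *
            structConst Q.2 (L - P - Q + diagExp M).1 (fun i => (q i).2)) := by
      intro q hq
      simp only [hV, hM q hq]
    rw [Finset.sum_congr rfl e1, Finset.sum_congr rfl e2, ← Finset.mul_sum, ← Finset.mul_sum,
      structConst_assoc]
  have hl : (f * g * h).1 L = ∑' t, U t := by
    let e : (MonExp n × MonExp n) × ((Fin n → ℕ) × (Fin n → ℕ)) ≃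
        (MonExp n × (Fin n → ℕ)) × (MonExp n × (Fin n → ℕ)) :=
      ⟨fun t => ((t.1.1 + t.1.2 - diagExp t.2.1, t.2.2), (t.1.1, t.2.1)),
        fun s => ((s.2.1, s.1.1 - s.2.1 + diagExp s.2.2), (s.2.2, s.1.2)),
        fun t => by ext <;> simp <;> abel, fun s => by ext <;> simp <;> abel⟩
    let G : (MonExp n × (Fin n → ℕ)) × (MonExp n × (Fin n → ℕ)) → ℂ := fun s =>
      mulTerm f.1 g.1 s.1.1 s.2 * (h.1 (L - s.1.1 + diagExp s.1.2) *
        structConst s.1.1.2 (L - s.1.1 + diagExp s.1.2).1 s.1.2)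
    have hG : ∀ t, G (e t) = U t := by
      rintro ⟨⟨P, Q⟩, ⟨k, l⟩⟩
      have h1 : P + Q - diagExp k - P + diagExp k = Q := by abel
      have h2 : L - (P + Q - diagExp k) + diagExp l = L - P - Q + diagExp (k + l) := by
        rw [diagExp_add]; abel
      have h3 : (P + Q - diagExp k).2 = fun i => P.2 i + Q.2 i - (k i : ℤ) := rfl
      simp only [G, e, Equiv.coe_fn_mk, mulTerm, hU, h1, h2, h3]
      ring
    have hGs : Summable G := e.summable_iff.mp (hUs.congr fun t => (hG t).symm)
    rw [mul_apply, ← tsum_eq_finsum (L := SummationFilter.unconditional _)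
      (mulTerm_support_finite (f * g) h L)]
    rw [← tsum_congr hG, e.tsum_eq G, hGs.tsum_prod]
    refine tsum_congr fun t => ?_
    rw [mulTerm, mul_apply, ← tsum_eq_finsum (L := SummationFilter.unconditional _)
      (mulTerm_support_finite f g t.1), mul_assoc, ← tsum_mul_right]
  have hr : (f * (g * h)).1 L = ∑' t, V t := by
    let e : (MonExp n × MonExp n) × ((Fin n → ℕ) × (Fin n → ℕ)) ≃
        (MonExp n × (Fin n → ℕ)) × (MonExp n × (Fin n → ℕ)) :=
      ⟨fun t => ((t.1.1, t.2.1), (t.1.2, t.2.2)),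
        fun s => ((s.1.1, s.2.1), (s.1.2, s.2.2)), fun _ => rfl, fun _ => rfl⟩
    let G : (MonExp n × (Fin n → ℕ)) × (MonExp n × (Fin n → ℕ)) → ℂ := fun s =>
      (f.1 s.1.1 * structConst s.1.1.2 (L - s.1.1 + diagExp s.1.2).1 s.1.2) *
        mulTerm g.1 h.1 (L - s.1.1 + diagExp s.1.2) s.2
    have hG : ∀ t, G (e t) = V t := by
      rintro ⟨⟨P, Q⟩, ⟨k, l⟩⟩
      have h2 : L - P + diagExp k - Q + diagExp l = L - P - Q + diagExp (k + l) := by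
        rw [diagExp_add]; abel
      have h3 : (fun i => Q.1 i + (L - P - Q + diagExp (k + l)).1 i - (l i : ℤ)) =
          (L - P + diagExp k).1 := by
        ext i
        simp [diagExp]
        abel
      simp only [G, e, Equiv.coe_fn_mk, mulTerm, hV, h2, h3]
      ring
    have hGs : Summable G := e.summable_iff.mp (hVs.congr fun t => (hG t).symm)
    rw [mul_apply, ← tsum_eq_finsum (L := SummationFilter.unconditional _)
      (mulTerm_support_finite f (g * h) L)]
    rw [← tsum_congr hG, e.tsum_eq G, hGs.tsum_prod]
    refine tsum_congr fun t => ?_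
    rw [mulTerm, mul_apply, ← tsum_eq_finsum (L := SummationFilter.unconditional _)
      (mulTerm_support_finite g h _), mul_right_comm, ← tsum_mul_left]
  rw [hl, hr, hUV]

instance : Ring (PsiDif n) :=
  { (inferInstance : AddCommGroup (PsiDif n)), (inferInstance : Mul (PsiDif n)),
    (inferInstance : One (PsiDif n)) with
    mul_assoc := PsiDif.mul_assoc
    one_mul := PsiDif.one_mul
    mul_one := PsiDif.mul_one
    left_distrib := PsiDif.mul_add
    right_distrib := PsiDif.add_mul
    zero_mul := fun f => by simpa using PsiDif.add_mul 0 0 f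
    mul_zero := fun f => by simpa using PsiDif.mul_add f 0 0 }

instance : Algebra ℂ (PsiDif n) :=
  Algebra.ofModule PsiDif.smul_mul (fun c f g => PsiDif.mul_smul c f g)

/-- The operator `x ^ a ∂ ^ b ↦ ∑_{m ≥ 1} w (a, b) m • x ^ (a - m e_i) ∂ ^ (b - m e_i)`, extended to
formal series coefficientwise (`m = k + 1` below). -/
def lowering (i : Fin n) (w : MonExp n → ℕ → ℂ) : PsiDif n →ₗ[ℂ] PsiDif n where
  toFun f := ⟨fun L => ∑ᶠ k : ℕ, w (L + diagExp (Pi.single i (k + 1))) (k + 1) *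
      f.1 (L + diagExp (Pi.single i (k + 1))), by
    have key : ∀ L, (∑ᶠ k : ℕ, w (L + diagExp (Pi.single i (k + 1))) (k + 1) *
        f.1 (L + diagExp (Pi.single i (k + 1)))) ≠ 0 →
        ∃ k : ℕ, f.1 (L + diagExp (Pi.single i (k + 1))) ≠ 0 := by
      intro L h
      by_contra! h0
      exact h (by simp [h0])
    obtain ⟨⟨N, hN⟩, hf⟩ := f.2
    constructor
    · refine ⟨N, fun L h j => ?_⟩
      obtain ⟨k, hk⟩ := key L h
      have := hN _ hk j
      simp only [diagExp, Prod.snd_add, Pi.add_apply] at this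
      omega
    · intro b
      obtain ⟨B, hB⟩ : ∃ B : ℤ, ∀ i, B ≤ b i := by
        obtain ⟨B, hB⟩ := (Set.finite_range b).bddBelow
        exact ⟨B, fun i => hB ⟨i, rfl⟩⟩
      refine (((finite_ge f B).prod (Set.finite_Iic (N - B).toNat)).image
        fun t => (t.1 - diagExp (Pi.single i (t.2 + 1))).1).subset ?_
      intro a h
      obtain ⟨k, hk⟩ := key (a, b) h
      refine ⟨((a, b) + diagExp (Pi.single i (k + 1)), k), ⟨⟨hk, fun j => ?_⟩, ?_⟩, by simp⟩
      · have := hB j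
        simp only [diagExp, Prod.snd_add, Pi.add_apply]
        omega
      · have h1 := hN _ hk i
        have h2 := hB i
        simp only [diagExp, Prod.snd_add, Pi.add_apply, Pi.single_eq_same] at h1
        push_cast at h1
        change k ≤ (N - B).toNat
        omega⟩
  map_add' f g := by
    have hfin : ∀ (f : PsiDif n) (L : MonExp n), (Function.support fun k : ℕ =>
        w (L + diagExp (Pi.single i (k + 1))) (k + 1) *
          f.1 (L + diagExp (Pi.single i (k + 1)))).Finite := by
      intro f L
      obtain ⟨⟨N, hN⟩, hf⟩ := f.2
      refine (Set.finite_Iic (N - L.2 i).toNat).subset fun k hk => ?_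
      have h1 := hN _ (right_ne_zero_of_mul hk) i
      simp only [diagExp, Prod.snd_add, Pi.add_apply, Pi.single_eq_same] at h1
      push_cast at h1
      change k ≤ (N - L.2 i).toNat
      omega
    ext L
    refine Eq.trans (finsum_congr fun k => ?_) (finsum_add_distrib (hfin f L) (hfin g L))
    simp [mul_add]
  map_smul' c f := by
    ext L
    refine Eq.trans (finsum_congr fun k => ?_) (smul_finsum c _).symm
    simp only [SetLike.val_smul, Pi.smul_apply, smul_eq_mul]
    ring

/-- The derivation `ln ∂_i`, acting by the commutator `[ln ∂_i, f]`:
`f ↦ ∑_{m ≥ 1} ((-1) ^ (m - 1) / m) (∂_x_i ^ m f) ∂_i ^ (-m)`. -/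
def lnD (i : Fin n) : PsiDif n →ₗ[ℂ] PsiDif n :=
  lowering i fun P m => (-1) ^ (m + 1) / m * fallFact (P.1 i) m

/-- The derivation `ln x_i`, acting by the commutator `[ln x_i, f]`:
`f ↦ - ∑_{m ≥ 1} (1 / m!) (∂_ξ_i ^ m f) (∂_x_i ^ m ln x_i)`, that is,
`f ↦ ∑_{m ≥ 1} ((-1) ^ m / m) x_i ^ (-m) (∂_ξ_i ^ m f)`. -/
def lnX (i : Fin n) : PsiDif n →ₗ[ℂ] PsiDif n :=
  lowering i fun P m => (-1) ^ m / m * fallFact (P.2 i) m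

/-- The noncommutative residue: the coefficient of `x₁⁻¹ ⋯ xₙ⁻¹ ∂₁⁻¹ ⋯ ∂ₙ⁻¹`. -/
def residue : PsiDif n →ₗ[ℂ] ℂ where
  toFun f := f.1 (-1, -1)
  map_add' _ _ := rfl
  map_smul' _ _ := rfl

/-- The operator `x_i`. -/
def varX (i : Fin n) : PsiDif n := monomial (Pi.single i 1) 0 1

/-- The operator `∂_i`. -/
def varD (i : Fin n) : PsiDif n := monomial 0 (Pi.single i 1) 1

/-- The four derivations `ln ∂₁, ln x₁, ln ∂₂, ln x₂` of the pseudodifferential operators on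
`(S¹)²`. -/
def logDerivations : Fin 4 → PsiDif 2 →ₗ[ℂ] PsiDif 2 := ![lnD 0, lnX 0, lnD 1, lnX 1]

end PsiDif

/-! ### Lie algebra cochains of an associative algebra -/

section Cochains

variable {A : Type*} [NonUnitalRing A] [Module ℂ A] [IsScalarTower ℂ A A] [SMulCommClass ℂ A A]
variable {M : Type*} [AddCommGroup M] [Module ℂ M]

/-- The Chevalley–Eilenberg differential of the Lie algebra `A` (with bracket
`⁅a, b⁆ = a * b - b * a`) with coefficients in `M`, on which `A` acts by `ρ`:
`(d f)(v₀, …, vₙ) = ∑_i (-1)^i ρ(v_i) f(…, v̂_i, …) + ∑_{i<j} (-1)^{i+j} f(⁅v_i, v_j⁆, …, v̂_i, …, v̂_j, …)`.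
In the second sum `⁅v_i, v_j⁆` is moved from the front to the place of `v_j`, which turns the sign
into `(-1)^{i+1}`. -/
def ceDiff {n : ℕ} (ρ : A → M →ₗ[ℂ] M) (f : A [⋀^Fin n]→ₗ[ℂ] M) (v : Fin (n + 1) → A) : M :=
  ∑ i : Fin (n + 1), (-1 : ℂ) ^ (i : ℕ) •
    (ρ (v i) (f (i.removeNth v)) -
      ∑ j ∈ Finset.Ioi i, f (i.removeNth (Function.update v j ⁅v i, v j⁆)))

/-- `f` is a cocycle. -/
def IsCocycle {n : ℕ} (ρ : A → M →ₗ[ℂ] M) (f : A [⋀^Fin n]→ₗ[ℂ] M) : Prop :=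
  ∀ v, ceDiff ρ f v = 0

/-- `f` is a coboundary (is cohomologous to zero). -/
def IsCoboundary {n : ℕ} (ρ : A → M →ₗ[ℂ] M) (f : A [⋀^Fin (n + 1)]→ₗ[ℂ] M) : Prop :=
  ∃ g : A [⋀^Fin n]→ₗ[ℂ] M, ∀ v, f v = ceDiff ρ g v

/-- `f` and `g` differ by a coboundary. -/
def Cohomologous {n : ℕ} (ρ : A → M →ₗ[ℂ] M) (f g : A [⋀^Fin (n + 1)]→ₗ[ℂ] M) : Prop :=
  IsCoboundary ρ (f - g)

/-- The trivial module `ℂ`. -/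
def trivialAction : A → ℂ →ₗ[ℂ] ℂ := fun _ => 0

/-- The coadjoint action `(a · φ) b = φ [b, a] = - φ [a, b]`. -/
def coadjoint (a : A) : Module.Dual ℂ A →ₗ[ℂ] Module.Dual ℂ A :=
  Module.Dual.transpose (R := ℂ) (LinearMap.mulRight ℂ a - LinearMap.mulLeft ℂ a)

/-- The canonical map from `(n+1)`-cochains with values in `ℂ` to `n`-cochains with values in the
coadjoint module `A*`: `θ(f)(v₁, …, vₙ)(a) = f(v₁, …, vₙ, a)`. -/
def theta {n : ℕ} (f : A [⋀^Fin (n + 1)]→ₗ[ℂ] ℂ) : A [⋀^Fin n]→ₗ[ℂ] Module.Dual ℂ A where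
  toFun v :=
    { toFun := fun a => f (Fin.snoc v a)
      map_add' := fun a b => by
        have := f.map_update_add (Fin.snoc v 0) (Fin.last n) a b
        simpa only [Fin.update_snoc_last] using this
      map_smul' := fun c a => by
        have := f.map_update_smul (Fin.snoc v 0) (Fin.last n) c a
        simpa only [Fin.update_snoc_last, RingHom.id_apply] using this }
  map_update_add' := by
    intro inst v i x y
    obtain rfl : inst = instDecidableEqFin n := Subsingleton.elim _ _
    ext a
    have := f.map_update_add (Fin.snoc v a) i.castSucc x y
    simp only [← Fin.snoc_update] at this
    exact this
  map_update_smul' := by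
    intro inst v i c x
    obtain rfl : inst = instDecidableEqFin n := Subsingleton.elim _ _
    ext a
    have := f.map_update_smul (Fin.snoc v a) i.castSucc c x
    simp only [← Fin.snoc_update] at this
    exact this
  map_eq_zero_of_eq' v i j h hij := by
    ext a
    exact f.map_eq_zero_of_eq (Fin.snoc v a) (i := i.castSucc) (j := j.castSucc) (by simpa using h)
      (by simpa using hij)

/-- `(a₁, …, a₄) ↦ L₁ a₁ ⋯ L₄ a₄`. -/
def prod4 (L : Fin 4 → A →ₗ[ℂ] A) : MultilinearMap ℂ (fun _ : Fin 4 => A) A where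
  toFun a := L 0 (a 0) * L 1 (a 1) * L 2 (a 2) * L 3 (a 3)
  map_update_add' := by
    intro inst a i x y
    obtain rfl : inst = instDecidableEqFin 4 := Subsingleton.elim _ _
    have hi : i = 0 ∨ i = 1 ∨ i = 2 ∨ i = 3 := by omega
    rcases hi with rfl | rfl | rfl | rfl <;> simp [mul_add, add_mul]
  map_update_smul' := by
    intro inst a i c x
    obtain rfl : inst = instDecidableEqFin 4 := Subsingleton.elim _ _
    have hi : i = 0 ∨ i = 1 ∨ i = 2 ∨ i = 3 := by omega
    rcases hi with rfl | rfl | rfl | rfl <;> simp [mul_smul_comm, smul_mul_assoc]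

/-- `(a₁, …, a₅) ↦ L₁ a₁ ⋯ L₅ a₅`. -/
def prod5 (L : Fin 5 → A →ₗ[ℂ] A) : MultilinearMap ℂ (fun _ : Fin 5 => A) A where
  toFun a := L 0 (a 0) * L 1 (a 1) * L 2 (a 2) * L 3 (a 3) * L 4 (a 4)
  map_update_add' := by
    intro inst a i x y
    obtain rfl : inst = instDecidableEqFin 5 := Subsingleton.elim _ _
    have hi : i = 0 ∨ i = 1 ∨ i = 2 ∨ i = 3 ∨ i = 4 := by omega
    rcases hi with rfl | rfl | rfl | rfl | rfl <;> simp [mul_add, add_mul]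
  map_update_smul' := by
    intro inst a i c x
    obtain rfl : inst = instDecidableEqFin 5 := Subsingleton.elim _ _
    have hi : i = 0 ∨ i = 1 ∨ i = 2 ∨ i = 3 ∨ i = 4 := by omega
    rcases hi with rfl | rfl | rfl | rfl | rfl <;> simp [mul_smul_comm, smul_mul_assoc]

/-- The alternation `Alt_{A, D}`: the sum over all permutations `τ` of the derivations and all
permutations `σ` of the arguments, with the sign of `τ` and the sign of `σ` (no normalization). -/
def alt {n : ℕ} (F : Equiv.Perm (Fin 4) → MultilinearMap ℂ (fun _ : Fin n => A) A) :
    A [⋀^Fin n]→ₗ[ℂ] A :=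
  ∑ τ : Equiv.Perm (Fin 4), Equiv.Perm.sign τ • MultilinearMap.alternatization (F τ)

/-- The data of a lifting problem for four derivations: a trace `Tr`, derivations `D i`, and elements
`Q i j`, with (i) `Tr ∘ D i = 0`, (ii) `[D i, D j] = ad (Q i j)`, and
(iii) `Alt_{i,j,k} D k (Q i j) = 0`. -/
structure LiftingConditions (Tr : A →ₗ[ℂ] ℂ) (D : Fin 4 → A →ₗ[ℂ] A) (Q : Fin 4 → Fin 4 → A) :
    Prop where
  trace_comm : ∀ a b, Tr (a * b) = Tr (b * a)
  leibniz : ∀ i a b, D i (a * b) = D i a * b + a * D i b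
  trace_deriv : ∀ i a, Tr (D i a) = 0
  commutator : ∀ i j a, D i (D j a) - D j (D i a) = Q i j * a - a * Q i j
  alt_deriv : ∀ i j k, D k (Q i j) + D i (Q j k) + D j (Q k i)
    - D k (Q j i) - D i (Q k j) - D j (Q i k) = 0

/-- The cochain `Ψ₅`. In the terms with `Q` the indices `i, j` of `Q i j` are not alternated: each
unordered pair `{i, j}` is to be counted once. As `alt` runs over all permutations of the
derivations, and so counts `Q i j` and `- Q j i`, this is the factor `1 / 2` for each `Q`. -/
def psi5 (Tr : A →ₗ[ℂ] ℂ) (D : Fin 4 → A →ₗ[ℂ] A) (Q : Fin 4 → Fin 4 → A) :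
    A [⋀^Fin 5]→ₗ[ℂ] ℂ :=
  let q (i j : Fin 4) : A →ₗ[ℂ] A := LinearMap.mulRight ℂ (Q i j)
  let I : A →ₗ[ℂ] A := LinearMap.id
  Tr.compAlternatingMap
    (alt (fun τ => prod5 ![D (τ 0), D (τ 1), D (τ 2), D (τ 3), I]) +
      (1 / 2 : ℂ) • alt (fun τ => prod5 ![q (τ 0) (τ 1), I, D (τ 2), D (τ 3), I]) +
      (1 / 2 : ℂ) • alt (fun τ => prod5 ![D (τ 0), q (τ 1) (τ 2), I, D (τ 3), I]) +
      (1 / 2 : ℂ) • alt (fun τ => prod5 ![D (τ 0), D (τ 1), q (τ 2) (τ 3), I, I]) +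
      (1 / 4 : ℂ) • alt (fun τ => prod5 ![q (τ 0) (τ 1), I, q (τ 2) (τ 3), I, I]))

/-- The cochain `α(a₁, …, a₄) = Alt_{A, D} D₁ a₁ ⋯ D₄ a₄` with values in the adjoint module `A`. -/
def alpha (D : Fin 4 → A →ₗ[ℂ] A) : A [⋀^Fin 4]→ₗ[ℂ] A :=
  alt (fun τ => prod4 (fun i => D (τ i)))

/-- The cochain `α*` with values in the coadjoint module `A*`, obtained from `α` by the invariant form
`⟨a, b⟩ = Tr (a * b)`: `α*(a₁, …, a₄)(b) = Tr (α(a₁, …, a₄) * b)`. -/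
def alphaStar (Tr : A →ₗ[ℂ] ℂ) (D : Fin 4 → A →ₗ[ℂ] A) : A [⋀^Fin 4]→ₗ[ℂ] Module.Dual ℂ A :=
  ((LinearMap.mul ℂ A).compr₂ Tr).compAlternatingMap (alpha D)

end Cochains

end LiftingFormula

end

/-! Think of `D 0, …, D 3` as a connection ∇ with curvature `Q`. Once the four indices are
alternated, (ii) says that ∇² is half the commutator with `Q` (`altTrace_sq`), (iii) is the Bianchi
identity ∇Q = 0 (`altTrace_bianchi`), and (i) allows integration by parts under the trace
(`altTrace_by_parts`). Let C(a₁, …, a₄) be the sum of ∇a₁∇a₂∇a₃∇a₄ and all words obtained from it by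
replacing neighbours ∇a∇b by ½ aQb (`curvedProd`); then Ψ₅ is the alternation of Tr(C(a₁, …, a₄) a₅)
over five arguments.

The main point is that alternating over five arguments gives just five times the alternation over
the first four. The permutations of five arguments are sorted by the place of the last one, which
leaves a sum over five cyclic rotations, all of them even (`sum_perm_five_eq_sum_rotations`). In
each rotation the cyclicity of the trace moves a₅ to the end, integration by parts removes a
derivative from a₅, and the Leibniz rule then produces only squares of ∇, derivatives of `Q` and
words of the same kind. With the weights ½ and ¼ all superfluous words cancel
(`altTrace_rotations`). Hence θ(Ψ₅) = 5 Tr(Alt C · a₅) as cochains (`theta_psi5`).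

Alternation and the trace pairing carry the Hochschild coboundary to the Chevalley–Eilenberg
differential (`ceDiff_coadjoint_alternatization`). C is a sum of cup products of the Hochschild
cocycles a ↦ Da and (a, b) ↦ aQb, so it is closed, and θ(Ψ₅) is a cocycle. As θ is a chain map and
every tuple of arguments is of the form (v, b), Ψ₅ is a cocycle too. Moreover aQb is the coboundary
of a ↦ Qa, so C differs from D₁a₁⋯D₄a₄ by the coboundary of an explicit `transgression`; this yields
the comparison with 5α*.

For pseudodifferential operators, a linear map that is continuous with respect to the order in ∂ is
determined by its values on monomials, and monomials are generated by `x_j`, `∂_j` and their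
inverses. The trace property, the Leibniz rules and the commutation relations thus reduce to checks
on generators. The curvature is ± the series `logCommutator`.

Nontriviality is a computation valid for every admissible `Q`. Evaluate θ(Ψ₅) = 5α* + 5
d(transgression) on (x₁, ∂₁, x₂, ∂₂) and then on 1. The term α* gives 24. As 1 is central and the
only nonzero brackets are [x_i, ∂_i] = -1, the differential reduces to the alternated transgression
at (1, x_i, ∂_i), which is -8 for each i; the residues in it depend on `Q` only through its
commutators with the generators, fixed by (ii). So the value is 5(24 - 16) = 40, and Ψ₅(1, x₁, x₂,
∂₁, ∂₂) = -40. Every coboundary with trivial coefficients vanishes on this tuple, because all its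
brackets are multiples of 1, and 1 is already an argument. -/

noncomputable section

namespace LiftingFormula

/-! ### Signed sums over permutations, sorted by one value -/

section Insertion

/-- The permutation of `Fin (n + 1)` that sends `p` to `i` and acts as `σ` on the complements. -/
def insertPerm {n : ℕ} (p i : Fin (n + 1)) (σ : Equiv.Perm (Fin n)) :
    Equiv.Perm (Fin (n + 1)) :=
  i.cycleRange.symm * Equiv.Perm.decomposeFin.symm (0, σ) * p.cycleRange

theorem insertPerm_self {n : ℕ} (p i : Fin (n + 1)) (σ : Equiv.Perm (Fin n)) :
    insertPerm p i σ p = i := by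
  simp [insertPerm]

theorem insertPerm_succAbove {n : ℕ} (p i : Fin (n + 1)) (σ : Equiv.Perm (Fin n)) (k : Fin n) :
    insertPerm p i σ (p.succAbove k) = i.succAbove (σ k) := by
  simp [insertPerm, Fin.cycleRange_succAbove]

theorem sign_insertPerm {n : ℕ} (p i : Fin (n + 1)) (σ : Equiv.Perm (Fin n)) :
    Equiv.Perm.sign (insertPerm p i σ) =
      (-1) ^ (i : ℕ) * (-1) ^ (p : ℕ) * Equiv.Perm.sign σ := by
  simp [insertPerm, Fin.sign_cycleRange, mul_right_comm]

/-- The value at `p` recovers `i` and the remaining values recover `σ`; surjectivity is the count (n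
+ 1)! = (n + 1) · n!. -/
theorem insertPerm_bijective {n : ℕ} (p : Fin (n + 1)) :
    Function.Bijective fun x : Fin (n + 1) × Equiv.Perm (Fin n) => insertPerm p x.1 x.2 := by
  rw [Fintype.bijective_iff_injective_and_card]
  constructor
  · rintro ⟨i, σ⟩ ⟨j, τ⟩ h
    have hij : i = j := by
      rw [← insertPerm_self p i σ, ← insertPerm_self p j τ]
      exact congrArg (fun e : Equiv.Perm (Fin (n + 1)) => e p) h
    subst hij
    refine Prod.ext rfl (Equiv.ext fun k => ?_)
    have := congrArg (fun e : Equiv.Perm (Fin (n + 1)) => e (p.succAbove k)) h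
    simpa [insertPerm_succAbove] using this
  · simp [Fintype.card_perm, Nat.factorial_succ]

/-- A signed sum over the permutations of `Fin (n + 1)`, sorted by their value at `p`. -/
theorem sum_perm_eq_sum_insertNth {n : ℕ} {X M : Type*} [AddCommGroup M] (p : Fin (n + 1))
    (v : Fin (n + 1) → X) (G : (Fin (n + 1) → X) → M) :
    ∑ σ : Equiv.Perm (Fin (n + 1)), Equiv.Perm.sign σ • G (v ∘ σ) =
      ∑ i : Fin (n + 1), ((-1 : ℤˣ) ^ (i : ℕ) * (-1) ^ (p : ℕ)) •
        ∑ σ : Equiv.Perm (Fin n), Equiv.Perm.sign σ •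
          G (p.insertNth (v i) (i.removeNth v ∘ σ)) := by
  rw [← (insertPerm_bijective p).sum_comp (fun σ => Equiv.Perm.sign σ • G (v ∘ σ)),
    Fintype.sum_prod_type]
  refine Finset.sum_congr rfl fun i _ => ?_
  rw [Finset.smul_sum]
  refine Finset.sum_congr rfl fun σ _ => ?_
  rw [sign_insertPerm, mul_smul _ (Equiv.Perm.sign σ)]
  congr 3
  rw [Fin.eq_insertNth_iff]
  refine ⟨by simp [insertPerm_self], funext fun k => ?_⟩
  simp [Fin.removeNth, insertPerm_succAbove]

theorem neg_one_pow_smul_eq {M : Type*} [AddCommGroup M] [Module ℂ M] (k : ℕ) (x : M) :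
    ((-1 : ℂ) ^ k) • x = ((-1 : ℤˣ) ^ k) • x := by
  rcases Nat.even_or_odd k with h | h <;> simp [h.neg_one_pow]

end Insertion

/-! ### From the Hochschild coboundary to the Chevalley–Eilenberg differential -/

section Hochschild

variable {A : Type*} [NonUnitalRing A] [Module ℂ A]

/-- The tuple with the neighbours at the places `k` and `k + 1` replaced by their product. -/
def contract {X : Type*} [Mul X] {n : ℕ} (k : Fin n) (w : Fin (n + 1) → X) : Fin n → X :=
  Function.update (k.castSucc.removeNth w) k (w k.castSucc * w k.succ)

/-- Together with the next lemma: an entry `a` inserted just before or just after place `k` is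
absorbed as a left or a right factor of the same entry of the same tuple, so that the difference of
the two cases is a bracket. -/
theorem contract_insertNth_castSucc {X : Type*} [Mul X] {n : ℕ} (k : Fin n) (a : X)
    (u : Fin n → X) :
    contract k (k.castSucc.insertNth a u) = Function.update u k (a * u k) := by
  have : (k.castSucc.insertNth a u : Fin (n + 1) → X) k.succ = u k := by
    rw [← Fin.succAbove_castSucc_self, Fin.insertNth_apply_succAbove]
  simp [contract, this]

theorem contract_insertNth_succ {X : Type*} [Mul X] {n : ℕ} (k : Fin n) (a : X)
    (u : Fin n → X) :
    contract k (k.succ.insertNth a u) = Function.update u k (u k * a) := by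
  have h : ∀ m, m ≠ k → k.castSucc.succAbove m = k.succ.succAbove m := by
    intro m hm
    rcases lt_or_gt_of_ne hm with h | h
    · rw [Fin.succAbove_castSucc_of_lt _ _ h, Fin.succAbove_succ_of_le _ _ h.le]
    · rw [Fin.succAbove_castSucc_of_le _ _ h.le, Fin.succAbove_succ_of_lt _ _ h]
  have : (k.succ.insertNth a u : Fin (n + 1) → X) k.castSucc = u k := by
    conv_lhs => rw [← Fin.succAbove_succ_self, Fin.insertNth_apply_succAbove]
  funext m
  by_cases hm : m = k
  · subst hm
    simp [contract, this]
  · simp only [contract, Function.update_of_ne hm, Fin.removeNth, h m hm,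
      Fin.insertNth_apply_succAbove]

theorem comp_insertNth {X : Type*} {n : ℕ} (v : Fin (n + 1) → X)
    (p : Fin (n + 1)) (i : Fin (n + 1)) (σ : Equiv.Perm (Fin n)) :
    v ∘ (p.insertNth i (i.removeNth id ∘ σ) : Fin (n + 1) → Fin (n + 1)) =
      p.insertNth (v i) (i.removeNth v ∘ σ) := by
  rw [Fin.eq_insertNth_iff]
  refine ⟨by simp, funext fun k => ?_⟩
  simp [Fin.removeNth]

/-- The part of the Chevalley–Eilenberg differential made of brackets of the arguments, for the
alternation of a multilinear map. -/
theorem sum_bracket_alternatization {n : ℕ} {M : Type*} [AddCommGroup M] [Module ℂ M]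
    (F : MultilinearMap ℂ (fun _ : Fin n => A) M) (v : Fin (n + 1) → A) :
    ∑ i : Fin (n + 1), (-1 : ℂ) ^ (i : ℕ) • ∑ j ∈ Finset.Ioi i,
      MultilinearMap.alternatization F (i.removeNth (Function.update v j ⁅v i, v j⁆)) =
    ∑ σ : Equiv.Perm (Fin (n + 1)), Equiv.Perm.sign σ •
      ∑ k : Fin n, ((-1 : ℤˣ) ^ (k : ℕ)) • F (contract k (v ∘ σ)) := by
  have hr : ∀ k : Fin n, ∑ σ : Equiv.Perm (Fin (n + 1)), Equiv.Perm.sign σ • F (contract k (v ∘ σ))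
      = (∑ i : Fin (n + 1), ((-1 : ℤˣ) ^ (i : ℕ) * (-1) ^ (k : ℕ)) •
        ∑ σ : Equiv.Perm (Fin n), Equiv.Perm.sign σ •
          if i < i.succAbove (σ k) then F (Function.update (i.removeNth v ∘ σ) k
            ⁅v i, v (i.succAbove (σ k))⁆) else 0) := by
    intro k
    -- The product at place `k` is split according to whether its left or its right factor has the
    -- smaller original index `i`. Extracting `i` from place `k` or from place `k + 1` gives the two
    -- products of a commutator; the sign between them comes from the shift of the place by one.
    let G₁ : (Fin (n + 1) → Fin (n + 1)) → M := fun s =>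
      if s k.castSucc < s k.succ then F (contract k (v ∘ s)) else 0
    let G₂ : (Fin (n + 1) → Fin (n + 1)) → M := fun s =>
      if s k.succ < s k.castSucc then F (contract k (v ∘ s)) else 0
    have h0 : ∀ σ : Equiv.Perm (Fin (n + 1)), F (contract k (v ∘ σ)) =
        G₁ (id ∘ σ) + G₂ (id ∘ σ) := by
      intro σ
      have hne : σ k.castSucc ≠ σ k.succ := fun h =>
        absurd (σ.injective h) (Fin.castSucc_lt_succ).ne
      rcases lt_or_gt_of_ne hne with h | h
      · simp [G₁, G₂, h, h.le]
      · simp [G₁, G₂, h, h.le]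
    simp only [h0, smul_add, Finset.sum_add_distrib]
    rw [sum_perm_eq_sum_insertNth k.castSucc id G₁, sum_perm_eq_sum_insertNth k.succ id G₂,
      ← Finset.sum_add_distrib]
    refine Finset.sum_congr rfl fun i _ => ?_
    have hs : ((-1 : ℤˣ) ^ (i : ℕ) * (-1) ^ (k.succ : ℕ)) =
        ((-1 : ℤˣ) ^ (i : ℕ) * (-1) ^ (k : ℕ)) * (-1) := by
      rw [Fin.val_succ, pow_succ, mul_assoc]
    rw [hs, mul_smul _ (-1 : ℤˣ), Fin.val_castSucc, ← smul_add]
    congr 1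
    rw [Units.neg_smul, one_smul, ← sub_eq_add_neg, ← Finset.sum_sub_distrib]
    refine Finset.sum_congr rfl fun σ _ => ?_
    rw [← smul_sub]
    congr 1
    have e1 : (k.castSucc.insertNth i (i.removeNth id ∘ σ) : Fin (n + 1) → Fin (n + 1)) k.succ =
        i.succAbove (σ k) := by
      rw [← Fin.succAbove_castSucc_self, Fin.insertNth_apply_succAbove]
      rfl
    have e2 : (k.succ.insertNth i (i.removeNth id ∘ σ) : Fin (n + 1) → Fin (n + 1)) k.castSucc =
        i.succAbove (σ k) := by
      conv_lhs => rw [← Fin.succAbove_succ_self, Fin.insertNth_apply_succAbove]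
      rfl
    simp only [G₁, G₂, id, e1, e2, Fin.insertNth_apply_same, comp_insertNth,
      contract_insertNth_castSucc, contract_insertNth_succ]
    split_ifs with h
    · rw [← MultilinearMap.map_update_sub]
      rfl
    · simp
  have hl : ∀ i : Fin (n + 1), ∑ j ∈ Finset.Ioi i,
      MultilinearMap.alternatization F (i.removeNth (Function.update v j ⁅v i, v j⁆)) =
      ∑ k : Fin n, ∑ σ : Equiv.Perm (Fin n), Equiv.Perm.sign σ •
          if i < i.succAbove (σ k) then F (Function.update (i.removeNth v ∘ σ) k
            ⁅v i, v (i.succAbove (σ k))⁆) else 0 := by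
    intro i
    have : Finset.Ioi i = Finset.univ.filter (fun j => i < j) := by ext; simp
    rw [this, Finset.sum_filter, Fin.sum_univ_succAbove _ i]
    simp only [lt_irrefl, if_false, zero_add]
    rw [Finset.sum_comm]
    have h1 : ∀ m : Fin n, (if i < i.succAbove m then MultilinearMap.alternatization F
          (i.removeNth (Function.update v (i.succAbove m) ⁅v i, v (i.succAbove m)⁆)) else 0) =
        ∑ σ : Equiv.Perm (Fin n), Equiv.Perm.sign σ • if i < i.succAbove m then
          F (Function.update (i.removeNth v ∘ σ) (σ.symm m) ⁅v i, v (i.succAbove m)⁆) else 0 := by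
      intro m
      split_ifs with h
      · rw [MultilinearMap.alternatization_apply]
        refine Finset.sum_congr rfl fun σ _ => ?_
        congr 1
        have : i.removeNth (Function.update v (i.succAbove m) ⁅v i, v (i.succAbove m)⁆) =
            Function.update (i.removeNth v) m ⁅v i, v (i.succAbove m)⁆ := by
          funext q
          by_cases hq : q = m
          · subst hq; simp [Fin.removeNth]
          · simp [Fin.removeNth, hq]
        rw [this, MultilinearMap.domDomCongr_apply]
        exact congrArg F (Function.update_comp_equiv (i.removeNth v) σ m _)
      · simp
    simp only [h1]
    rw [Finset.sum_comm]
    refine Finset.sum_congr rfl fun σ _ => ?_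
    -- The bracket sits at the place `σ.symm m`; substituting `m = σ k` sorts the sum by this place.
    rw [← Equiv.sum_comp σ]
    simp
  simp only [hl, Finset.smul_sum, neg_one_pow_smul_eq]
  rw [Finset.sum_comm]
  conv_rhs => rw [Finset.sum_comm]
  refine Finset.sum_congr rfl fun k _ => ?_
  have := hr k
  calc _ = ((-1 : ℤˣ) ^ (k : ℕ)) • ∑ σ : Equiv.Perm (Fin (n + 1)),
        Equiv.Perm.sign σ • F (contract k (v ∘ σ)) := by
        rw [this, Finset.smul_sum]
        refine Finset.sum_congr rfl fun i _ => ?_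
        rw [smul_smul, mul_left_comm, Int.units_mul_self, mul_one, Finset.smul_sum]
    _ = _ := by
        rw [Finset.smul_sum]
        refine Finset.sum_congr rfl fun σ _ => ?_
        rw [smul_comm]

variable [IsScalarTower ℂ A A] [SMulCommClass ℂ A A]

/-- The Hochschild coboundary, up to sign, of an `A`-valued multilinear map. -/
def hochDiff {n : ℕ} (F : (Fin n → A) → A) (w : Fin (n + 1) → A) : A :=
  w 0 * F (Fin.tail w) - ∑ k : Fin n, ((-1 : ℤˣ) ^ (k : ℕ)) • F (contract k w) -
    ((-1 : ℤˣ) ^ n) • (F (Fin.init w) * w (Fin.last n))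

/-- The cochain with values in the coadjoint module obtained from a cochain with values in the
adjoint module by the pairing `⟨a, b⟩ = Tr (a * b)`. -/
def traceDual (Tr : A →ₗ[ℂ] ℂ) {n : ℕ} (f : A [⋀^Fin n]→ₗ[ℂ] A) :
    A [⋀^Fin n]→ₗ[ℂ] Module.Dual ℂ A :=
  ((LinearMap.mul ℂ A).compr₂ Tr).compAlternatingMap f

theorem traceDual_apply (Tr : A →ₗ[ℂ] ℂ) {n : ℕ} (f : A [⋀^Fin n]→ₗ[ℂ] A) (v : Fin n → A) (b : A) :
    traceDual Tr f v b = Tr (f v * b) := rfl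

/-- The Chevalley–Eilenberg differential of the alternation of a Hochschild cochain is the
alternation of its Hochschild coboundary. -/
theorem ceDiff_coadjoint_alternatization (Tr : A →ₗ[ℂ] ℂ) (hTr : ∀ a b, Tr (a * b) = Tr (b * a))
    {n : ℕ} (F : MultilinearMap ℂ (fun _ : Fin n => A) A) (v : Fin (n + 1) → A) (b : A) :
    ceDiff coadjoint (traceDual Tr (MultilinearMap.alternatization F)) v b =
      Tr ((∑ σ : Equiv.Perm (Fin (n + 1)), Equiv.Perm.sign σ • hochDiff F (v ∘ σ)) * b) := by
  -- The trace form is invariant, so the coadjoint action on Tr(a ·) is the adjoint action on `a`;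
  -- from here on the computation takes place in `A`.
  have hc : ∀ x a : A, coadjoint x (((LinearMap.mul ℂ A).compr₂ Tr) a) b =
      Tr ((x * a - a * x) * b) := by
    intro x a
    change Tr (a * (b * x - x * b)) = _
    rw [mul_sub, sub_mul, map_sub, map_sub, ← mul_assoc a b x, hTr (a * b) x]
    simp only [mul_assoc]
  have h1 : ceDiff coadjoint (traceDual Tr (MultilinearMap.alternatization F)) v b =
      Tr ((∑ i : Fin (n + 1), (-1 : ℂ) ^ (i : ℕ) •
        (v i * MultilinearMap.alternatization F (i.removeNth v) -
          MultilinearMap.alternatization F (i.removeNth v) * v i -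
          ∑ j ∈ Finset.Ioi i, MultilinearMap.alternatization F
            (i.removeNth (Function.update v j ⁅v i, v j⁆)))) * b) := by
    rw [ceDiff, Finset.sum_mul, map_sum, LinearMap.sum_apply]
    refine Finset.sum_congr rfl fun i _ => ?_
    rw [LinearMap.smul_apply, smul_mul_assoc, map_smul, LinearMap.sub_apply, sub_mul, map_sub,
      LinearMap.sum_apply, Finset.sum_mul, map_sum]
    congr 2
    exact hc _ _
  rw [h1]
  congr 2
  simp only [hochDiff, smul_sub, Finset.sum_sub_distrib, sum_bracket_alternatization]
  rw [sub_right_comm]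
  refine congrArg₂ _ (congrArg₂ _ ?_ rfl) ?_
  · rw [sum_perm_eq_sum_insertNth 0 v fun w => w 0 * F (Fin.tail w)]
    refine Finset.sum_congr rfl fun i _ => ?_
    rw [neg_one_pow_smul_eq, MultilinearMap.alternatization_apply, Finset.mul_sum]
    simp only [Fin.val_zero, pow_zero, mul_one, mul_smul_comm]
    simp [Fin.insertNth_zero', Fin.tail_cons, Function.comp_def]
  · rw [sum_perm_eq_sum_insertNth (Fin.last n) v
      fun w => ((-1 : ℤˣ) ^ n) • (F (Fin.init w) * w (Fin.last n))]
    refine Finset.sum_congr rfl fun i _ => ?_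
    rw [neg_one_pow_smul_eq, MultilinearMap.alternatization_apply, Finset.sum_mul, mul_smul]
    congr 1
    rw [Finset.smul_sum]
    refine Finset.sum_congr rfl fun σ _ => ?_
    rw [Fin.insertNth_last', Fin.init_snoc, Fin.snoc_last, smul_comm, Fin.val_last,
      smul_smul ((-1 : ℤˣ) ^ n) ((-1) ^ n), Int.units_mul_self, one_smul, smul_mul_assoc]
    rfl

end Hochschild

/-! ### Traces alternated over the four indices -/

section AlternatedTrace

variable {A : Type*} [NonUnitalRing A] [Module ℂ A]

/-- The trace of an element depending on four indices, alternated over the indices. -/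
def altTrace (Tr : A →ₗ[ℂ] ℂ) (g : (Fin 4 → Fin 4) → A) : ℂ :=
  ∑ τ : Equiv.Perm (Fin 4), Equiv.Perm.sign τ • Tr (g τ)

variable {Tr : A →ₗ[ℂ] ℂ}

theorem altTrace_add (f g : (Fin 4 → Fin 4) → A) :
    altTrace Tr (fun d => f d + g d) = altTrace Tr f + altTrace Tr g := by
  simp [altTrace, Finset.sum_add_distrib]

theorem altTrace_sub (f g : (Fin 4 → Fin 4) → A) :
    altTrace Tr (fun d => f d - g d) = altTrace Tr f - altTrace Tr g := by
  simp [altTrace, smul_sub, Finset.sum_sub_distrib]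

/-- Substitution of `τ * c` for `τ`. This is how words that differ by a renumbering of the indices
are identified. -/
theorem altTrace_perm (c : Equiv.Perm (Fin 4)) (f g : (Fin 4 → Fin 4) → A)
    (h : ∀ d, f d = g (d ∘ c)) :
    altTrace Tr f = ((Equiv.Perm.sign c : ℤ) : ℂ) * altTrace Tr g := by
  unfold altTrace
  rw [← Equiv.sum_comp (Equiv.mulRight c) (fun τ : Equiv.Perm (Fin 4) =>
    Equiv.Perm.sign τ • Tr (g τ)), Finset.mul_sum]
  refine Finset.sum_congr rfl fun τ _ => ?_
  rw [h]
  simp only [Equiv.coe_mulRight, Equiv.Perm.sign_mul, Equiv.Perm.coe_mul, mul_smul]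
  rcases Int.units_eq_one_or (Equiv.Perm.sign c) with hc | hc <;>
    rcases Int.units_eq_one_or (Equiv.Perm.sign τ) with hτ | hτ <;> simp [hc, hτ]

theorem altTrace_congr {f g : (Fin 4 → Fin 4) → A} (h : ∀ d, Tr (f d) = Tr (g d)) :
    altTrace Tr f = altTrace Tr g :=
  Finset.sum_congr rfl fun τ _ => by rw [h]

end AlternatedTrace

/-! ### Integration by parts, curvature and Bianchi identity -/

section NablaCalculus

variable {A : Type*} [NonUnitalRing A] [Module ℂ A]
variable {Tr : A →ₗ[ℂ] ℂ} {D : Fin 4 → A →ₗ[ℂ] A} {Q : Fin 4 → Fin 4 → A}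

/-- The trace of the total derivative `D (d i) (f d * b)` vanishes for each ordering of the indices
separately. -/
theorem altTrace_by_parts (h : LiftingConditions Tr D Q) (i : Fin 4) (f : (Fin 4 → Fin 4) → A)
    (b : A) :
    altTrace Tr (fun d => f d * D (d i) b) = - altTrace Tr (fun d => D (d i) (f d) * b) := by
  rw [eq_neg_iff_add_eq_zero, ← altTrace_add]
  unfold altTrace
  refine Finset.sum_eq_zero fun τ _ => ?_
  change Equiv.Perm.sign τ • Tr (f τ * D (τ i) b + D (τ i) (f τ) * b) = 0
  rw [add_comm, ← h.leibniz, h.trace_deriv, smul_zero]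

/-- Under alternation the square of the connection is half the commutator with the curvature. -/
theorem altTrace_sq (h : LiftingConditions Tr D Q) (i j : Fin 4) (hij : i ≠ j) (x : A)
    (L : (Fin 4 → Fin 4) → A → A) (hL : ∀ d y z, L d (y - z) = L d y - L d z)
    (hs : ∀ d, L (d ∘ Equiv.swap i j) = L d) :
    altTrace Tr (fun d => L d (D (d i) (D (d j) x))) =
      1 / 2 * (altTrace Tr (fun d => L d (Q (d i) (d j) * x)) -
        altTrace Tr (fun d => L d (x * Q (d i) (d j)))) := by
  -- The context `L` does not see the exchange of the two indices, so exchanging them changes the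
  -- sign: the alternated commutator of the two derivations is twice the alternated square.
  have h1 := altTrace_perm (Tr := Tr) (Equiv.swap i j) (fun d => L d (D (d i) (D (d j) x)))
    (fun d => L d (D (d j) (D (d i) x))) (fun d => by simp [hs])
  rw [Equiv.Perm.sign_swap hij] at h1
  have h2 : altTrace Tr (fun d => L d (Q (d i) (d j) * x)) -
        altTrace Tr (fun d => L d (x * Q (d i) (d j))) =
      altTrace Tr (fun d => L d (D (d i) (D (d j) x))) -
        altTrace Tr (fun d => L d (D (d j) (D (d i) x))) := by
    rw [← altTrace_sub, ← altTrace_sub]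
    simp only [← hL, h.commutator]
  rw [h2]
  push_cast at h1
  linear_combination (1 / 2) * h1

/-- The Bianchi identity under alternation. -/
theorem altTrace_bianchi (h : LiftingConditions Tr D Q) (i j k : Fin 4) (hij : i ≠ j)
    (hik : i ≠ k) (hjk : j ≠ k) (L : (Fin 4 → Fin 4) → A → A)
    (hL : ∀ d y z, L d (y - z) = L d y - L d z)
    (h1 : ∀ d, L (d ∘ Equiv.swap i j) = L d) (h2 : ∀ d, L (d ∘ Equiv.swap j k) = L d) :
    altTrace Tr (fun d => L d (D (d i) (Q (d j) (d k)))) = 0 := by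
  have hL0 : ∀ d, L d 0 = 0 := fun d => by simpa using hL d 0 0
  have hLn : ∀ d y, L d (-y) = - L d y := fun d y => by simpa [hL0] using hL d 0 y
  have hLa : ∀ d y z, L d (y + z) = L d y + L d z := fun d y z => by
    rw [← sub_neg_eq_add, hL, hLn, sub_neg_eq_add]
  set f : Fin 4 → Fin 4 → Fin 4 → ℂ := fun p q r =>
    altTrace Tr (fun d => L d (D (d p) (Q (d q) (d r)))) with hf
  have e1 : ∀ p q r : Fin 4, f p q r = - f (Equiv.swap i j p) (Equiv.swap i j q)
      (Equiv.swap i j r) := by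
    intro p q r
    have := altTrace_perm (Tr := Tr) (Equiv.swap i j) (fun d => L d (D (d (Equiv.swap i j p))
      (Q (d (Equiv.swap i j q)) (d (Equiv.swap i j r)))))
      (fun d => L d (D (d p) (Q (d q) (d r)))) (fun d => by simp [h1])
    rw [Equiv.Perm.sign_swap hij] at this
    simp only [hf, this]
    simp
  have e2 : ∀ p q r : Fin 4, f p q r = - f (Equiv.swap j k p) (Equiv.swap j k q)
      (Equiv.swap j k r) := by
    intro p q r
    have := altTrace_perm (Tr := Tr) (Equiv.swap j k) (fun d => L d (D (d (Equiv.swap j k p))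
      (Q (d (Equiv.swap j k q)) (d (Equiv.swap j k r)))))
      (fun d => L d (D (d p) (Q (d q) (d r)))) (fun d => by simp [h2])
    rw [Equiv.Perm.sign_swap hjk] at this
    simp only [hf, this]
    simp
  have s1 : Equiv.swap i j k = k := Equiv.swap_apply_of_ne_of_ne hik.symm hjk.symm
  have s2 : Equiv.swap j k i = i := Equiv.swap_apply_of_ne_of_ne hij hik
  -- `f` changes sign under the transpositions `(i j)` and `(j k)`, hence is alternating in `i, j,
  -- k`. The six terms of condition (iii) are therefore all equal to `f i j k`, whence the factor 1
  -- / 6 below.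
  have a1 := e1 i j k
  have a2 := e2 i j k
  have a5 := e1 j k i
  have a6 := e2 k i j
  have a7 := e1 k j i
  simp only [Equiv.swap_apply_left, Equiv.swap_apply_right, s1, s2] at a1 a2 a5 a6 a7
  have key : f k i j + f i j k + f j k i - f k j i - f i k j - f j i k = 0 := by
    simp only [hf, ← altTrace_add, ← altTrace_sub, ← hLa, ← hL, h.alt_deriv, hL0]
    simp [altTrace]
  change f i j k = 0
  linear_combination (1 / 6) * (key + a7 - 2 * a6 - a5 + 2 * a2 + 3 * a1)

end NablaCalculus

/-! ### The five cyclic rotations of the curved words -/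

section CyclicRotations

variable {A : Type*} [NonUnitalRing A] [Module ℂ A]
variable {Tr : A →ₗ[ℂ] ℂ} {D : Fin 4 → A →ₗ[ℂ] A} {Q : Fin 4 → Fin 4 → A}

/-- When the Leibniz rule carries the outer derivative `D (d 0)` past `k` other indices, renumbering
the indices in their order of occurrence is a cycle of length `k + 1`, of sign (-1)^k. This lemma
and the next two are `k = 1, 2, 3`. -/
theorem altTrace_cycle1 (f g : (Fin 4 → Fin 4) → A) (h : ∀ d, f d = g (d ∘ Equiv.swap 0 1)) :
    altTrace Tr f = - altTrace Tr g := by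
  rw [altTrace_perm _ f g h, show Equiv.Perm.sign (Equiv.swap (0 : Fin 4) 1) = -1 by decide]
  simp

theorem altTrace_cycle2 (f g : (Fin 4 → Fin 4) → A)
    (h : ∀ d, f d = g (d ∘ (Equiv.swap 0 1 * Equiv.swap 1 2 : Equiv.Perm (Fin 4)))) :
    altTrace Tr f = altTrace Tr g := by
  rw [altTrace_perm _ f g h,
    show Equiv.Perm.sign (Equiv.swap 0 1 * Equiv.swap 1 2 : Equiv.Perm (Fin 4)) = 1 by decide]
  simp

theorem altTrace_cycle3 (f g : (Fin 4 → Fin 4) → A)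
    (h : ∀ d, f d = g (d ∘ (Equiv.swap 0 1 * Equiv.swap 1 2 * Equiv.swap 2 3 :
      Equiv.Perm (Fin 4)))) :
    altTrace Tr f = - altTrace Tr g := by
  rw [altTrace_perm _ f g h, show Equiv.Perm.sign
    (Equiv.swap 0 1 * Equiv.swap 1 2 * Equiv.swap 2 3 : Equiv.Perm (Fin 4)) = -1 by decide]
  simp

/-- A cyclic rotation of a word rotates its four indices; the rotation by one place is a 4-cycle,
hence odd. This and the next two lemmas restore the order of the indices after a use of the
cyclicity of the trace. -/
theorem altTrace_rot1 (f g : (Fin 4 → Fin 4) → A)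
    (h : ∀ d, f d = g (d ∘ Equiv.addRight (1 : Fin 4))) : altTrace Tr f = - altTrace Tr g := by
  rw [altTrace_perm _ f g h, show Equiv.Perm.sign (Equiv.addRight (1 : Fin 4)) = -1 by decide]
  simp

theorem altTrace_rot2 (f g : (Fin 4 → Fin 4) → A)
    (h : ∀ d, f d = g (d ∘ Equiv.addRight (2 : Fin 4))) : altTrace Tr f = altTrace Tr g := by
  rw [altTrace_perm _ f g h, show Equiv.Perm.sign (Equiv.addRight (2 : Fin 4)) = 1 by decide]
  simp

theorem altTrace_rot3 (f g : (Fin 4 → Fin 4) → A)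
    (h : ∀ d, f d = g (d ∘ Equiv.addRight (3 : Fin 4))) : altTrace Tr f = - altTrace Tr g := by
  rw [altTrace_perm _ f g h, show Equiv.Perm.sign (Equiv.addRight (3 : Fin 4)) = -1 by decide]
  simp

variable (a : Fin 4 → A) (b : A)

/-- The suffix spells the differentiated word: `t` is a bare argument, `p` a derivative of an
argument, `Q` a curvature. In this lemma and its companions the Leibniz rule is applied to the outer
`D (d 0)`. On a bare argument it gives a new derivative; on a derivative, a square, to be replaced
by ½ (Qa - aQ); on a curvature, zero by Bianchi. In the proofs `e_j` renumbers the indices for the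
factor number `j`, and `f_j` applies the curvature or Bianchi identity to it. -/
theorem altTrace_nabla_tppp (h : LiftingConditions Tr D Q) :
    altTrace Tr (fun d => D (d 0) (a 0 * (D (d 1) (a 1) * (D (d 2) (a 2) * D (d 3) (a 3)))) * b) =
      altTrace Tr (fun d => D (d 0) (a 0) * (D (d 1) (a 1) * (D (d 2) (a 2) * (D (d 3) (a 3) * b))))
      + 1 / 2 * altTrace Tr (fun d => a 0 * (Q (d 0) (d 1) * (a 1 * (D (d 2) (a 2) * (D (d 3) (a 3) * b)))))
      - 1 / 2 * altTrace Tr (fun d => a 0 * (a 1 * (Q (d 0) (d 1) * (D (d 2) (a 2) * (D (d 3) (a 3) * b)))))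
      - 1 / 2 * altTrace Tr (fun d => a 0 * (D (d 0) (a 1) * (Q (d 1) (d 2) * (a 2 * (D (d 3) (a 3) * b)))))
      + 1 / 2 * altTrace Tr (fun d => a 0 * (D (d 0) (a 1) * (a 2 * (Q (d 1) (d 2) * (D (d 3) (a 3) * b)))))
      + 1 / 2 * altTrace Tr (fun d => a 0 * (D (d 0) (a 1) * (D (d 1) (a 2) * (Q (d 2) (d 3) * (a 3 * b)))))
      - 1 / 2 * altTrace Tr (fun d => a 0 * (D (d 0) (a 1) * (D (d 1) (a 2) * (a 3 * (Q (d 2) (d 3) * b))))) := by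
  have f1 := altTrace_sq h 0 1 (by decide) (a 1)
    (fun d y => a 0 * (y * (D (d 2) (a 2) * (D (d 3) (a 3) * b)))) (fun _ _ _ => by simp only [mul_sub, sub_mul]) (fun _ => rfl)
  have e2 := altTrace_cycle1 (Tr := Tr) (fun d => a 0 * (D (d 1) (a 1) * (D (d 0) (D (d 2) (a 2)) * (D (d 3) (a 3) * b))))
    (fun d => a 0 * (D (d 0) (a 1) * (D (d 1) (D (d 2) (a 2)) * (D (d 3) (a 3) * b)))) (fun _ => rfl)
  have f2 := altTrace_sq h 1 2 (by decide) (a 2)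
    (fun d y => a 0 * (D (d 0) (a 1) * (y * (D (d 3) (a 3) * b)))) (fun _ _ _ => by simp only [mul_sub, sub_mul]) (fun _ => rfl)
  have e3 := altTrace_cycle2 (Tr := Tr) (fun d => a 0 * (D (d 1) (a 1) * (D (d 2) (a 2) * (D (d 0) (D (d 3) (a 3)) * b))))
    (fun d => a 0 * (D (d 0) (a 1) * (D (d 1) (a 2) * (D (d 2) (D (d 3) (a 3)) * b)))) (fun _ => rfl)
  have f3 := altTrace_sq h 2 3 (by decide) (a 3)
    (fun d y => a 0 * (D (d 0) (a 1) * (D (d 1) (a 2) * (y * b)))) (fun _ _ _ => by simp only [mul_sub, sub_mul]) (fun _ => rfl)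
  simp only [h.leibniz, add_mul, mul_add, mul_assoc, altTrace_add] at f1 e2 f2 e3 f3 ⊢
  linear_combination f1 + e2 - f2 + e3 + f3

theorem altTrace_nabla_ptpp (h : LiftingConditions Tr D Q) :
    altTrace Tr (fun d => D (d 0) (D (d 1) (a 0) * (a 1 * (D (d 2) (a 2) * D (d 3) (a 3)))) * b) =
      1 / 2 * altTrace Tr (fun d => Q (d 0) (d 1) * (a 0 * (a 1 * (D (d 2) (a 2) * (D (d 3) (a 3) * b)))))
      - 1 / 2 * altTrace Tr (fun d => a 0 * (Q (d 0) (d 1) * (a 1 * (D (d 2) (a 2) * (D (d 3) (a 3) * b)))))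
      - altTrace Tr (fun d => D (d 0) (a 0) * (D (d 1) (a 1) * (D (d 2) (a 2) * (D (d 3) (a 3) * b))))
      - 1 / 2 * altTrace Tr (fun d => D (d 0) (a 0) * (a 1 * (Q (d 1) (d 2) * (a 2 * (D (d 3) (a 3) * b)))))
      + 1 / 2 * altTrace Tr (fun d => D (d 0) (a 0) * (a 1 * (a 2 * (Q (d 1) (d 2) * (D (d 3) (a 3) * b)))))
      + 1 / 2 * altTrace Tr (fun d => D (d 0) (a 0) * (a 1 * (D (d 1) (a 2) * (Q (d 2) (d 3) * (a 3 * b)))))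
      - 1 / 2 * altTrace Tr (fun d => D (d 0) (a 0) * (a 1 * (D (d 1) (a 2) * (a 3 * (Q (d 2) (d 3) * b))))) := by
  have f0 := altTrace_sq h 0 1 (by decide) (a 0)
    (fun d y => y * (a 1 * (D (d 2) (a 2) * (D (d 3) (a 3) * b)))) (fun _ _ _ => by simp only [sub_mul]) (fun _ => rfl)
  have e1 := altTrace_cycle1 (Tr := Tr) (fun d => D (d 1) (a 0) * (D (d 0) (a 1) * (D (d 2) (a 2) * (D (d 3) (a 3) * b))))
    (fun d => D (d 0) (a 0) * (D (d 1) (a 1) * (D (d 2) (a 2) * (D (d 3) (a 3) * b)))) (fun _ => rfl)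
  have e2 := altTrace_cycle1 (Tr := Tr) (fun d => D (d 1) (a 0) * (a 1 * (D (d 0) (D (d 2) (a 2)) * (D (d 3) (a 3) * b))))
    (fun d => D (d 0) (a 0) * (a 1 * (D (d 1) (D (d 2) (a 2)) * (D (d 3) (a 3) * b)))) (fun _ => rfl)
  have f2 := altTrace_sq h 1 2 (by decide) (a 2)
    (fun d y => D (d 0) (a 0) * (a 1 * (y * (D (d 3) (a 3) * b)))) (fun _ _ _ => by simp only [mul_sub, sub_mul]) (fun _ => rfl)
  have e3 := altTrace_cycle2 (Tr := Tr) (fun d => D (d 1) (a 0) * (a 1 * (D (d 2) (a 2) * (D (d 0) (D (d 3) (a 3)) * b))))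
    (fun d => D (d 0) (a 0) * (a 1 * (D (d 1) (a 2) * (D (d 2) (D (d 3) (a 3)) * b)))) (fun _ => rfl)
  have f3 := altTrace_sq h 2 3 (by decide) (a 3)
    (fun d y => D (d 0) (a 0) * (a 1 * (D (d 1) (a 2) * (y * b)))) (fun _ _ _ => by simp only [mul_sub, sub_mul]) (fun _ => rfl)
  simp only [h.leibniz, add_mul, mul_add, mul_assoc, altTrace_add] at f0 e1 e2 f2 e3 f3 ⊢
  linear_combination f0 + e1 + e2 - f2 + e3 + f3

theorem altTrace_nabla_pptp (h : LiftingConditions Tr D Q) :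
    altTrace Tr (fun d => D (d 0) (D (d 1) (a 0) * (D (d 2) (a 1) * (a 2 * D (d 3) (a 3)))) * b) =
      1 / 2 * altTrace Tr (fun d => Q (d 0) (d 1) * (a 0 * (D (d 2) (a 1) * (a 2 * (D (d 3) (a 3) * b)))))
      - 1 / 2 * altTrace Tr (fun d => a 0 * (Q (d 0) (d 1) * (D (d 2) (a 1) * (a 2 * (D (d 3) (a 3) * b)))))
      - 1 / 2 * altTrace Tr (fun d => D (d 0) (a 0) * (Q (d 1) (d 2) * (a 1 * (a 2 * (D (d 3) (a 3) * b)))))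
      + 1 / 2 * altTrace Tr (fun d => D (d 0) (a 0) * (a 1 * (Q (d 1) (d 2) * (a 2 * (D (d 3) (a 3) * b)))))
      + altTrace Tr (fun d => D (d 0) (a 0) * (D (d 1) (a 1) * (D (d 2) (a 2) * (D (d 3) (a 3) * b))))
      + 1 / 2 * altTrace Tr (fun d => D (d 0) (a 0) * (D (d 1) (a 1) * (a 2 * (Q (d 2) (d 3) * (a 3 * b)))))
      - 1 / 2 * altTrace Tr (fun d => D (d 0) (a 0) * (D (d 1) (a 1) * (a 2 * (a 3 * (Q (d 2) (d 3) * b))))) := by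
  have f0 := altTrace_sq h 0 1 (by decide) (a 0)
    (fun d y => y * (D (d 2) (a 1) * (a 2 * (D (d 3) (a 3) * b)))) (fun _ _ _ => by simp only [sub_mul]) (fun _ => rfl)
  have e1 := altTrace_cycle1 (Tr := Tr) (fun d => D (d 1) (a 0) * (D (d 0) (D (d 2) (a 1)) * (a 2 * (D (d 3) (a 3) * b))))
    (fun d => D (d 0) (a 0) * (D (d 1) (D (d 2) (a 1)) * (a 2 * (D (d 3) (a 3) * b)))) (fun _ => rfl)
  have f1 := altTrace_sq h 1 2 (by decide) (a 1)
    (fun d y => D (d 0) (a 0) * (y * (a 2 * (D (d 3) (a 3) * b)))) (fun _ _ _ => by simp only [mul_sub, sub_mul]) (fun _ => rfl)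
  have e2 := altTrace_cycle2 (Tr := Tr) (fun d => D (d 1) (a 0) * (D (d 2) (a 1) * (D (d 0) (a 2) * (D (d 3) (a 3) * b))))
    (fun d => D (d 0) (a 0) * (D (d 1) (a 1) * (D (d 2) (a 2) * (D (d 3) (a 3) * b)))) (fun _ => rfl)
  have e3 := altTrace_cycle2 (Tr := Tr) (fun d => D (d 1) (a 0) * (D (d 2) (a 1) * (a 2 * (D (d 0) (D (d 3) (a 3)) * b))))
    (fun d => D (d 0) (a 0) * (D (d 1) (a 1) * (a 2 * (D (d 2) (D (d 3) (a 3)) * b)))) (fun _ => rfl)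
  have f3 := altTrace_sq h 2 3 (by decide) (a 3)
    (fun d y => D (d 0) (a 0) * (D (d 1) (a 1) * (a 2 * (y * b)))) (fun _ _ _ => by simp only [mul_sub, sub_mul]) (fun _ => rfl)
  simp only [h.leibniz, add_mul, mul_add, mul_assoc, altTrace_add] at f0 e1 f1 e2 e3 f3 ⊢
  linear_combination f0 + e1 - f1 + e2 + e3 + f3

theorem altTrace_nabla_pppt (h : LiftingConditions Tr D Q) :
    altTrace Tr (fun d => D (d 0) (D (d 1) (a 0) * (D (d 2) (a 1) * (D (d 3) (a 2) * a 3))) * b) =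
      1 / 2 * altTrace Tr (fun d => Q (d 0) (d 1) * (a 0 * (D (d 2) (a 1) * (D (d 3) (a 2) * (a 3 * b)))))
      - 1 / 2 * altTrace Tr (fun d => a 0 * (Q (d 0) (d 1) * (D (d 2) (a 1) * (D (d 3) (a 2) * (a 3 * b)))))
      - 1 / 2 * altTrace Tr (fun d => D (d 0) (a 0) * (Q (d 1) (d 2) * (a 1 * (D (d 3) (a 2) * (a 3 * b)))))
      + 1 / 2 * altTrace Tr (fun d => D (d 0) (a 0) * (a 1 * (Q (d 1) (d 2) * (D (d 3) (a 2) * (a 3 * b)))))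
      + 1 / 2 * altTrace Tr (fun d => D (d 0) (a 0) * (D (d 1) (a 1) * (Q (d 2) (d 3) * (a 2 * (a 3 * b)))))
      - 1 / 2 * altTrace Tr (fun d => D (d 0) (a 0) * (D (d 1) (a 1) * (a 2 * (Q (d 2) (d 3) * (a 3 * b)))))
      - altTrace Tr (fun d => D (d 0) (a 0) * (D (d 1) (a 1) * (D (d 2) (a 2) * (D (d 3) (a 3) * b)))) := by
  have f0 := altTrace_sq h 0 1 (by decide) (a 0)
    (fun d y => y * (D (d 2) (a 1) * (D (d 3) (a 2) * (a 3 * b)))) (fun _ _ _ => by simp only [sub_mul]) (fun _ => rfl)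
  have e1 := altTrace_cycle1 (Tr := Tr) (fun d => D (d 1) (a 0) * (D (d 0) (D (d 2) (a 1)) * (D (d 3) (a 2) * (a 3 * b))))
    (fun d => D (d 0) (a 0) * (D (d 1) (D (d 2) (a 1)) * (D (d 3) (a 2) * (a 3 * b)))) (fun _ => rfl)
  have f1 := altTrace_sq h 1 2 (by decide) (a 1)
    (fun d y => D (d 0) (a 0) * (y * (D (d 3) (a 2) * (a 3 * b)))) (fun _ _ _ => by simp only [mul_sub, sub_mul]) (fun _ => rfl)
  have e2 := altTrace_cycle2 (Tr := Tr) (fun d => D (d 1) (a 0) * (D (d 2) (a 1) * (D (d 0) (D (d 3) (a 2)) * (a 3 * b))))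
    (fun d => D (d 0) (a 0) * (D (d 1) (a 1) * (D (d 2) (D (d 3) (a 2)) * (a 3 * b)))) (fun _ => rfl)
  have f2 := altTrace_sq h 2 3 (by decide) (a 2)
    (fun d y => D (d 0) (a 0) * (D (d 1) (a 1) * (y * (a 3 * b)))) (fun _ _ _ => by simp only [mul_sub, sub_mul]) (fun _ => rfl)
  have e3 := altTrace_cycle3 (Tr := Tr) (fun d => D (d 1) (a 0) * (D (d 2) (a 1) * (D (d 3) (a 2) * (D (d 0) (a 3) * b))))
    (fun d => D (d 0) (a 0) * (D (d 1) (a 1) * (D (d 2) (a 2) * (D (d 3) (a 3) * b)))) (fun _ => rfl)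
  simp only [h.leibniz, add_mul, mul_add, mul_assoc, altTrace_add] at f0 e1 f1 e2 f2 e3 ⊢
  linear_combination f0 + e1 - f1 + e2 + f2 + e3

/-- Here a curvature occurs among the factors: after renumbering, the term in which it is
differentiated has three consecutive indices 1, 2, 3 in the pattern of the Bianchi identity and
drops out (`e3`, `f3`). -/
theorem altTrace_nabla_pttQt (h : LiftingConditions Tr D Q) :
    altTrace Tr (fun d => D (d 0) (D (d 1) (a 0) * (a 1 * (a 2 * (Q (d 2) (d 3) * a 3)))) * b) =
      1 / 2 * altTrace Tr (fun d => Q (d 0) (d 1) * (a 0 * (a 1 * (a 2 * (Q (d 2) (d 3) * (a 3 * b))))))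
      - 1 / 2 * altTrace Tr (fun d => a 0 * (Q (d 0) (d 1) * (a 1 * (a 2 * (Q (d 2) (d 3) * (a 3 * b))))))
      - altTrace Tr (fun d => D (d 0) (a 0) * (D (d 1) (a 1) * (a 2 * (Q (d 2) (d 3) * (a 3 * b)))))
      - altTrace Tr (fun d => D (d 0) (a 0) * (a 1 * (D (d 1) (a 2) * (Q (d 2) (d 3) * (a 3 * b)))))
      - altTrace Tr (fun d => D (d 0) (a 0) * (a 1 * (a 2 * (Q (d 1) (d 2) * (D (d 3) (a 3) * b))))) := by
  have f0 := altTrace_sq h 0 1 (by decide) (a 0)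
    (fun d y => y * (a 1 * (a 2 * (Q (d 2) (d 3) * (a 3 * b))))) (fun _ _ _ => by simp only [sub_mul]) (fun _ => rfl)
  have e1 := altTrace_cycle1 (Tr := Tr) (fun d => D (d 1) (a 0) * (D (d 0) (a 1) * (a 2 * (Q (d 2) (d 3) * (a 3 * b)))))
    (fun d => D (d 0) (a 0) * (D (d 1) (a 1) * (a 2 * (Q (d 2) (d 3) * (a 3 * b))))) (fun _ => rfl)
  have e2 := altTrace_cycle1 (Tr := Tr) (fun d => D (d 1) (a 0) * (a 1 * (D (d 0) (a 2) * (Q (d 2) (d 3) * (a 3 * b)))))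
    (fun d => D (d 0) (a 0) * (a 1 * (D (d 1) (a 2) * (Q (d 2) (d 3) * (a 3 * b))))) (fun _ => rfl)
  have e3 := altTrace_cycle1 (Tr := Tr) (fun d => D (d 1) (a 0) * (a 1 * (a 2 * (D (d 0) (Q (d 2) (d 3)) * (a 3 * b)))))
    (fun d => D (d 0) (a 0) * (a 1 * (a 2 * (D (d 1) (Q (d 2) (d 3)) * (a 3 * b))))) (fun _ => rfl)
  have f3 := altTrace_bianchi h 1 2 3 (by decide) (by decide) (by decide)
    (fun d y => D (d 0) (a 0) * (a 1 * (a 2 * (y * (a 3 * b))))) (fun _ _ _ => by simp only [mul_sub, sub_mul]) (fun _ => rfl) (fun _ => rfl)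
  have e4 := altTrace_cycle3 (Tr := Tr) (fun d => D (d 1) (a 0) * (a 1 * (a 2 * (Q (d 2) (d 3) * (D (d 0) (a 3) * b)))))
    (fun d => D (d 0) (a 0) * (a 1 * (a 2 * (Q (d 1) (d 2) * (D (d 3) (a 3) * b))))) (fun _ => rfl)
  simp only [h.leibniz, add_mul, mul_add, mul_assoc, altTrace_add] at f0 e1 e2 e3 f3 e4 ⊢
  linear_combination f0 + e1 + e2 + e3 - f3 + e4

theorem altTrace_nabla_ttQtp (h : LiftingConditions Tr D Q) :
    altTrace Tr (fun d => D (d 0) (a 0 * (a 1 * (Q (d 1) (d 2) * (a 2 * D (d 3) (a 3))))) * b) =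
      altTrace Tr (fun d => D (d 0) (a 0) * (a 1 * (Q (d 1) (d 2) * (a 2 * (D (d 3) (a 3) * b)))))
      + altTrace Tr (fun d => a 0 * (D (d 0) (a 1) * (Q (d 1) (d 2) * (a 2 * (D (d 3) (a 3) * b)))))
      + altTrace Tr (fun d => a 0 * (a 1 * (Q (d 0) (d 1) * (D (d 2) (a 2) * (D (d 3) (a 3) * b)))))
      + 1 / 2 * altTrace Tr (fun d => a 0 * (a 1 * (Q (d 0) (d 1) * (a 2 * (Q (d 2) (d 3) * (a 3 * b))))))
      - 1 / 2 * altTrace Tr (fun d => a 0 * (a 1 * (Q (d 0) (d 1) * (a 2 * (a 3 * (Q (d 2) (d 3) * b)))))) := by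
  have f2 := altTrace_bianchi h 0 1 2 (by decide) (by decide) (by decide)
    (fun d y => a 0 * (a 1 * (y * (a 2 * (D (d 3) (a 3) * b))))) (fun _ _ _ => by simp only [mul_sub, sub_mul]) (fun _ => rfl) (fun _ => rfl)
  have e3 := altTrace_cycle2 (Tr := Tr) (fun d => a 0 * (a 1 * (Q (d 1) (d 2) * (D (d 0) (a 2) * (D (d 3) (a 3) * b)))))
    (fun d => a 0 * (a 1 * (Q (d 0) (d 1) * (D (d 2) (a 2) * (D (d 3) (a 3) * b))))) (fun _ => rfl)
  have e4 := altTrace_cycle2 (Tr := Tr) (fun d => a 0 * (a 1 * (Q (d 1) (d 2) * (a 2 * (D (d 0) (D (d 3) (a 3)) * b)))))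
    (fun d => a 0 * (a 1 * (Q (d 0) (d 1) * (a 2 * (D (d 2) (D (d 3) (a 3)) * b))))) (fun _ => rfl)
  have f4 := altTrace_sq h 2 3 (by decide) (a 3)
    (fun d y => a 0 * (a 1 * (Q (d 0) (d 1) * (a 2 * (y * b))))) (fun _ _ _ => by simp only [mul_sub, sub_mul]) (fun _ => rfl)
  simp only [h.leibniz, add_mul, mul_add, mul_assoc, altTrace_add] at f2 e3 e4 f4 ⊢
  linear_combination f2 + e3 + e4 + f4

theorem altTrace_nabla_tQtpt (h : LiftingConditions Tr D Q) :
    altTrace Tr (fun d => D (d 0) (a 0 * (Q (d 1) (d 2) * (a 1 * (D (d 3) (a 2) * a 3)))) * b) =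
      altTrace Tr (fun d => D (d 0) (a 0) * (Q (d 1) (d 2) * (a 1 * (D (d 3) (a 2) * (a 3 * b)))))
      + altTrace Tr (fun d => a 0 * (Q (d 0) (d 1) * (D (d 2) (a 1) * (D (d 3) (a 2) * (a 3 * b)))))
      + 1 / 2 * altTrace Tr (fun d => a 0 * (Q (d 0) (d 1) * (a 1 * (Q (d 2) (d 3) * (a 2 * (a 3 * b))))))
      - 1 / 2 * altTrace Tr (fun d => a 0 * (Q (d 0) (d 1) * (a 1 * (a 2 * (Q (d 2) (d 3) * (a 3 * b))))))
      - altTrace Tr (fun d => a 0 * (Q (d 0) (d 1) * (a 1 * (D (d 2) (a 2) * (D (d 3) (a 3) * b))))) := by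
  have f1 := altTrace_bianchi h 0 1 2 (by decide) (by decide) (by decide)
    (fun d y => a 0 * (y * (a 1 * (D (d 3) (a 2) * (a 3 * b))))) (fun _ _ _ => by simp only [mul_sub, sub_mul]) (fun _ => rfl) (fun _ => rfl)
  have e2 := altTrace_cycle2 (Tr := Tr) (fun d => a 0 * (Q (d 1) (d 2) * (D (d 0) (a 1) * (D (d 3) (a 2) * (a 3 * b)))))
    (fun d => a 0 * (Q (d 0) (d 1) * (D (d 2) (a 1) * (D (d 3) (a 2) * (a 3 * b))))) (fun _ => rfl)
  have e3 := altTrace_cycle2 (Tr := Tr) (fun d => a 0 * (Q (d 1) (d 2) * (a 1 * (D (d 0) (D (d 3) (a 2)) * (a 3 * b)))))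
    (fun d => a 0 * (Q (d 0) (d 1) * (a 1 * (D (d 2) (D (d 3) (a 2)) * (a 3 * b))))) (fun _ => rfl)
  have f3 := altTrace_sq h 2 3 (by decide) (a 2)
    (fun d y => a 0 * (Q (d 0) (d 1) * (a 1 * (y * (a 3 * b))))) (fun _ _ _ => by simp only [mul_sub, sub_mul]) (fun _ => rfl)
  have e4 := altTrace_cycle3 (Tr := Tr) (fun d => a 0 * (Q (d 1) (d 2) * (a 1 * (D (d 3) (a 2) * (D (d 0) (a 3) * b)))))
    (fun d => a 0 * (Q (d 0) (d 1) * (a 1 * (D (d 2) (a 2) * (D (d 3) (a 3) * b))))) (fun _ => rfl)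
  simp only [h.leibniz, add_mul, mul_add, mul_assoc, altTrace_add] at f1 e2 e3 f3 e4 ⊢
  linear_combination f1 + e2 + e3 + f3 + e4

theorem altTrace_nabla_tptQt (h : LiftingConditions Tr D Q) :
    altTrace Tr (fun d => D (d 0) (a 0 * (D (d 1) (a 1) * (a 2 * (Q (d 2) (d 3) * a 3)))) * b) =
      altTrace Tr (fun d => D (d 0) (a 0) * (D (d 1) (a 1) * (a 2 * (Q (d 2) (d 3) * (a 3 * b)))))
      + 1 / 2 * altTrace Tr (fun d => a 0 * (Q (d 0) (d 1) * (a 1 * (a 2 * (Q (d 2) (d 3) * (a 3 * b))))))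
      - 1 / 2 * altTrace Tr (fun d => a 0 * (a 1 * (Q (d 0) (d 1) * (a 2 * (Q (d 2) (d 3) * (a 3 * b))))))
      - altTrace Tr (fun d => a 0 * (D (d 0) (a 1) * (D (d 1) (a 2) * (Q (d 2) (d 3) * (a 3 * b)))))
      - altTrace Tr (fun d => a 0 * (D (d 0) (a 1) * (a 2 * (Q (d 1) (d 2) * (D (d 3) (a 3) * b))))) := by
  have f1 := altTrace_sq h 0 1 (by decide) (a 1)
    (fun d y => a 0 * (y * (a 2 * (Q (d 2) (d 3) * (a 3 * b))))) (fun _ _ _ => by simp only [mul_sub, sub_mul]) (fun _ => rfl)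
  have e2 := altTrace_cycle1 (Tr := Tr) (fun d => a 0 * (D (d 1) (a 1) * (D (d 0) (a 2) * (Q (d 2) (d 3) * (a 3 * b)))))
    (fun d => a 0 * (D (d 0) (a 1) * (D (d 1) (a 2) * (Q (d 2) (d 3) * (a 3 * b))))) (fun _ => rfl)
  have e3 := altTrace_cycle1 (Tr := Tr) (fun d => a 0 * (D (d 1) (a 1) * (a 2 * (D (d 0) (Q (d 2) (d 3)) * (a 3 * b)))))
    (fun d => a 0 * (D (d 0) (a 1) * (a 2 * (D (d 1) (Q (d 2) (d 3)) * (a 3 * b))))) (fun _ => rfl)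
  have f3 := altTrace_bianchi h 1 2 3 (by decide) (by decide) (by decide)
    (fun d y => a 0 * (D (d 0) (a 1) * (a 2 * (y * (a 3 * b))))) (fun _ _ _ => by simp only [mul_sub, sub_mul]) (fun _ => rfl) (fun _ => rfl)
  have e4 := altTrace_cycle3 (Tr := Tr) (fun d => a 0 * (D (d 1) (a 1) * (a 2 * (Q (d 2) (d 3) * (D (d 0) (a 3) * b)))))
    (fun d => a 0 * (D (d 0) (a 1) * (a 2 * (Q (d 1) (d 2) * (D (d 3) (a 3) * b))))) (fun _ => rfl)
  simp only [h.leibniz, add_mul, mul_add, mul_assoc, altTrace_add] at f1 e2 e3 f3 e4 ⊢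
  linear_combination f1 + e2 + e3 - f3 + e4

theorem altTrace_nabla_ptQtt (h : LiftingConditions Tr D Q) :
    altTrace Tr (fun d => D (d 0) (D (d 1) (a 0) * (a 1 * (Q (d 2) (d 3) * (a 2 * a 3)))) * b) =
      1 / 2 * altTrace Tr (fun d => Q (d 0) (d 1) * (a 0 * (a 1 * (Q (d 2) (d 3) * (a 2 * (a 3 * b))))))
      - 1 / 2 * altTrace Tr (fun d => a 0 * (Q (d 0) (d 1) * (a 1 * (Q (d 2) (d 3) * (a 2 * (a 3 * b))))))
      - altTrace Tr (fun d => D (d 0) (a 0) * (D (d 1) (a 1) * (Q (d 2) (d 3) * (a 2 * (a 3 * b)))))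
      - altTrace Tr (fun d => D (d 0) (a 0) * (a 1 * (Q (d 1) (d 2) * (D (d 3) (a 2) * (a 3 * b)))))
      - altTrace Tr (fun d => D (d 0) (a 0) * (a 1 * (Q (d 1) (d 2) * (a 2 * (D (d 3) (a 3) * b))))) := by
  have f0 := altTrace_sq h 0 1 (by decide) (a 0)
    (fun d y => y * (a 1 * (Q (d 2) (d 3) * (a 2 * (a 3 * b))))) (fun _ _ _ => by simp only [sub_mul]) (fun _ => rfl)
  have e1 := altTrace_cycle1 (Tr := Tr) (fun d => D (d 1) (a 0) * (D (d 0) (a 1) * (Q (d 2) (d 3) * (a 2 * (a 3 * b)))))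
    (fun d => D (d 0) (a 0) * (D (d 1) (a 1) * (Q (d 2) (d 3) * (a 2 * (a 3 * b))))) (fun _ => rfl)
  have e2 := altTrace_cycle1 (Tr := Tr) (fun d => D (d 1) (a 0) * (a 1 * (D (d 0) (Q (d 2) (d 3)) * (a 2 * (a 3 * b)))))
    (fun d => D (d 0) (a 0) * (a 1 * (D (d 1) (Q (d 2) (d 3)) * (a 2 * (a 3 * b))))) (fun _ => rfl)
  have f2 := altTrace_bianchi h 1 2 3 (by decide) (by decide) (by decide)
    (fun d y => D (d 0) (a 0) * (a 1 * (y * (a 2 * (a 3 * b))))) (fun _ _ _ => by simp only [mul_sub, sub_mul]) (fun _ => rfl) (fun _ => rfl)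
  have e3 := altTrace_cycle3 (Tr := Tr) (fun d => D (d 1) (a 0) * (a 1 * (Q (d 2) (d 3) * (D (d 0) (a 2) * (a 3 * b)))))
    (fun d => D (d 0) (a 0) * (a 1 * (Q (d 1) (d 2) * (D (d 3) (a 2) * (a 3 * b))))) (fun _ => rfl)
  have e4 := altTrace_cycle3 (Tr := Tr) (fun d => D (d 1) (a 0) * (a 1 * (Q (d 2) (d 3) * (a 2 * (D (d 0) (a 3) * b)))))
    (fun d => D (d 0) (a 0) * (a 1 * (Q (d 1) (d 2) * (a 2 * (D (d 3) (a 3) * b))))) (fun _ => rfl)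
  simp only [h.leibniz, add_mul, mul_add, mul_assoc, altTrace_add] at f0 e1 e2 f2 e3 e4 ⊢
  linear_combination f0 + e1 + e2 - f2 + e3 + e4

theorem altTrace_nabla_tQttp (h : LiftingConditions Tr D Q) :
    altTrace Tr (fun d => D (d 0) (a 0 * (Q (d 1) (d 2) * (a 1 * (a 2 * D (d 3) (a 3))))) * b) =
      altTrace Tr (fun d => D (d 0) (a 0) * (Q (d 1) (d 2) * (a 1 * (a 2 * (D (d 3) (a 3) * b)))))
      + altTrace Tr (fun d => a 0 * (Q (d 0) (d 1) * (D (d 2) (a 1) * (a 2 * (D (d 3) (a 3) * b)))))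
      + altTrace Tr (fun d => a 0 * (Q (d 0) (d 1) * (a 1 * (D (d 2) (a 2) * (D (d 3) (a 3) * b)))))
      + 1 / 2 * altTrace Tr (fun d => a 0 * (Q (d 0) (d 1) * (a 1 * (a 2 * (Q (d 2) (d 3) * (a 3 * b))))))
      - 1 / 2 * altTrace Tr (fun d => a 0 * (Q (d 0) (d 1) * (a 1 * (a 2 * (a 3 * (Q (d 2) (d 3) * b)))))) := by
  have f1 := altTrace_bianchi h 0 1 2 (by decide) (by decide) (by decide)
    (fun d y => a 0 * (y * (a 1 * (a 2 * (D (d 3) (a 3) * b))))) (fun _ _ _ => by simp only [mul_sub, sub_mul]) (fun _ => rfl) (fun _ => rfl)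
  have e2 := altTrace_cycle2 (Tr := Tr) (fun d => a 0 * (Q (d 1) (d 2) * (D (d 0) (a 1) * (a 2 * (D (d 3) (a 3) * b)))))
    (fun d => a 0 * (Q (d 0) (d 1) * (D (d 2) (a 1) * (a 2 * (D (d 3) (a 3) * b))))) (fun _ => rfl)
  have e3 := altTrace_cycle2 (Tr := Tr) (fun d => a 0 * (Q (d 1) (d 2) * (a 1 * (D (d 0) (a 2) * (D (d 3) (a 3) * b)))))
    (fun d => a 0 * (Q (d 0) (d 1) * (a 1 * (D (d 2) (a 2) * (D (d 3) (a 3) * b))))) (fun _ => rfl)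
  have e4 := altTrace_cycle2 (Tr := Tr) (fun d => a 0 * (Q (d 1) (d 2) * (a 1 * (a 2 * (D (d 0) (D (d 3) (a 3)) * b)))))
    (fun d => a 0 * (Q (d 0) (d 1) * (a 1 * (a 2 * (D (d 2) (D (d 3) (a 3)) * b))))) (fun _ => rfl)
  have f4 := altTrace_sq h 2 3 (by decide) (a 3)
    (fun d y => a 0 * (Q (d 0) (d 1) * (a 1 * (a 2 * (y * b))))) (fun _ _ _ => by simp only [mul_sub, sub_mul]) (fun _ => rfl)
  simp only [h.leibniz, add_mul, mul_add, mul_assoc, altTrace_add] at f1 e2 e3 e4 f4 ⊢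
  linear_combination f1 + e2 + e3 + e4 + f4

/-- All rotations are brought to words that end in `b`: `r` uses the cyclicity of the trace, `s`
integrates by parts to free `b` from its derivative, `u` puts the indices back in order. What
remains are total derivatives times `b`, which the `altTrace_nabla` lemmas expand. -/
theorem altTrace_rotations_ppppt (h : LiftingConditions Tr D Q) :
    altTrace Tr (fun d => D (d 0) b * (D (d 1) (a 0) * (D (d 2) (a 1) * (D (d 3) (a 2) * a 3))))
      + altTrace Tr (fun d => D (d 0) (a 3) * (D (d 1) b * (D (d 2) (a 0) * (D (d 3) (a 1) * a 2))))
      + altTrace Tr (fun d => D (d 0) (a 2) * (D (d 1) (a 3) * (D (d 2) b * (D (d 3) (a 0) * a 1))))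
      + altTrace Tr (fun d => D (d 0) (a 1) * (D (d 1) (a 2) * (D (d 2) (a 3) * (D (d 3) b * a 0))))
      + altTrace Tr (fun d => D (d 0) (a 0) * (D (d 1) (a 1) * (D (d 2) (a 2) * (D (d 3) (a 3) * b)))) =
      - altTrace Tr (fun d => D (d 0) (D (d 1) (a 0) * (D (d 2) (a 1) * (D (d 3) (a 2) * a 3))) * b)
      + altTrace Tr (fun d => D (d 0) (D (d 1) (a 0) * (D (d 2) (a 1) * (a 2 * D (d 3) (a 3)))) * b)
      - altTrace Tr (fun d => D (d 0) (D (d 1) (a 0) * (a 1 * (D (d 2) (a 2) * D (d 3) (a 3)))) * b)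
      + altTrace Tr (fun d => D (d 0) (a 0 * (D (d 1) (a 1) * (D (d 2) (a 2) * D (d 3) (a 3)))) * b)
      + altTrace Tr (fun d => D (d 0) (a 0) * (D (d 1) (a 1) * (D (d 2) (a 2) * (D (d 3) (a 3) * b)))) := by
  have r0 : altTrace Tr (fun d => D (d 0) b * (D (d 1) (a 0) * (D (d 2) (a 1) * (D (d 3) (a 2) * a 3)))) =
      altTrace Tr (fun d => D (d 1) (a 0) * (D (d 2) (a 1) * (D (d 3) (a 2) * (a 3 * D (d 0) b)))) :=
    altTrace_congr fun d => by simpa only [mul_assoc] using h.trace_comm (D (d 0) b) (D (d 1) (a 0) * (D (d 2) (a 1) * (D (d 3) (a 2) * a 3)))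
  have s0 := altTrace_by_parts h 0 (fun d => D (d 1) (a 0) * (D (d 2) (a 1) * (D (d 3) (a 2) * a 3))) b
  have r1 : altTrace Tr (fun d => D (d 0) (a 3) * (D (d 1) b * (D (d 2) (a 0) * (D (d 3) (a 1) * a 2)))) =
      altTrace Tr (fun d => D (d 2) (a 0) * (D (d 3) (a 1) * (a 2 * (D (d 0) (a 3) * D (d 1) b)))) :=
    altTrace_congr fun d => by simpa only [mul_assoc] using h.trace_comm (D (d 0) (a 3) * D (d 1) b) (D (d 2) (a 0) * (D (d 3) (a 1) * a 2))
  have s1 := altTrace_by_parts h 1 (fun d => D (d 2) (a 0) * (D (d 3) (a 1) * (a 2 * D (d 0) (a 3)))) b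
  have u1 := altTrace_rot1 (Tr := Tr) (fun d => D (d 1) (D (d 2) (a 0) * (D (d 3) (a 1) * (a 2 * D (d 0) (a 3)))) * b)
    (fun d => D (d 0) (D (d 1) (a 0) * (D (d 2) (a 1) * (a 2 * D (d 3) (a 3)))) * b) (fun _ => rfl)
  have r2 : altTrace Tr (fun d => D (d 0) (a 2) * (D (d 1) (a 3) * (D (d 2) b * (D (d 3) (a 0) * a 1)))) =
      altTrace Tr (fun d => D (d 3) (a 0) * (a 1 * (D (d 0) (a 2) * (D (d 1) (a 3) * D (d 2) b)))) :=
    altTrace_congr fun d => by simpa only [mul_assoc] using h.trace_comm (D (d 0) (a 2) * (D (d 1) (a 3) * D (d 2) b)) (D (d 3) (a 0) * a 1)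
  have s2 := altTrace_by_parts h 2 (fun d => D (d 3) (a 0) * (a 1 * (D (d 0) (a 2) * D (d 1) (a 3)))) b
  have u2 := altTrace_rot2 (Tr := Tr) (fun d => D (d 2) (D (d 3) (a 0) * (a 1 * (D (d 0) (a 2) * D (d 1) (a 3)))) * b)
    (fun d => D (d 0) (D (d 1) (a 0) * (a 1 * (D (d 2) (a 2) * D (d 3) (a 3)))) * b) (fun _ => rfl)
  have r3 : altTrace Tr (fun d => D (d 0) (a 1) * (D (d 1) (a 2) * (D (d 2) (a 3) * (D (d 3) b * a 0)))) =
      altTrace Tr (fun d => a 0 * (D (d 0) (a 1) * (D (d 1) (a 2) * (D (d 2) (a 3) * D (d 3) b)))) :=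
    altTrace_congr fun d => by simpa only [mul_assoc] using h.trace_comm (D (d 0) (a 1) * (D (d 1) (a 2) * (D (d 2) (a 3) * D (d 3) b))) (a 0)
  have s3 := altTrace_by_parts h 3 (fun d => a 0 * (D (d 0) (a 1) * (D (d 1) (a 2) * D (d 2) (a 3)))) b
  have u3 := altTrace_rot3 (Tr := Tr) (fun d => D (d 3) (a 0 * (D (d 0) (a 1) * (D (d 1) (a 2) * D (d 2) (a 3)))) * b)
    (fun d => D (d 0) (a 0 * (D (d 1) (a 1) * (D (d 2) (a 2) * D (d 3) (a 3)))) * b) (fun _ => rfl)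
  simp only [mul_assoc] at s0 s1 u1 s2 u2 s3 u3
  linear_combination r0 + s0 + r1 + s1 - u1 + r2 + s2 - u2 + r3 + s3 - u3

/-- As for the word without curvature, except that in some rotations `b` falls on a bare place.
Those are only rotated; they leave words with a `Q` at the very beginning or next to `b`, which
cancel later against the ends of the squares of ∇. -/
theorem altTrace_rotations_tQtppt (h : LiftingConditions Tr D Q) :
    altTrace Tr (fun d => b * (Q (d 0) (d 1) * (a 0 * (D (d 2) (a 1) * (D (d 3) (a 2) * a 3)))))
      + altTrace Tr (fun d => a 3 * (Q (d 0) (d 1) * (b * (D (d 2) (a 0) * (D (d 3) (a 1) * a 2)))))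
      + altTrace Tr (fun d => a 2 * (Q (d 0) (d 1) * (a 3 * (D (d 2) b * (D (d 3) (a 0) * a 1)))))
      + altTrace Tr (fun d => a 1 * (Q (d 0) (d 1) * (a 2 * (D (d 2) (a 3) * (D (d 3) b * a 0)))))
      + altTrace Tr (fun d => a 0 * (Q (d 0) (d 1) * (a 1 * (D (d 2) (a 2) * (D (d 3) (a 3) * b))))) =
      altTrace Tr (fun d => Q (d 0) (d 1) * (a 0 * (D (d 2) (a 1) * (D (d 3) (a 2) * (a 3 * b)))))
      + altTrace Tr (fun d => D (d 0) (a 0) * (D (d 1) (a 1) * (a 2 * (a 3 * (Q (d 2) (d 3) * b)))))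
      - altTrace Tr (fun d => D (d 0) (D (d 1) (a 0) * (a 1 * (a 2 * (Q (d 2) (d 3) * a 3)))) * b)
      + altTrace Tr (fun d => D (d 0) (a 0 * (a 1 * (Q (d 1) (d 2) * (a 2 * D (d 3) (a 3))))) * b)
      + altTrace Tr (fun d => a 0 * (Q (d 0) (d 1) * (a 1 * (D (d 2) (a 2) * (D (d 3) (a 3) * b))))) := by
  have r0 : altTrace Tr (fun d => b * (Q (d 0) (d 1) * (a 0 * (D (d 2) (a 1) * (D (d 3) (a 2) * a 3))))) =
      altTrace Tr (fun d => Q (d 0) (d 1) * (a 0 * (D (d 2) (a 1) * (D (d 3) (a 2) * (a 3 * b))))) :=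
    altTrace_congr fun d => by simpa only [mul_assoc] using h.trace_comm (b) (Q (d 0) (d 1) * (a 0 * (D (d 2) (a 1) * (D (d 3) (a 2) * a 3))))
  have r1 : altTrace Tr (fun d => a 3 * (Q (d 0) (d 1) * (b * (D (d 2) (a 0) * (D (d 3) (a 1) * a 2))))) =
      altTrace Tr (fun d => D (d 2) (a 0) * (D (d 3) (a 1) * (a 2 * (a 3 * (Q (d 0) (d 1) * b))))) :=
    altTrace_congr fun d => by simpa only [mul_assoc] using h.trace_comm (a 3 * (Q (d 0) (d 1) * b)) (D (d 2) (a 0) * (D (d 3) (a 1) * a 2))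
  have u1 := altTrace_rot2 (Tr := Tr) (fun d => D (d 2) (a 0) * (D (d 3) (a 1) * (a 2 * (a 3 * (Q (d 0) (d 1) * b)))))
    (fun d => D (d 0) (a 0) * (D (d 1) (a 1) * (a 2 * (a 3 * (Q (d 2) (d 3) * b))))) (fun _ => rfl)
  have r2 : altTrace Tr (fun d => a 2 * (Q (d 0) (d 1) * (a 3 * (D (d 2) b * (D (d 3) (a 0) * a 1))))) =
      altTrace Tr (fun d => D (d 3) (a 0) * (a 1 * (a 2 * (Q (d 0) (d 1) * (a 3 * D (d 2) b))))) :=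
    altTrace_congr fun d => by simpa only [mul_assoc] using h.trace_comm (a 2 * (Q (d 0) (d 1) * (a 3 * D (d 2) b))) (D (d 3) (a 0) * a 1)
  have s2 := altTrace_by_parts h 2 (fun d => D (d 3) (a 0) * (a 1 * (a 2 * (Q (d 0) (d 1) * a 3)))) b
  have u2 := altTrace_rot2 (Tr := Tr) (fun d => D (d 2) (D (d 3) (a 0) * (a 1 * (a 2 * (Q (d 0) (d 1) * a 3)))) * b)
    (fun d => D (d 0) (D (d 1) (a 0) * (a 1 * (a 2 * (Q (d 2) (d 3) * a 3)))) * b) (fun _ => rfl)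
  have r3 : altTrace Tr (fun d => a 1 * (Q (d 0) (d 1) * (a 2 * (D (d 2) (a 3) * (D (d 3) b * a 0))))) =
      altTrace Tr (fun d => a 0 * (a 1 * (Q (d 0) (d 1) * (a 2 * (D (d 2) (a 3) * D (d 3) b))))) :=
    altTrace_congr fun d => by simpa only [mul_assoc] using h.trace_comm (a 1 * (Q (d 0) (d 1) * (a 2 * (D (d 2) (a 3) * D (d 3) b)))) (a 0)
  have s3 := altTrace_by_parts h 3 (fun d => a 0 * (a 1 * (Q (d 0) (d 1) * (a 2 * D (d 2) (a 3))))) b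
  have u3 := altTrace_rot3 (Tr := Tr) (fun d => D (d 3) (a 0 * (a 1 * (Q (d 0) (d 1) * (a 2 * D (d 2) (a 3))))) * b)
    (fun d => D (d 0) (a 0 * (a 1 * (Q (d 1) (d 2) * (a 2 * D (d 3) (a 3))))) * b) (fun _ => rfl)
  simp only [mul_assoc] at u1 s2 u2 s3 u3
  linear_combination r0 + r1 + u1 + r2 + s2 - u2 + r3 + s3 - u3

theorem altTrace_rotations_ptQtpt (h : LiftingConditions Tr D Q) :
    altTrace Tr (fun d => D (d 0) b * (a 0 * (Q (d 1) (d 2) * (a 1 * (D (d 3) (a 2) * a 3)))))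
      + altTrace Tr (fun d => D (d 0) (a 3) * (b * (Q (d 1) (d 2) * (a 0 * (D (d 3) (a 1) * a 2)))))
      + altTrace Tr (fun d => D (d 0) (a 2) * (a 3 * (Q (d 1) (d 2) * (b * (D (d 3) (a 0) * a 1)))))
      + altTrace Tr (fun d => D (d 0) (a 1) * (a 2 * (Q (d 1) (d 2) * (a 3 * (D (d 3) b * a 0)))))
      + altTrace Tr (fun d => D (d 0) (a 0) * (a 1 * (Q (d 1) (d 2) * (a 2 * (D (d 3) (a 3) * b))))) =
      - altTrace Tr (fun d => D (d 0) (a 0 * (Q (d 1) (d 2) * (a 1 * (D (d 3) (a 2) * a 3)))) * b)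
      - altTrace Tr (fun d => Q (d 0) (d 1) * (a 0 * (D (d 2) (a 1) * (a 2 * (D (d 3) (a 3) * b)))))
      - altTrace Tr (fun d => D (d 0) (a 0) * (a 1 * (D (d 1) (a 2) * (a 3 * (Q (d 2) (d 3) * b)))))
      + altTrace Tr (fun d => D (d 0) (a 0 * (D (d 1) (a 1) * (a 2 * (Q (d 2) (d 3) * a 3)))) * b)
      + altTrace Tr (fun d => D (d 0) (a 0) * (a 1 * (Q (d 1) (d 2) * (a 2 * (D (d 3) (a 3) * b))))) := by
  have r0 : altTrace Tr (fun d => D (d 0) b * (a 0 * (Q (d 1) (d 2) * (a 1 * (D (d 3) (a 2) * a 3))))) =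
      altTrace Tr (fun d => a 0 * (Q (d 1) (d 2) * (a 1 * (D (d 3) (a 2) * (a 3 * D (d 0) b))))) :=
    altTrace_congr fun d => by simpa only [mul_assoc] using h.trace_comm (D (d 0) b) (a 0 * (Q (d 1) (d 2) * (a 1 * (D (d 3) (a 2) * a 3))))
  have s0 := altTrace_by_parts h 0 (fun d => a 0 * (Q (d 1) (d 2) * (a 1 * (D (d 3) (a 2) * a 3)))) b
  have r1 : altTrace Tr (fun d => D (d 0) (a 3) * (b * (Q (d 1) (d 2) * (a 0 * (D (d 3) (a 1) * a 2))))) =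
      altTrace Tr (fun d => Q (d 1) (d 2) * (a 0 * (D (d 3) (a 1) * (a 2 * (D (d 0) (a 3) * b))))) :=
    altTrace_congr fun d => by simpa only [mul_assoc] using h.trace_comm (D (d 0) (a 3) * b) (Q (d 1) (d 2) * (a 0 * (D (d 3) (a 1) * a 2)))
  have u1 := altTrace_rot1 (Tr := Tr) (fun d => Q (d 1) (d 2) * (a 0 * (D (d 3) (a 1) * (a 2 * (D (d 0) (a 3) * b)))))
    (fun d => Q (d 0) (d 1) * (a 0 * (D (d 2) (a 1) * (a 2 * (D (d 3) (a 3) * b))))) (fun _ => rfl)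
  have r2 : altTrace Tr (fun d => D (d 0) (a 2) * (a 3 * (Q (d 1) (d 2) * (b * (D (d 3) (a 0) * a 1))))) =
      altTrace Tr (fun d => D (d 3) (a 0) * (a 1 * (D (d 0) (a 2) * (a 3 * (Q (d 1) (d 2) * b))))) :=
    altTrace_congr fun d => by simpa only [mul_assoc] using h.trace_comm (D (d 0) (a 2) * (a 3 * (Q (d 1) (d 2) * b))) (D (d 3) (a 0) * a 1)
  have u2 := altTrace_rot3 (Tr := Tr) (fun d => D (d 3) (a 0) * (a 1 * (D (d 0) (a 2) * (a 3 * (Q (d 1) (d 2) * b)))))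
    (fun d => D (d 0) (a 0) * (a 1 * (D (d 1) (a 2) * (a 3 * (Q (d 2) (d 3) * b))))) (fun _ => rfl)
  have r3 : altTrace Tr (fun d => D (d 0) (a 1) * (a 2 * (Q (d 1) (d 2) * (a 3 * (D (d 3) b * a 0))))) =
      altTrace Tr (fun d => a 0 * (D (d 0) (a 1) * (a 2 * (Q (d 1) (d 2) * (a 3 * D (d 3) b))))) :=
    altTrace_congr fun d => by simpa only [mul_assoc] using h.trace_comm (D (d 0) (a 1) * (a 2 * (Q (d 1) (d 2) * (a 3 * D (d 3) b)))) (a 0)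
  have s3 := altTrace_by_parts h 3 (fun d => a 0 * (D (d 0) (a 1) * (a 2 * (Q (d 1) (d 2) * a 3)))) b
  have u3 := altTrace_rot3 (Tr := Tr) (fun d => D (d 3) (a 0 * (D (d 0) (a 1) * (a 2 * (Q (d 1) (d 2) * a 3)))) * b)
    (fun d => D (d 0) (a 0 * (D (d 1) (a 1) * (a 2 * (Q (d 2) (d 3) * a 3)))) * b) (fun _ => rfl)
  simp only [mul_assoc] at s0 u1 u2 s3 u3
  linear_combination r0 + s0 + r1 + u1 + r2 + u2 + r3 + s3 - u3

theorem altTrace_rotations_pptQtt (h : LiftingConditions Tr D Q) :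
    altTrace Tr (fun d => D (d 0) b * (D (d 1) (a 0) * (a 1 * (Q (d 2) (d 3) * (a 2 * a 3)))))
      + altTrace Tr (fun d => D (d 0) (a 3) * (D (d 1) b * (a 0 * (Q (d 2) (d 3) * (a 1 * a 2)))))
      + altTrace Tr (fun d => D (d 0) (a 2) * (D (d 1) (a 3) * (b * (Q (d 2) (d 3) * (a 0 * a 1)))))
      + altTrace Tr (fun d => D (d 0) (a 1) * (D (d 1) (a 2) * (a 3 * (Q (d 2) (d 3) * (b * a 0)))))
      + altTrace Tr (fun d => D (d 0) (a 0) * (D (d 1) (a 1) * (a 2 * (Q (d 2) (d 3) * (a 3 * b))))) =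
      - altTrace Tr (fun d => D (d 0) (D (d 1) (a 0) * (a 1 * (Q (d 2) (d 3) * (a 2 * a 3)))) * b)
      + altTrace Tr (fun d => D (d 0) (a 0 * (Q (d 1) (d 2) * (a 1 * (a 2 * D (d 3) (a 3))))) * b)
      + altTrace Tr (fun d => Q (d 0) (d 1) * (a 0 * (a 1 * (D (d 2) (a 2) * (D (d 3) (a 3) * b)))))
      + altTrace Tr (fun d => a 0 * (D (d 0) (a 1) * (D (d 1) (a 2) * (a 3 * (Q (d 2) (d 3) * b)))))
      + altTrace Tr (fun d => D (d 0) (a 0) * (D (d 1) (a 1) * (a 2 * (Q (d 2) (d 3) * (a 3 * b))))) := by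
  have r0 : altTrace Tr (fun d => D (d 0) b * (D (d 1) (a 0) * (a 1 * (Q (d 2) (d 3) * (a 2 * a 3))))) =
      altTrace Tr (fun d => D (d 1) (a 0) * (a 1 * (Q (d 2) (d 3) * (a 2 * (a 3 * D (d 0) b))))) :=
    altTrace_congr fun d => by simpa only [mul_assoc] using h.trace_comm (D (d 0) b) (D (d 1) (a 0) * (a 1 * (Q (d 2) (d 3) * (a 2 * a 3))))
  have s0 := altTrace_by_parts h 0 (fun d => D (d 1) (a 0) * (a 1 * (Q (d 2) (d 3) * (a 2 * a 3)))) b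
  have r1 : altTrace Tr (fun d => D (d 0) (a 3) * (D (d 1) b * (a 0 * (Q (d 2) (d 3) * (a 1 * a 2))))) =
      altTrace Tr (fun d => a 0 * (Q (d 2) (d 3) * (a 1 * (a 2 * (D (d 0) (a 3) * D (d 1) b))))) :=
    altTrace_congr fun d => by simpa only [mul_assoc] using h.trace_comm (D (d 0) (a 3) * D (d 1) b) (a 0 * (Q (d 2) (d 3) * (a 1 * a 2)))
  have s1 := altTrace_by_parts h 1 (fun d => a 0 * (Q (d 2) (d 3) * (a 1 * (a 2 * D (d 0) (a 3))))) b
  have u1 := altTrace_rot1 (Tr := Tr) (fun d => D (d 1) (a 0 * (Q (d 2) (d 3) * (a 1 * (a 2 * D (d 0) (a 3))))) * b)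
    (fun d => D (d 0) (a 0 * (Q (d 1) (d 2) * (a 1 * (a 2 * D (d 3) (a 3))))) * b) (fun _ => rfl)
  have r2 : altTrace Tr (fun d => D (d 0) (a 2) * (D (d 1) (a 3) * (b * (Q (d 2) (d 3) * (a 0 * a 1))))) =
      altTrace Tr (fun d => Q (d 2) (d 3) * (a 0 * (a 1 * (D (d 0) (a 2) * (D (d 1) (a 3) * b))))) :=
    altTrace_congr fun d => by simpa only [mul_assoc] using h.trace_comm (D (d 0) (a 2) * (D (d 1) (a 3) * b)) (Q (d 2) (d 3) * (a 0 * a 1))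
  have u2 := altTrace_rot2 (Tr := Tr) (fun d => Q (d 2) (d 3) * (a 0 * (a 1 * (D (d 0) (a 2) * (D (d 1) (a 3) * b)))))
    (fun d => Q (d 0) (d 1) * (a 0 * (a 1 * (D (d 2) (a 2) * (D (d 3) (a 3) * b))))) (fun _ => rfl)
  have r3 : altTrace Tr (fun d => D (d 0) (a 1) * (D (d 1) (a 2) * (a 3 * (Q (d 2) (d 3) * (b * a 0))))) =
      altTrace Tr (fun d => a 0 * (D (d 0) (a 1) * (D (d 1) (a 2) * (a 3 * (Q (d 2) (d 3) * b))))) :=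
    altTrace_congr fun d => by simpa only [mul_assoc] using h.trace_comm (D (d 0) (a 1) * (D (d 1) (a 2) * (a 3 * (Q (d 2) (d 3) * b)))) (a 0)
  simp only [mul_assoc] at s0 s1 u1 u2
  linear_combination r0 + s0 + r1 + s1 - u1 + r2 + u2 + r3

theorem altTrace_rotations_tQttQtt (h : LiftingConditions Tr D Q) :
    altTrace Tr (fun d => b * (Q (d 0) (d 1) * (a 0 * (a 1 * (Q (d 2) (d 3) * (a 2 * a 3))))))
      + altTrace Tr (fun d => a 3 * (Q (d 0) (d 1) * (b * (a 0 * (Q (d 2) (d 3) * (a 1 * a 2))))))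
      + altTrace Tr (fun d => a 2 * (Q (d 0) (d 1) * (a 3 * (b * (Q (d 2) (d 3) * (a 0 * a 1))))))
      + altTrace Tr (fun d => a 1 * (Q (d 0) (d 1) * (a 2 * (a 3 * (Q (d 2) (d 3) * (b * a 0))))))
      + altTrace Tr (fun d => a 0 * (Q (d 0) (d 1) * (a 1 * (a 2 * (Q (d 2) (d 3) * (a 3 * b)))))) =
      altTrace Tr (fun d => Q (d 0) (d 1) * (a 0 * (a 1 * (Q (d 2) (d 3) * (a 2 * (a 3 * b))))))
      + altTrace Tr (fun d => a 0 * (Q (d 0) (d 1) * (a 1 * (a 2 * (a 3 * (Q (d 2) (d 3) * b))))))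
      + altTrace Tr (fun d => Q (d 0) (d 1) * (a 0 * (a 1 * (a 2 * (Q (d 2) (d 3) * (a 3 * b))))))
      + altTrace Tr (fun d => a 0 * (a 1 * (Q (d 0) (d 1) * (a 2 * (a 3 * (Q (d 2) (d 3) * b))))))
      + altTrace Tr (fun d => a 0 * (Q (d 0) (d 1) * (a 1 * (a 2 * (Q (d 2) (d 3) * (a 3 * b)))))) := by
  have r0 : altTrace Tr (fun d => b * (Q (d 0) (d 1) * (a 0 * (a 1 * (Q (d 2) (d 3) * (a 2 * a 3)))))) =
      altTrace Tr (fun d => Q (d 0) (d 1) * (a 0 * (a 1 * (Q (d 2) (d 3) * (a 2 * (a 3 * b)))))) :=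
    altTrace_congr fun d => by simpa only [mul_assoc] using h.trace_comm (b) (Q (d 0) (d 1) * (a 0 * (a 1 * (Q (d 2) (d 3) * (a 2 * a 3)))))
  have r1 : altTrace Tr (fun d => a 3 * (Q (d 0) (d 1) * (b * (a 0 * (Q (d 2) (d 3) * (a 1 * a 2)))))) =
      altTrace Tr (fun d => a 0 * (Q (d 2) (d 3) * (a 1 * (a 2 * (a 3 * (Q (d 0) (d 1) * b)))))) :=
    altTrace_congr fun d => by simpa only [mul_assoc] using h.trace_comm (a 3 * (Q (d 0) (d 1) * b)) (a 0 * (Q (d 2) (d 3) * (a 1 * a 2)))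
  have u1 := altTrace_rot2 (Tr := Tr) (fun d => a 0 * (Q (d 2) (d 3) * (a 1 * (a 2 * (a 3 * (Q (d 0) (d 1) * b))))))
    (fun d => a 0 * (Q (d 0) (d 1) * (a 1 * (a 2 * (a 3 * (Q (d 2) (d 3) * b)))))) (fun _ => rfl)
  have r2 : altTrace Tr (fun d => a 2 * (Q (d 0) (d 1) * (a 3 * (b * (Q (d 2) (d 3) * (a 0 * a 1)))))) =
      altTrace Tr (fun d => Q (d 2) (d 3) * (a 0 * (a 1 * (a 2 * (Q (d 0) (d 1) * (a 3 * b)))))) :=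
    altTrace_congr fun d => by simpa only [mul_assoc] using h.trace_comm (a 2 * (Q (d 0) (d 1) * (a 3 * b))) (Q (d 2) (d 3) * (a 0 * a 1))
  have u2 := altTrace_rot2 (Tr := Tr) (fun d => Q (d 2) (d 3) * (a 0 * (a 1 * (a 2 * (Q (d 0) (d 1) * (a 3 * b))))))
    (fun d => Q (d 0) (d 1) * (a 0 * (a 1 * (a 2 * (Q (d 2) (d 3) * (a 3 * b)))))) (fun _ => rfl)
  have r3 : altTrace Tr (fun d => a 1 * (Q (d 0) (d 1) * (a 2 * (a 3 * (Q (d 2) (d 3) * (b * a 0)))))) =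
      altTrace Tr (fun d => a 0 * (a 1 * (Q (d 0) (d 1) * (a 2 * (a 3 * (Q (d 2) (d 3) * b)))))) :=
    altTrace_congr fun d => by simpa only [mul_assoc] using h.trace_comm (a 1 * (Q (d 0) (d 1) * (a 2 * (a 3 * (Q (d 2) (d 3) * b))))) (a 0)
  linear_combination r0 + r1 + u1 + r2 + u2 + r3

/-- The five kinds of words are rotated with the weights they have in Ψ₅, and each total derivative
is expanded with the sign with which it occurs. For the word without curvature the expansions yield
four more copies of the word itself, which with the unrotated one make five; the ½ and ¼ are what
makes the words with one and with two curvatures collect to the same multiple, with every other word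
cancelling. -/
theorem altTrace_rotations (h : LiftingConditions Tr D Q) :
    (altTrace Tr (fun d => D (d 0) b * (D (d 1) (a 0) * (D (d 2) (a 1) * (D (d 3) (a 2) * a 3))))
      + altTrace Tr (fun d => D (d 0) (a 3) * (D (d 1) b * (D (d 2) (a 0) * (D (d 3) (a 1) * a 2))))
      + altTrace Tr (fun d => D (d 0) (a 2) * (D (d 1) (a 3) * (D (d 2) b * (D (d 3) (a 0) * a 1))))
      + altTrace Tr (fun d => D (d 0) (a 1) * (D (d 1) (a 2) * (D (d 2) (a 3) * (D (d 3) b * a 0))))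
      + altTrace Tr (fun d => D (d 0) (a 0) * (D (d 1) (a 1) * (D (d 2) (a 2) * (D (d 3) (a 3) * b)))))
    + 1 / 2 * (altTrace Tr (fun d => b * (Q (d 0) (d 1) * (a 0 * (D (d 2) (a 1) * (D (d 3) (a 2) * a 3)))))
      + altTrace Tr (fun d => a 3 * (Q (d 0) (d 1) * (b * (D (d 2) (a 0) * (D (d 3) (a 1) * a 2)))))
      + altTrace Tr (fun d => a 2 * (Q (d 0) (d 1) * (a 3 * (D (d 2) b * (D (d 3) (a 0) * a 1)))))
      + altTrace Tr (fun d => a 1 * (Q (d 0) (d 1) * (a 2 * (D (d 2) (a 3) * (D (d 3) b * a 0)))))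
      + altTrace Tr (fun d => a 0 * (Q (d 0) (d 1) * (a 1 * (D (d 2) (a 2) * (D (d 3) (a 3) * b))))))
    + 1 / 2 * (altTrace Tr (fun d => D (d 0) b * (a 0 * (Q (d 1) (d 2) * (a 1 * (D (d 3) (a 2) * a 3)))))
      + altTrace Tr (fun d => D (d 0) (a 3) * (b * (Q (d 1) (d 2) * (a 0 * (D (d 3) (a 1) * a 2)))))
      + altTrace Tr (fun d => D (d 0) (a 2) * (a 3 * (Q (d 1) (d 2) * (b * (D (d 3) (a 0) * a 1)))))
      + altTrace Tr (fun d => D (d 0) (a 1) * (a 2 * (Q (d 1) (d 2) * (a 3 * (D (d 3) b * a 0)))))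
      + altTrace Tr (fun d => D (d 0) (a 0) * (a 1 * (Q (d 1) (d 2) * (a 2 * (D (d 3) (a 3) * b))))))
    + 1 / 2 * (altTrace Tr (fun d => D (d 0) b * (D (d 1) (a 0) * (a 1 * (Q (d 2) (d 3) * (a 2 * a 3)))))
      + altTrace Tr (fun d => D (d 0) (a 3) * (D (d 1) b * (a 0 * (Q (d 2) (d 3) * (a 1 * a 2)))))
      + altTrace Tr (fun d => D (d 0) (a 2) * (D (d 1) (a 3) * (b * (Q (d 2) (d 3) * (a 0 * a 1)))))
      + altTrace Tr (fun d => D (d 0) (a 1) * (D (d 1) (a 2) * (a 3 * (Q (d 2) (d 3) * (b * a 0)))))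
      + altTrace Tr (fun d => D (d 0) (a 0) * (D (d 1) (a 1) * (a 2 * (Q (d 2) (d 3) * (a 3 * b))))))
    + 1 / 4 * (altTrace Tr (fun d => b * (Q (d 0) (d 1) * (a 0 * (a 1 * (Q (d 2) (d 3) * (a 2 * a 3))))))
      + altTrace Tr (fun d => a 3 * (Q (d 0) (d 1) * (b * (a 0 * (Q (d 2) (d 3) * (a 1 * a 2))))))
      + altTrace Tr (fun d => a 2 * (Q (d 0) (d 1) * (a 3 * (b * (Q (d 2) (d 3) * (a 0 * a 1))))))
      + altTrace Tr (fun d => a 1 * (Q (d 0) (d 1) * (a 2 * (a 3 * (Q (d 2) (d 3) * (b * a 0))))))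
      + altTrace Tr (fun d => a 0 * (Q (d 0) (d 1) * (a 1 * (a 2 * (Q (d 2) (d 3) * (a 3 * b))))))) =
      5 * (altTrace Tr (fun d => D (d 0) (a 0) * (D (d 1) (a 1) * (D (d 2) (a 2) * (D (d 3) (a 3) * b))))
        + 1 / 2 * altTrace Tr (fun d => a 0 * (Q (d 0) (d 1) * (a 1 * (D (d 2) (a 2) * (D (d 3) (a 3) * b)))))
        + 1 / 2 * altTrace Tr (fun d => D (d 0) (a 0) * (a 1 * (Q (d 1) (d 2) * (a 2 * (D (d 3) (a 3) * b)))))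
        + 1 / 2 * altTrace Tr (fun d => D (d 0) (a 0) * (D (d 1) (a 1) * (a 2 * (Q (d 2) (d 3) * (a 3 * b)))))
        + 1 / 4 * altTrace Tr (fun d => a 0 * (Q (d 0) (d 1) * (a 1 * (a 2 * (Q (d 2) (d 3) * (a 3 * b))))))) := by
  linear_combination altTrace_rotations_ppppt a b h + 1 / 2 * altTrace_rotations_tQtppt a b h + 1 / 2 * altTrace_rotations_ptQtpt a b h + 1 / 2 * altTrace_rotations_pptQtt a b h + 1 / 4 * altTrace_rotations_tQttQtt a b h
    + altTrace_nabla_tppp a b h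
    - altTrace_nabla_ptpp a b h
    + altTrace_nabla_pptp a b h
    - altTrace_nabla_pppt a b h
    - 1 / 2 * altTrace_nabla_pttQt a b h
    + 1 / 2 * altTrace_nabla_ttQtp a b h
    - 1 / 2 * altTrace_nabla_tQtpt a b h
    + 1 / 2 * altTrace_nabla_tptQt a b h
    - 1 / 2 * altTrace_nabla_ptQtt a b h
    + 1 / 2 * altTrace_nabla_tQttp a b h

end CyclicRotations

/-! ### The map θ as a chain map, and the sum over rotations -/

section Theta

variable {A : Type*} [NonUnitalRing A] [Module ℂ A]

theorem ceDiff_smul {n : ℕ} {M : Type*} [AddCommGroup M] [Module ℂ M] (ρ : A → M →ₗ[ℂ] M) (c : ℂ)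
    (f : A [⋀^Fin n]→ₗ[ℂ] M) (v : Fin (n + 1) → A) :
    ceDiff ρ (c • f) v = c • ceDiff ρ f v := by
  simp only [ceDiff, AlternatingMap.smul_apply, map_smul, Finset.smul_sum,
    smul_comm c]
  simp only [← Finset.smul_sum, ← smul_sub]

variable [IsScalarTower ℂ A A] [SMulCommClass ℂ A A]

/-- The canonical map `theta` commutes with the Chevalley–Eilenberg differentials. -/
theorem ceDiff_trivialAction_snoc {n : ℕ} (f : A [⋀^Fin (n + 1)]→ₗ[ℂ] ℂ) (v : Fin (n + 1) → A)
    (b : A) :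
    ceDiff trivialAction f (Fin.snoc v b : Fin (n + 2) → A) = ceDiff coadjoint (theta f) v b := by
  have h1 : ∀ (i : Fin (n + 1)) (x : Fin (n + 1) → A) (y : A),
      i.castSucc.removeNth (Fin.snoc x y : Fin (n + 2) → A) =
        (Fin.snoc (i.removeNth x) y : Fin (n + 1) → A) := by
    intro i x y
    funext k
    refine Fin.lastCases ?_ (fun k => ?_) k
    · simp [Fin.removeNth]
    · simp [Fin.removeNth, Fin.castSucc_succAbove_castSucc]
  -- The brackets of `v i` with the last argument `b` become the coadjoint action; those among the
  -- `v i` remain brackets. The index of `b` itself contributes nothing, since the action is trivial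
  -- and no index lies beyond it.
  have h2 : ∀ i : Fin (n + 1), Finset.Ioi i.castSucc =
      insert (Fin.last (n + 1)) ((Finset.Ioi i).map Fin.castSuccEmb) := by
    intro i
    ext k
    refine Fin.lastCases ?_ (fun k => ?_) k
    · simp [Fin.castSucc_lt_last]
    · simp [Fin.le_last]
  have h3 : Finset.Ioi (Fin.last (n + 1)) = ∅ := by
    ext k; simp [Fin.le_last]
  rw [ceDiff, ceDiff, Fin.sum_univ_castSucc, LinearMap.sum_apply, h3]
  simp only [trivialAction, LinearMap.zero_apply, Finset.sum_empty, sub_zero, smul_zero, add_zero,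
    Fin.val_castSucc, Fin.snoc_castSucc]
  refine Finset.sum_congr rfl fun i _ => ?_
  rw [LinearMap.smul_apply, LinearMap.sub_apply, LinearMap.sum_apply, h2, Finset.sum_insert]
  · congr 1
    simp only [Fin.snoc_last, Fin.update_snoc_last, h1, Finset.sum_map, Fin.castSuccEmb_apply,
      Fin.snoc_castSucc, ← Fin.snoc_update, zero_sub, neg_add]
    rw [sub_eq_add_neg]
    congr 1
    change _ = f (Fin.snoc (i.removeNth v) (b * v i - v i * b))
    have := (theta f (i.removeNth v)).map_neg (b * v i - v i * b)
    rw [neg_sub] at this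
    change f (Fin.snoc (i.removeNth v) (v i * b - b * v i)) =
      - f (Fin.snoc (i.removeNth v) (b * v i - v i * b)) at this
    change - f (Fin.snoc (i.removeNth v) (v i * b - b * v i)) = _
    rw [this, neg_neg]
  · simp

/-- Every tuple is of the form `Fin.snoc v b`, so no information is lost by θ. -/
theorem isCocycle_trivialAction_of_theta {n : ℕ} {f : A [⋀^Fin (n + 1)]→ₗ[ℂ] ℂ}
    (h : IsCocycle coadjoint (theta f)) : IsCocycle trivialAction f := by
  intro v
  rw [← Fin.snoc_init_self v, ceDiff_trivialAction_snoc, h, LinearMap.zero_apply]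

/-- A signed sum over the permutations of `Fin 5`, sorted by the place of the last argument, which is
then brought to the last place by a cyclic rotation. -/
theorem sum_perm_five_eq_sum_rotations {X M : Type*} [AddCommGroup M]
    (w : Fin 5 → X) (G : (Fin 5 → X) → M) :
    ∑ ρ : Equiv.Perm (Fin 5), Equiv.Perm.sign ρ • G (w ∘ ρ) =
      ∑ σ : Equiv.Perm (Fin 4), Equiv.Perm.sign σ • ∑ m : Fin 5,
        G ((Fin.snoc (Fin.init w ∘ σ) (w 4) : Fin 5 → X) ∘ Equiv.addRight m) := by
  classical
  -- Exactly one rotation brings the last argument from its place `ρ.symm 4` to the last place; the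
  -- indicator singles out this `m`.
  have h1 : ∀ ρ : Equiv.Perm (Fin 5), G (w ∘ ρ) =
      ∑ m : Fin 5, if (ρ * Equiv.addRight (-m)) 4 = 4 then G (w ∘ ρ) else 0 := by
    intro ρ
    rw [Finset.sum_eq_single (4 - ρ.symm 4)]
    · simp
    · intro m _ hm
      rw [if_neg]
      intro h
      apply hm
      rw [Equiv.Perm.mul_apply, ← Equiv.eq_symm_apply] at h
      rw [← h]
      simp
    · simp
  have h2 : ∀ m : Fin 5, ∑ ρ : Equiv.Perm (Fin 5), Equiv.Perm.sign ρ •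
        (if (ρ * Equiv.addRight (-m)) 4 = 4 then G (w ∘ ρ) else 0) =
      ∑ ρ : Equiv.Perm (Fin 5), Equiv.Perm.sign ρ •
        (if ρ 4 = 4 then G (w ∘ ρ ∘ Equiv.addRight m) else 0) := by
    intro m
    -- A 5-cycle is even, hence so are all rotations of five places: no signs appear.
    have hs : ∀ m : Fin 5, Equiv.Perm.sign (Equiv.addRight m) = 1 := by decide
    refine Fintype.sum_equiv (Equiv.mulRight (Equiv.addRight (-m))) _ _ fun ρ => ?_
    simp only [Equiv.coe_mulRight, Equiv.Perm.sign_mul, hs, mul_one]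
    congr 3
    funext k
    simp
  have h3 : ∑ ρ : Equiv.Perm (Fin 5), Equiv.Perm.sign ρ • G (w ∘ ρ) =
      ∑ ρ : Equiv.Perm (Fin 5), ∑ m : Fin 5, Equiv.Perm.sign ρ •
        (if (ρ * Equiv.addRight (-m)) 4 = 4 then G (w ∘ ρ) else 0) :=
    Finset.sum_congr rfl fun ρ _ => by rw [← Finset.smul_sum, ← h1]
  rw [h3, Finset.sum_comm]
  simp only [Finset.smul_sum]
  conv_rhs => rw [Finset.sum_comm]
  refine Finset.sum_congr rfl fun m _ => ?_
  rw [h2]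
  -- Sorting by the value at the last place reduces to the permutations that fix it, that is, to the
  -- permutations of the first four arguments.
  have := sum_perm_eq_sum_insertNth (Fin.last 4) id (fun s : Fin 5 → Fin 5 =>
    if s 4 = 4 then G (w ∘ s ∘ Equiv.addRight m) else 0)
  simp only [Function.id_comp] at this
  rw [this, Finset.sum_eq_single (Fin.last 4)]
  · rw [Int.units_mul_self, one_smul]
    refine Finset.sum_congr rfl fun σ _ => ?_
    rw [if_pos (by simp)]
    congr 2
    rw [← Function.comp_assoc]
    congr 1
    rw [id, comp_insertNth, Fin.insertNth_last']
    congr 1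
    funext k
    exact congrArg w (Fin.succAbove_last_apply (σ k))
  · intro i _ hi
    rw [Finset.sum_eq_zero, smul_zero]
    intro σ _
    rw [if_neg, smul_zero]
    rw [show (4 : Fin 5) = Fin.last 4 from rfl, Fin.insertNth_last', Fin.snoc_last]
    exact hi
  · simp

end Theta

/-! ### Explicit Hochschild coboundaries and alternation over indices -/

section Hochschild

variable {A : Type*} [NonUnitalRing A]

theorem hochDiff_three (F : (Fin 3 → A) → A) (w : Fin 4 → A) :
    hochDiff F w = w 0 * F ![w 1, w 2, w 3] - F ![w 0 * w 1, w 2, w 3] + F ![w 0, w 1 * w 2, w 3] -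
      F ![w 0, w 1, w 2 * w 3] + F ![w 0, w 1, w 2] * w 3 := by
  have e1 : Fin.tail w = ![w 1, w 2, w 3] := by ext i; fin_cases i <;> rfl
  have e2 : Fin.init w = ![w 0, w 1, w 2] := by ext i; fin_cases i <;> rfl
  have e3 : contract 0 w = ![w 0 * w 1, w 2, w 3] := by ext i; fin_cases i <;> rfl
  have e4 : contract 1 w = ![w 0, w 1 * w 2, w 3] := by ext i; fin_cases i <;> rfl
  have e5 : contract 2 w = ![w 0, w 1, w 2 * w 3] := by ext i; fin_cases i <;> rfl
  rw [hochDiff, Fin.sum_univ_three, e1, e2, e3, e4, e5]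
  simp only [Fin.val_zero, Fin.val_one, Fin.val_two, pow_zero, pow_one, one_smul, Units.neg_smul,
    even_two.neg_one_pow, (by decide : Odd 3).neg_one_pow]
  rw [show Fin.last 3 = 3 from rfl]
  abel

theorem hochDiff_four (F : (Fin 4 → A) → A) (w : Fin 5 → A) :
    hochDiff F w = w 0 * F ![w 1, w 2, w 3, w 4] - F ![w 0 * w 1, w 2, w 3, w 4] +
      F ![w 0, w 1 * w 2, w 3, w 4] - F ![w 0, w 1, w 2 * w 3, w 4] +
      F ![w 0, w 1, w 2, w 3 * w 4] - F ![w 0, w 1, w 2, w 3] * w 4 := by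
  have e1 : Fin.tail w = ![w 1, w 2, w 3, w 4] := by ext i; fin_cases i <;> rfl
  have e2 : Fin.init w = ![w 0, w 1, w 2, w 3] := by ext i; fin_cases i <;> rfl
  have e3 : contract 0 w = ![w 0 * w 1, w 2, w 3, w 4] := by ext i; fin_cases i <;> rfl
  have e4 : contract 1 w = ![w 0, w 1 * w 2, w 3, w 4] := by ext i; fin_cases i <;> rfl
  have e5 : contract 2 w = ![w 0, w 1, w 2 * w 3, w 4] := by ext i; fin_cases i <;> rfl
  have e6 : contract 3 w = ![w 0, w 1, w 2, w 3 * w 4] := by ext i; fin_cases i <;> rfl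
  rw [hochDiff, Fin.sum_univ_four, e1, e2, e3, e4, e5, e6]
  simp only [Fin.val_zero, Fin.val_one, Fin.val_two, pow_zero, pow_one, one_smul, Units.neg_smul,
    even_two.neg_one_pow, (by decide : Even 4).neg_one_pow,
    show ((3 : Fin 4) : ℕ) = 3 from rfl, (by decide : Odd 3).neg_one_pow]
  rw [show Fin.last 4 = 4 from rfl]
  abel

variable [Module ℂ A]

/-- The sum defining `alt`, as a multilinear map that remains to be alternated over the arguments. -/
def altIndices {n : ℕ} (F : (Fin 4 → Fin 4) → MultilinearMap ℂ (fun _ : Fin n => A) A) :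
    MultilinearMap ℂ (fun _ : Fin n => A) A :=
  ∑ τ : Equiv.Perm (Fin 4), Equiv.Perm.sign τ • F τ

theorem alt_eq_alternatization {n : ℕ}
    (F : (Fin 4 → Fin 4) → MultilinearMap ℂ (fun _ : Fin n => A) A) :
    alt (fun τ => F τ) = MultilinearMap.alternatization (altIndices F) := by
  rw [alt, altIndices, map_sum]
  refine Finset.sum_congr rfl fun τ _ => ?_
  rcases Int.units_eq_one_or (Equiv.Perm.sign τ) with h | h <;> simp [h]

theorem altTrace_smul {Tr : A →ₗ[ℂ] ℂ} (c : ℂ) (f : (Fin 4 → Fin 4) → A) :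
    altTrace Tr (fun d => c • f d) = c * altTrace Tr f := by
  simp only [altTrace, map_smul, Finset.mul_sum, smul_eq_mul, mul_smul_comm]

theorem hochDiff_altIndices {n : ℕ}
    (F : (Fin 4 → Fin 4) → MultilinearMap ℂ (fun _ : Fin n => A) A) (w : Fin (n + 1) → A) :
    hochDiff (altIndices F) w =
      ∑ τ : Equiv.Perm (Fin 4), Equiv.Perm.sign τ • hochDiff (F τ) w := by
  have h : ∀ x : Fin n → A, altIndices F x = ∑ τ : Equiv.Perm (Fin 4), Equiv.Perm.sign τ • F τ x := by
    intro x
    simp [altIndices]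
  simp only [hochDiff, h, smul_sub, Finset.sum_sub_distrib, Finset.mul_sum, Finset.sum_mul,
    Finset.smul_sum, mul_smul_comm, smul_mul_assoc]
  congr 2
  · rw [Finset.sum_comm]
    exact Finset.sum_congr rfl fun _ _ => Finset.sum_congr rfl fun _ _ => by rw [smul_comm]
  · exact funext fun _ => by rw [smul_comm]

theorem alt_apply {n : ℕ} (F : (Fin 4 → Fin 4) → MultilinearMap ℂ (fun _ : Fin n => A) A)
    (v : Fin n → A) :
    alt (fun τ => F τ) v = ∑ σ : Equiv.Perm (Fin n), Equiv.Perm.sign σ •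
      ∑ τ : Equiv.Perm (Fin 4), Equiv.Perm.sign τ • F τ (v ∘ σ) := by
  rw [alt_eq_alternatization, MultilinearMap.alternatization_apply]
  simp [altIndices, Function.comp_def]

theorem theta_apply {n : ℕ} (f : A [⋀^Fin (n + 1)]→ₗ[ℂ] ℂ) (v : Fin n → A) (b : A) :
    theta f v b = f (Fin.snoc v b) := rfl

theorem IsCocycle.smul {n : ℕ} {M : Type*} [AddCommGroup M] [Module ℂ M] {ρ : A → M →ₗ[ℂ] M}
    {f : A [⋀^Fin n]→ₗ[ℂ] M} (hf : IsCocycle ρ f) (c : ℂ) : IsCocycle ρ (c • f) := fun v => by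
  rw [ceDiff_smul, hf, smul_zero]

theorem trace_alt {Tr : A →ₗ[ℂ] ℂ} {n : ℕ} (F : (Fin 4 → Fin 4) → MultilinearMap ℂ (fun _ : Fin n => A) A)
    (v : Fin n → A) :
    Tr (alt (fun τ => F τ) v) = ∑ σ : Equiv.Perm (Fin n), Equiv.Perm.sign σ •
      altTrace Tr (fun d => F d (v ∘ σ)) := by
  simp only [alt_apply, map_sum, LinearMap.map_smul_of_tower, altTrace]

theorem trace_alt_mul {Tr : A →ₗ[ℂ] ℂ} {n : ℕ} (F : (Fin 4 → Fin 4) → MultilinearMap ℂ (fun _ : Fin n => A) A)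
    (v : Fin n → A) (b : A) :
    Tr (alt (fun τ => F τ) v * b) = ∑ σ : Equiv.Perm (Fin n), Equiv.Perm.sign σ •
      altTrace Tr (fun d => F d (v ∘ σ) * b) := by
  simp only [alt_apply, Finset.sum_mul, smul_mul_assoc, map_sum, LinearMap.map_smul_of_tower,
    altTrace]

end Hochschild

/-! ### The cocycle Ψ₅ and its comparison with α* -/

section Assembly

variable {A : Type*} [NonUnitalRing A] [Module ℂ A] [IsScalarTower ℂ A A] [SMulCommClass ℂ A A]

/-- `(a₁, a₂, a₃) ↦ L₁ a₁ L₂ a₂ L₃ a₃`. -/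
def prod3 (L : Fin 3 → A →ₗ[ℂ] A) : MultilinearMap ℂ (fun _ : Fin 3 => A) A where
  toFun a := L 0 (a 0) * L 1 (a 1) * L 2 (a 2)
  map_update_add' := by
    intro inst a i x y
    obtain rfl : inst = instDecidableEqFin 3 := Subsingleton.elim _ _
    have hi : i = 0 ∨ i = 1 ∨ i = 2 := by omega
    rcases hi with rfl | rfl | rfl <;> simp [mul_add, add_mul]
  map_update_smul' := by
    intro inst a i c x
    obtain rfl : inst = instDecidableEqFin 3 := Subsingleton.elim _ _
    have hi : i = 0 ∨ i = 1 ∨ i = 2 := by omega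
    rcases hi with rfl | rfl | rfl <;> simp [mul_smul_comm, smul_mul_assoc]

/-- The adjoint cocycle obtained from `D₁ a₁ ⋯ D₄ a₄` by adding all terms in which pairs of
neighbours `D_i a D_j b` are replaced by `a Q_ij b`. -/
def curvedProd (D : Fin 4 → A →ₗ[ℂ] A) (Q : Fin 4 → Fin 4 → A) (d : Fin 4 → Fin 4) :
    MultilinearMap ℂ (fun _ : Fin 4 => A) A :=
  let q (i j : Fin 4) : A →ₗ[ℂ] A := LinearMap.mulRight ℂ (Q i j)
  let I : A →ₗ[ℂ] A := LinearMap.id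
  prod4 ![D (d 0), D (d 1), D (d 2), D (d 3)] +
    (1 / 2 : ℂ) • prod4 ![q (d 0) (d 1), I, D (d 2), D (d 3)] +
    (1 / 2 : ℂ) • prod4 ![D (d 0), q (d 1) (d 2), I, D (d 3)] +
    (1 / 2 : ℂ) • prod4 ![D (d 0), D (d 1), q (d 2) (d 3), I] +
    (1 / 4 : ℂ) • prod4 ![q (d 0) (d 1), I, q (d 2) (d 3), I]

/-- A primitive of the difference of `curvedProd` and `D₁ a₁ ⋯ D₄ a₄`. -/
def transgression (D : Fin 4 → A →ₗ[ℂ] A) (Q : Fin 4 → Fin 4 → A) (d : Fin 4 → Fin 4) :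
    MultilinearMap ℂ (fun _ : Fin 3 => A) A :=
  let q (i j : Fin 4) : A →ₗ[ℂ] A := LinearMap.mulLeft ℂ (Q i j)
  let I : A →ₗ[ℂ] A := LinearMap.id
  (1 / 2 : ℂ) • prod3 ![D (d 0), D (d 1), q (d 2) (d 3)] -
    (1 / 2 : ℂ) • prod3 ![D (d 0), q (d 1) (d 2), D (d 3)] +
    (1 / 2 : ℂ) • prod3 ![q (d 0) (d 1), D (d 2), D (d 3)] +
    (1 / 4 : ℂ) • prod3 ![q (d 0) (d 1), I, q (d 2) (d 3)]

variable {Tr : A →ₗ[ℂ] ℂ} {D : Fin 4 → A →ₗ[ℂ] A} {Q : Fin 4 → Fin 4 → A}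

theorem prod4_apply (L : Fin 4 → A →ₗ[ℂ] A) (a : Fin 4 → A) :
    prod4 L a = L 0 (a 0) * L 1 (a 1) * L 2 (a 2) * L 3 (a 3) := rfl

theorem prod5_apply (L : Fin 5 → A →ₗ[ℂ] A) (a : Fin 5 → A) :
    prod5 L a = L 0 (a 0) * L 1 (a 1) * L 2 (a 2) * L 3 (a 3) * L 4 (a 4) := rfl

theorem prod3_apply (L : Fin 3 → A →ₗ[ℂ] A) (a : Fin 3 → A) :
    prod3 L a = L 0 (a 0) * L 1 (a 1) * L 2 (a 2) := rfl

/-- By the signed Leibniz rule for cup products, at fixed indices: `D` is closed, and left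
multiplication by `Q` has coboundary (x, y) ↦ xQy. The signs in `transgression` are those of the
position of `Q`. In its last word (Qx) y (Qz) the coboundary (x, y) ↦ xy of the identity cancels
that of the second `Q`, leaving x Q y z Q w. -/
theorem hochDiff_transgression (h : LiftingConditions Tr D Q) (d : Fin 4 → Fin 4) (w : Fin 4 → A) :
    hochDiff (transgression D Q d) w =
      curvedProd D Q d w - prod4 ![D (d 0), D (d 1), D (d 2), D (d 3)] w := by
  rw [hochDiff_three]
  simp [transgression, curvedProd, prod4_apply, prod3_apply, h.leibniz, mul_add, add_mul, mul_sub,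
    sub_mul, mul_assoc, mul_smul_comm, smul_mul_assoc, smul_add]
  abel

/-- A derivation is a Hochschild 1-cocycle, and cup products of cocycles are cocycles. -/
theorem hochDiff_prod4_eq_zero (h : LiftingConditions Tr D Q) (d : Fin 4 → Fin 4) (w : Fin 5 → A) :
    hochDiff (prod4 ![D (d 0), D (d 1), D (d 2), D (d 3)]) w = 0 := by
  rw [hochDiff_four]
  simp [prod4_apply, h.leibniz, mul_add, add_mul, mul_assoc]

/-- Each word is a cup product of 1-cocycles `D` and 2-cocycles (x, y) ↦ xQy; the latter is closed
for any `Q` by associativity. -/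
theorem hochDiff_curvedProd (h : LiftingConditions Tr D Q) (d : Fin 4 → Fin 4) (w : Fin 5 → A) :
    hochDiff (curvedProd D Q d) w = 0 := by
  rw [hochDiff_four]
  simp [curvedProd, prod4_apply, h.leibniz, mul_add, add_mul,
    mul_assoc, mul_smul_comm, smul_mul_assoc, smul_add]
  abel

theorem ceDiff_coadjoint_alt (h : LiftingConditions Tr D Q) {n : ℕ}
    (F : (Fin 4 → Fin 4) → MultilinearMap ℂ (fun _ : Fin n => A) A) (v : Fin (n + 1) → A) (b : A) :
    ceDiff coadjoint (traceDual Tr (alt (fun τ => F τ))) v b =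
      Tr ((∑ σ : Equiv.Perm (Fin (n + 1)), Equiv.Perm.sign σ •
        ∑ τ : Equiv.Perm (Fin 4), Equiv.Perm.sign τ • hochDiff (F τ) (v ∘ σ)) * b) := by
  rw [alt_eq_alternatization, ceDiff_coadjoint_alternatization Tr h.trace_comm]
  simp only [hochDiff_altIndices]

theorem alphaStar_eq_traceDual_alt :
    alphaStar Tr D = traceDual Tr (alt (fun τ =>
      prod4 ![D (τ 0), D (τ 1), D (τ 2), D (τ 3)])) := by
  rw [alphaStar, traceDual, alpha]
  congr 3

theorem isCocycle_alphaStar (h : LiftingConditions Tr D Q) :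
    IsCocycle coadjoint (alphaStar Tr D) := by
  intro v
  ext b
  rw [alphaStar_eq_traceDual_alt,
    ceDiff_coadjoint_alt h (fun d => prod4 ![D (d 0), D (d 1), D (d 2), D (d 3)])]
  simp [hochDiff_prod4_eq_zero h]

theorem isCocycle_curvedProd (h : LiftingConditions Tr D Q) :
    IsCocycle coadjoint (traceDual Tr (alt (fun τ => curvedProd D Q τ))) := by
  intro v
  ext b
  rw [ceDiff_coadjoint_alt h]
  simp [hochDiff_curvedProd h]

/-- For each permutation of the first four arguments, the last argument visits all five places by
rotations, and `altTrace_rotations` adds these up to five times the term in which it comes last.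
This is an equality of cochains, not only of classes. -/
theorem theta_psi5 (h : LiftingConditions Tr D Q) :
    theta (psi5 Tr D Q) = (5 : ℂ) • traceDual Tr (alt (fun τ => curvedProd D Q τ)) := by
  ext v b
  let q (i j : Fin 4) : A →ₗ[ℂ] A := LinearMap.mulRight ℂ (Q i j)
  let I : A →ₗ[ℂ] A := LinearMap.id
  let G : (Fin 4 → Fin 4) → MultilinearMap ℂ (fun _ : Fin 5 => A) A := fun d =>
    prod5 ![D (d 0), D (d 1), D (d 2), D (d 3), I] +
      (1 / 2 : ℂ) • prod5 ![q (d 0) (d 1), I, D (d 2), D (d 3), I] +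
      (1 / 2 : ℂ) • prod5 ![D (d 0), q (d 1) (d 2), I, D (d 3), I] +
      (1 / 2 : ℂ) • prod5 ![D (d 0), D (d 1), q (d 2) (d 3), I, I] +
      (1 / 4 : ℂ) • prod5 ![q (d 0) (d 1), I, q (d 2) (d 3), I, I]
  have h0 : ∀ w, psi5 Tr D Q w =
      ∑ ρ : Equiv.Perm (Fin 5), Equiv.Perm.sign ρ • altTrace Tr (fun d => G d (w ∘ ρ)) := by
    intro w
    rw [psi5, LinearMap.compAlternatingMap_apply]
    simp only [AlternatingMap.add_apply, AlternatingMap.smul_apply, map_add, map_smul]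
    rw [trace_alt (fun d => prod5 ![D (d 0), D (d 1), D (d 2), D (d 3), I]),
      trace_alt (fun d => prod5 ![q (d 0) (d 1), I, D (d 2), D (d 3), I]),
      trace_alt (fun d => prod5 ![D (d 0), q (d 1) (d 2), I, D (d 3), I]),
      trace_alt (fun d => prod5 ![D (d 0), D (d 1), q (d 2) (d 3), I, I]),
      trace_alt (fun d => prod5 ![q (d 0) (d 1), I, q (d 2) (d 3), I, I])]
    simp only [G, add_apply, smul_apply, altTrace_add, altTrace_smul, smul_add,
      Finset.sum_add_distrib, smul_eq_mul, Finset.mul_sum, mul_smul_comm]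
  rw [theta_apply, AlternatingMap.smul_apply, LinearMap.smul_apply, traceDual_apply, smul_eq_mul, h0, trace_alt_mul, sum_perm_five_eq_sum_rotations _ fun w => altTrace Tr (fun d => G d w),
    Finset.mul_sum]
  refine Finset.sum_congr rfl fun σ _ => ?_
  rw [mul_smul_comm]
  congr 1
  set a : Fin 4 → A := v ∘ σ
  have ha : (Fin.snoc (Fin.init (Fin.snoc v b : Fin 5 → A) ∘ σ) ((Fin.snoc v b : Fin 5 → A) 4) :
      Fin 5 → A) = ![a 0, a 1, a 2, a 3, b] := by
    rw [show (Fin.snoc v b : Fin 5 → A) 4 = b from Fin.snoc_last _ _, Fin.init_snoc]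
    funext i
    fin_cases i <;> rfl
  rw [ha]
  have hr := altTrace_rotations a b h
  have e0 : ![a 0, a 1, a 2, a 3, b] ∘ Equiv.addRight (0 : Fin 5) = ![a 0, a 1, a 2, a 3, b] := by
    funext i; fin_cases i <;> rfl
  have e1 : ![a 0, a 1, a 2, a 3, b] ∘ Equiv.addRight (1 : Fin 5) = ![a 1, a 2, a 3, b, a 0] := by
    funext i; fin_cases i <;> rfl
  have e2 : ![a 0, a 1, a 2, a 3, b] ∘ Equiv.addRight (2 : Fin 5) = ![a 2, a 3, b, a 0, a 1] := by
    funext i; fin_cases i <;> rfl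
  have e3 : ![a 0, a 1, a 2, a 3, b] ∘ Equiv.addRight (3 : Fin 5) = ![a 3, b, a 0, a 1, a 2] := by
    funext i; fin_cases i <;> rfl
  have e4 : ![a 0, a 1, a 2, a 3, b] ∘ Equiv.addRight (4 : Fin 5) = ![b, a 0, a 1, a 2, a 3] := by
    funext i; fin_cases i <;> rfl
  rw [Fin.sum_univ_five, e0, e1, e2, e3, e4]
  simp [G, q, I, curvedProd, prod5_apply, prod4_apply, add_mul, smul_mul_assoc, altTrace_add,
    altTrace_smul, mul_assoc]
  linear_combination hr

/-- The cochain `psi5` lifts `5 • alphaStar` up to the coboundary of the alternated transgression. -/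
theorem theta_psi5_sub_alphaStar (h : LiftingConditions Tr D Q) (v : Fin 4 → A) :
    (theta (psi5 Tr D Q) - (5 : ℂ) • alphaStar Tr D) v =
      ceDiff coadjoint ((5 : ℂ) • traceDual Tr (alt (fun τ => transgression D Q τ))) v := by
  ext b
  rw [ceDiff_smul, theta_psi5 h, alphaStar_eq_traceDual_alt, LinearMap.smul_apply,
    ceDiff_coadjoint_alt h, AlternatingMap.sub_apply, AlternatingMap.smul_apply,
    AlternatingMap.smul_apply, LinearMap.sub_apply, LinearMap.smul_apply, LinearMap.smul_apply,
    traceDual_apply, traceDual_apply, ← smul_sub, ← map_sub, ← sub_mul, alt_apply,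
    alt_apply (fun d => prod4 ![D (d 0), D (d 1), D (d 2), D (d 3)])]
  simp only [hochDiff_transgression h, smul_sub, Finset.sum_sub_distrib]

theorem isCocycle_theta_psi5 (h : LiftingConditions Tr D Q) :
    IsCocycle coadjoint (theta (psi5 Tr D Q)) := by
  have := (isCocycle_curvedProd h).smul 5
  rwa [← theta_psi5 h] at this

theorem isCocycle_psi5 (h : LiftingConditions Tr D Q) : IsCocycle trivialAction (psi5 Tr D Q) :=
  isCocycle_trivialAction_of_theta (n := 4) (isCocycle_theta_psi5 h)

theorem cohomologous_theta_psi5 (h : LiftingConditions Tr D Q) :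
    Cohomologous coadjoint (theta (psi5 Tr D Q)) ((5 : ℂ) • alphaStar Tr D) := by
  refine ⟨(5 : ℂ) • traceDual Tr (alt (fun τ => transgression D Q τ)), fun v => ?_⟩
  rw [← theta_psi5_sub_alphaStar h v]

end Assembly

namespace PsiDif

variable {n : ℕ}

/-! ### Multiplication by the generators, and generation of the monomials -/

section Products

theorem fallFact_zero (x : ℂ) : fallFact x 0 = 1 := by simp [fallFact]

theorem fallFact_one (x : ℂ) : fallFact x 1 = x := by simp [fallFact]

theorem fallFact_succ (x : ℂ) (k : ℕ) : fallFact x (k + 1) = fallFact x k * (x - k) := by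
  simp [fallFact, Finset.prod_range_succ]

theorem fallFact_succ' (x : ℂ) (k : ℕ) : fallFact x (k + 1) = x * fallFact (x - 1) k := by
  rw [add_comm, fallFact_add, fallFact_one]; simp

/-- The discrete derivative of a falling factorial. It is the source of the telescoping by which the
logarithms are seen to satisfy the Leibniz rule. -/
theorem fallFact_add_one_sub (x : ℂ) (k : ℕ) :
    fallFact (x + 1) (k + 1) - fallFact x (k + 1) = (k + 1) * fallFact x k := by
  rw [fallFact_succ', fallFact_succ, add_sub_cancel_right]; ring

theorem fallFact_natCast_of_lt {j k : ℕ} (h : j < k) : fallFact (j : ℂ) k = 0 :=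
  Finset.prod_eq_zero (Finset.mem_range.mpr h) (sub_self _)

theorem monomial_coeff (a b : Fin n → ℤ) (c : ℂ) (L : MonExp n) :
    (monomial a b c).1 L = if L = (a, b) then c else 0 := by
  change (Pi.single (a, b) c : MonExp n → ℂ) L = _
  rw [Pi.single_apply]

theorem monomial_mul_coeff (a : Fin n → ℤ) (c : ℂ) (f : PsiDif n) (L : MonExp n) :
    (monomial a 0 c * f).1 L = c * f.1 (L - (a, 0)) := by
  rw [mul_apply, finsum_eq_single _ ((a, 0), 0)]
  · simp [mulTerm, monomial_coeff, diagExp_zero, structConst_zero]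
  · rintro ⟨P, k⟩ h
    by_cases hP : P = (a, 0)
    · have hk : k ≠ 0 := fun hk => h (by rw [hP, hk])
      simp [mulTerm, hP, structConst_zero_left _ _ hk]
    · simp [mulTerm, monomial_coeff, hP]

theorem mul_monomial_coeff (b : Fin n → ℤ) (c : ℂ) (f : PsiDif n) (L : MonExp n) :
    (f * monomial 0 b c).1 L = f.1 (L - (0, b)) * c := by
  rw [mul_apply, finsum_eq_single _ (L - (0, b), 0)]
  · simp [mulTerm, monomial_coeff, diagExp_zero, structConst_zero]
  · rintro ⟨P, k⟩ h
    by_cases hP : L - P + diagExp k = (0, b)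
    · have hk : k ≠ 0 := by
        rintro rfl
        refine h ?_
        rw [diagExp_zero, add_zero] at hP
        rw [← hP, sub_sub_cancel]
      simp [mulTerm, hP, structConst_zero_right _ _ hk]
    · simp [mulTerm, monomial_coeff, hP]

theorem zero_ne_single (j : Fin n) : (0 : Fin n → ℕ) ≠ Pi.single j 1 := fun h => by
  simpa using congrFun h j

/-- The falling factorials of 1 vanish from length 2 on and those of 0 from length 1 on: a single
`∂_j` can be contracted at most once, with `x_j`. -/
theorem structConst_single_left (j : Fin n) (c : Fin n → ℤ) (k : Fin n → ℕ) (hk : k ≠ 0)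
    (hk' : k ≠ Pi.single j 1) : structConst (Pi.single j 1) c k = 0 := by
  by_cases h : ∃ i, i ≠ j ∧ k i ≠ 0
  · obtain ⟨i, hi, hki⟩ := h
    exact Finset.prod_eq_zero (Finset.mem_univ i) (by simp [hi, fallFact_zero_left _ hki])
  · push Not at h
    have hj : 1 < k j := by
      by_contra hlt
      have : k j = 0 ∨ k j = 1 := by omega
      rcases this with h0 | h1
      · exact hk (funext fun i => by
          by_cases hi : i = j
          · rw [hi, h0]; rfl
          · exact h i hi)
      · exact hk' (funext fun i => by
          by_cases hi : i = j
          · rw [hi, h1]; simp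
          · simp [h i hi, hi])
    refine Finset.prod_eq_zero (Finset.mem_univ j) ?_
    have := fallFact_natCast_of_lt hj
    simp only [Nat.cast_one] at this
    simp [this]

theorem structConst_single_right (j : Fin n) (b : Fin n → ℤ) (k : Fin n → ℕ) (hk : k ≠ 0)
    (hk' : k ≠ Pi.single j 1) : structConst b (Pi.single j 1) k = 0 := by
  rw [← structConst_single_left j b k hk hk']
  exact Finset.prod_congr rfl fun i _ => by rw [mul_comm (fallFact (b i : ℂ) (k i))]

theorem structConst_single_single_left (j : Fin n) (c : Fin n → ℤ) :
    structConst (Pi.single j 1) c (Pi.single j 1) = c j := by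
  rw [structConst, Finset.prod_eq_single j]
  · simp [fallFact_one]
  · intro i _ hi
    simp [hi, fallFact_zero]
  · simp

theorem structConst_single_single_right (j : Fin n) (b : Fin n → ℤ) :
    structConst b (Pi.single j 1) (Pi.single j 1) = b j := by
  rw [structConst, Finset.prod_eq_single j]
  · simp [fallFact_one]
  · intro i _ hi
    simp [hi, fallFact_zero]
  · simp

theorem diagExp_single (j : Fin n) (k : ℕ) :
    diagExp (Pi.single j k) = ((Pi.single j (k : ℤ), Pi.single j (k : ℤ)) : MonExp n) := by
  ext i <;> by_cases h : i = j <;> simp [diagExp, h, Pi.single_apply]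

theorem varX_mul_coeff (j : Fin n) (f : PsiDif n) (L : MonExp n) :
    (varX j * f).1 L = f.1 (L - (Pi.single j 1, 0)) := by
  rw [varX, monomial_mul_coeff, _root_.one_mul]

theorem mul_varD_coeff (j : Fin n) (f : PsiDif n) (L : MonExp n) :
    (f * varD j).1 L = f.1 (L - (0, Pi.single j 1)) := by
  rw [varD, mul_monomial_coeff, _root_.mul_one]

/-- The Leibniz rule ∂_j ∘ f = f ∂_j + ∂f/∂x_j, read on coefficients. -/
theorem varD_mul_coeff (j : Fin n) (f : PsiDif n) (L : MonExp n) :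
    (varD j * f).1 L =
      f.1 (L - (0, Pi.single j 1)) + (L.1 j + 1) * f.1 (L + (Pi.single j 1, 0)) := by
  have e0 : L - ((0, Pi.single j 1) : MonExp n) + diagExp 0 = L - (0, Pi.single j 1) := by
    rw [diagExp_zero, add_zero]
  have e1 : L - ((0, Pi.single j 1) : MonExp n) + diagExp (Pi.single j 1) =
      L + (Pi.single j 1, 0) := by
    rw [diagExp_single]; ext i <;> simp
  rw [mul_apply, finsum_eq_sum_of_support_subset (s :=
    {(((0, Pi.single j 1) : MonExp n), (0 : Fin n → ℕ)), ((0, Pi.single j 1), Pi.single j 1)})]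
  · rw [Finset.sum_pair (by simp [zero_ne_single j])]
    simp only [mulTerm, e0, e1, varD, monomial_coeff, if_true, structConst_zero,
      structConst_single_single_left]
    simp
    ring
  · rintro ⟨P, k⟩ h
    by_contra h'
    refine h ?_
    by_cases hP : P = (0, Pi.single j 1)
    · simp only [hP, Finset.coe_insert, Finset.coe_singleton, Set.mem_insert_iff,
        Set.mem_singleton_iff, Prod.mk.injEq, true_and, not_or] at h'
      simp [mulTerm, hP, structConst_single_left j _ k h'.1 h'.2]
    · simp [mulTerm, varD, monomial_coeff, hP]

theorem mul_varX_coeff (j : Fin n) (f : PsiDif n) (L : MonExp n) :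
    (f * varX j).1 L =
      f.1 (L - (Pi.single j 1, 0)) + (L.2 j + 1) * f.1 (L + (0, Pi.single j 1)) := by
  have e0 : L - (L - ((Pi.single j 1, 0) : MonExp n)) + diagExp 0 = (Pi.single j 1, 0) := by
    rw [diagExp_zero, add_zero, sub_sub_cancel]
  have e1 : L - (L + ((0, Pi.single j 1) : MonExp n)) + diagExp (Pi.single j 1) =
      (Pi.single j 1, 0) := by
    rw [diagExp_single]; ext i <;> simp
  rw [mul_apply, finsum_eq_sum_of_support_subset (s :=
    {(L - ((Pi.single j 1, 0) : MonExp n), (0 : Fin n → ℕ)),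
      (L + (0, Pi.single j 1), Pi.single j 1)})]
  · rw [Finset.sum_pair (by simp [zero_ne_single j])]
    simp only [mulTerm, e0, e1, varX, monomial_coeff, if_true, structConst_zero,
      structConst_single_single_right]
    simp
    ring
  · rintro ⟨P, k⟩ h
    by_contra h'
    refine h ?_
    by_cases hQ : L - P + diagExp k = (Pi.single j 1, 0)
    · have hP : P = L + diagExp k - (Pi.single j 1, 0) := by rw [← hQ]; abel
      have h0 : k ≠ 0 := by
        rintro rfl
        exact h' (by rw [hP, diagExp_zero, add_zero]; simp)
      have h1 : k ≠ Pi.single j 1 := by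
        rintro rfl
        refine h' ?_
        have : P = L + (0, Pi.single j 1) := by
          rw [hP, diagExp_single]; ext i <;> simp
        simp [this]
      simp [mulTerm, hQ, structConst_single_right j _ k h0 h1]
    · simp [mulTerm, varX, monomial_coeff, hQ]

/-- The operator `x_j⁻¹`. -/
def varXInv (j : Fin n) : PsiDif n := monomial (Pi.single j (-1)) 0 1

/-- The operator `∂_j⁻¹`. -/
def varDInv (j : Fin n) : PsiDif n := monomial 0 (Pi.single j (-1)) 1

theorem monomial_mul_monomial (a a' b b' : Fin n → ℤ) (c : ℂ) :
    monomial a 0 c * monomial a' b 1 = monomial (a + a') b c ∧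
      monomial a b c * monomial 0 b' 1 = monomial a (b + b') c := by
  constructor <;> ext L
  · rw [monomial_mul_coeff, monomial_coeff, monomial_coeff]
    simp only [sub_eq_iff_eq_add, mul_ite, mul_one, mul_zero]
    congr 1
    simp [add_comm]
  · rw [mul_monomial_coeff, monomial_coeff, monomial_coeff]
    simp only [sub_eq_iff_eq_add, mul_one]
    congr 1
    simp

theorem smul_monomial (a b : Fin n → ℤ) (c : ℂ) : monomial a b c = c • monomial a b 1 := by
  ext L
  change _ = c • (monomial a b 1).1 L
  rw [monomial_coeff, monomial_coeff]
  simp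

theorem monomial_zero : monomial (0 : Fin n → ℤ) 0 1 = 1 := rfl

theorem varX_mul_varXInv (j : Fin n) : varX j * varXInv j = 1 := by
  rw [varX, varXInv, (monomial_mul_monomial _ _ _ 0 _).1, ← Pi.single_add]
  simp [monomial_zero]

theorem varXInv_mul_varX (j : Fin n) : varXInv j * varX j = 1 := by
  rw [varX, varXInv, (monomial_mul_monomial _ _ _ 0 _).1, ← Pi.single_add]
  simp [monomial_zero]

theorem varD_mul_varDInv (j : Fin n) : varD j * varDInv j = 1 := by
  rw [varD, varDInv, (monomial_mul_monomial _ 0 _ _ _).2, ← Pi.single_add]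
  simp [monomial_zero]

theorem varDInv_mul_varD (j : Fin n) : varDInv j * varD j = 1 := by
  rw [varD, varDInv, (monomial_mul_monomial _ 0 _ _ _).2, ← Pi.single_add]
  simp [monomial_zero]

/-- The monomials are generated by the operators `x_j`, `∂_j` and their inverses. -/
theorem monomial_induction {p : PsiDif n → Prop} (one : p 1) (mul : ∀ f g, p f → p g → p (f * g))
    (inv : ∀ f g, f * g = 1 → g * f = 1 → p f → p g) (hX : ∀ j, p (varX j)) (hD : ∀ j, p (varD j))
    (a b : Fin n → ℤ) : p (monomial a b 1) := by
  -- The powers of the `x_j` and those of the `∂_j` are treated at once, as homomorphisms `m` from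
  -- the group of exponents; `inv` reaches the negative exponents.
  have key : ∀ m : (Fin n → ℤ) → PsiDif n, m 0 = 1 → (∀ a a', m (a + a') = m a * m a') →
      (∀ j, p (m (Pi.single j 1))) → ∀ a, p (m a) := by
    intro m h0 hadd h1 a
    have hinv : ∀ a, m a * m (-a) = 1 ∧ m (-a) * m a = 1 := fun a => by
      rw [← hadd, ← hadd]; simp [h0]
    have hnat : ∀ (j : Fin n) (k : ℕ), p (m (Pi.single j (k : ℤ))) := by
      intro j k
      induction k with
      | zero => simpa [h0] using one
      | succ k ih =>
        rw [Nat.cast_succ, Pi.single_add, hadd]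
        exact mul _ _ ih (h1 j)
    have hint : ∀ (j : Fin n) (k : ℤ), p (m (Pi.single j k)) := by
      intro j k
      obtain ⟨k, rfl | rfl⟩ := k.eq_nat_or_neg
      · exact hnat j k
      · rw [Pi.single_neg]
        exact inv _ _ (hinv _).1 (hinv _).2 (hnat j k)
    have hsum : ∀ s : Finset (Fin n), p (m (∑ j ∈ s, Pi.single j (a j))) := by
      intro s
      induction s using Finset.induction_on with
      | empty => simpa [h0] using one
      | insert j s hj ih =>
        rw [Finset.sum_insert hj, hadd]
        exact mul _ _ (hint j _) ih
    simpa [Finset.univ_sum_single] using hsum Finset.univ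
  have hx := key (fun a => monomial a 0 1) rfl
    (fun a a' => ((monomial_mul_monomial a a' 0 0 1).1).symm) hX a
  have hd := key (fun b => monomial 0 b 1) rfl
    (fun b b' => ((monomial_mul_monomial 0 0 b b' 1).2).symm) hD b
  have : monomial a b 1 = monomial a 0 1 * monomial 0 b 1 := by
    rw [(monomial_mul_monomial a 0 b 0 1).1, add_zero]
  rw [this]
  exact mul _ _ hx hd

end Products

/-! ### Continuity with respect to the order, and reduction to monomials -/

section Continuity

/-- The operators all of whose terms `x ^ a ∂ ^ b` have some `b_i < B`. -/
def IsLow (B : ℤ) (f : PsiDif n) : Prop := ∀ P : MonExp n, (∀ i, B ≤ P.2 i) → f.1 P = 0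

/-- A linear operator is continuous if it maps operators of sufficiently low order to operators of
low order. -/
def IsCont (T : PsiDif n →ₗ[ℂ] PsiDif n) : Prop := ∀ B, ∃ B', ∀ f, IsLow B' f → IsLow B (T f)

theorem IsCont.comp {S T : PsiDif n →ₗ[ℂ] PsiDif n} (hS : IsCont S) (hT : IsCont T) :
    IsCont (S ∘ₗ T) := by
  intro B
  obtain ⟨B₁, h₁⟩ := hS B
  obtain ⟨B₂, h₂⟩ := hT B₁
  exact ⟨B₂, fun f hf => h₁ _ (h₂ _ hf)⟩

theorem IsLow.mono {B B' : ℤ} (h : B' ≤ B) {f : PsiDif n} (hf : IsLow B' f) : IsLow B f :=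
  fun P hP => hf P fun i => h.trans (hP i)

theorem IsCont.sub {S T : PsiDif n →ₗ[ℂ] PsiDif n} (hS : IsCont S) (hT : IsCont T) :
    IsCont (S - T) := by
  intro B
  obtain ⟨B₁, h₁⟩ := hS B
  obtain ⟨B₂, h₂⟩ := hT B
  refine ⟨min B₁ B₂, fun f hf P hP => ?_⟩
  change (S f).1 P - (T f).1 P = 0
  rw [h₁ f (hf.mono (min_le_left _ _)) P hP, h₂ f (hf.mono (min_le_right _ _)) P hP, sub_zero]

/-- Since orders are bounded above and the coefficients are Laurent polynomials, only finitely many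
monomials have all exponents of ∂ at least `B`; these are subtracted. -/
theorem exists_isLow_sub_sum_monomial (f : PsiDif n) (B : ℤ) :
    ∃ s : Finset (MonExp n), IsLow B (f - ∑ P ∈ s, monomial P.1 P.2 (f.1 P)) := by
  refine ⟨(finite_ge f B).toFinset, fun P hP => ?_⟩
  change f.1 P - (∑ Q ∈ _, monomial Q.1 Q.2 (f.1 Q)).1 P = 0
  have : (∑ Q ∈ (finite_ge f B).toFinset, monomial Q.1 Q.2 (f.1 Q)).1 P =
      ∑ Q ∈ (finite_ge f B).toFinset, if P = Q then f.1 Q else 0 := by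
    rw [Submodule.coe_sum, Finset.sum_apply]
    exact Finset.sum_congr rfl fun Q _ => monomial_coeff _ _ _ _
  rw [this, Finset.sum_ite_eq]
  split_ifs with h
  · exact sub_self _
  · rw [Set.Finite.mem_toFinset] at h
    have : f.1 P = 0 := by
      by_contra h0
      exact h ⟨h0, hP⟩
    rw [this, sub_zero]

/-- A linear form that vanishes on the monomials and on operators of low order is zero. -/
theorem linearForm_eq_zero (φ : PsiDif n →ₗ[ℂ] ℂ) (hφ : ∃ B, ∀ f, IsLow B f → φ f = 0)
    (h : ∀ a b, φ (monomial a b 1) = 0) (f : PsiDif n) : φ f = 0 := by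
  obtain ⟨B, hB⟩ := hφ
  obtain ⟨s, hs⟩ := exists_isLow_sub_sum_monomial f B
  have := hB _ hs
  rw [map_sub, map_sum, Finset.sum_eq_zero, sub_zero] at this
  · exact this
  · intro P _
    rw [smul_monomial, map_smul, h, smul_zero]

theorem exists_le (L : MonExp n) : ∃ B : ℤ, ∀ i, B ≤ L.2 i := by
  obtain ⟨B, hB⟩ := (Set.finite_range L.2).bddBelow
  exact ⟨B, fun i => hB ⟨i, rfl⟩⟩

/-- The coefficient of `x ^ L.1 ∂ ^ L.2`. -/
def coeff (L : MonExp n) : PsiDif n →ₗ[ℂ] ℂ where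
  toFun f := f.1 L
  map_add' _ _ := rfl
  map_smul' _ _ := rfl

theorem IsCont.coeff {T : PsiDif n →ₗ[ℂ] PsiDif n} (hT : IsCont T) (L : MonExp n) :
    ∃ B, ∀ f, IsLow B f → coeff L (T f) = 0 := by
  obtain ⟨B, hB⟩ := exists_le L
  obtain ⟨B', hB'⟩ := hT B
  exact ⟨B', fun f hf => hB' f hf L hB⟩

/-- One coefficient of `T f` depends on only finitely many monomials of `f`. Identities between
continuous operators need therefore be checked on monomials only. -/
theorem IsCont.eq_zero {T : PsiDif n →ₗ[ℂ] PsiDif n} (hT : IsCont T)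
    (h : ∀ a b, T (monomial a b 1) = 0) (f : PsiDif n) : T f = 0 := by
  ext L
  exact linearForm_eq_zero (PsiDif.coeff L ∘ₗ T) (hT.coeff L)
    (fun a b => by rw [LinearMap.comp_apply, h, map_zero]) f

/-- If the orders of `g` are at most `N`, the product raises orders by at most `N`, and contractions
only lower them; hence the threshold `B - N`. -/
theorem isCont_mulLeft (g : PsiDif n) : IsCont (LinearMap.mulLeft ℂ g) := by
  intro B
  obtain ⟨N, hN⟩ := g.2.1
  refine ⟨B - N, fun f hf L hL => ?_⟩
  rw [LinearMap.mulLeft_apply, mul_apply]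
  refine finsum_eq_zero_of_forall_eq_zero fun ⟨P, k⟩ => ?_
  by_cases hP : g.1 P = 0
  · simp [mulTerm, hP]
  · rw [mulTerm, hf, mul_zero, zero_mul]
    intro i
    have h1 : P.2 i ≤ N := hN P hP i
    have h2 : B ≤ L.2 i := hL i
    change B - N ≤ L.2 i - P.2 i + (k i : ℤ)
    omega

theorem isCont_mulRight (g : PsiDif n) : IsCont (LinearMap.mulRight ℂ g) := by
  intro B
  obtain ⟨N, hN⟩ := g.2.1
  refine ⟨B - N, fun f hf L hL => ?_⟩
  rw [LinearMap.mulRight_apply, mul_apply]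
  refine finsum_eq_zero_of_forall_eq_zero fun ⟨P, k⟩ => ?_
  by_cases hP : g.1 (L - P + diagExp k) = 0
  · simp [mulTerm, hP]
  · rw [mulTerm, hf, zero_mul, zero_mul]
    intro i
    have h1 := hN _ hP i
    have h2 := hL i
    simp only [diagExp, Prod.snd_add, Prod.snd_sub, Pi.add_apply, Pi.sub_apply] at h1
    change B - N ≤ P.2 i
    omega

theorem lowering_coeff (i : Fin n) (w : MonExp n → ℕ → ℂ) (f : PsiDif n) (L : MonExp n) :
    (lowering i w f).1 L = ∑ᶠ k : ℕ, w (L + diagExp (Pi.single i (k + 1))) (k + 1) *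
      f.1 (L + diagExp (Pi.single i (k + 1))) := rfl

theorem isCont_lowering (i : Fin n) (w : MonExp n → ℕ → ℂ) : IsCont (lowering i w) := by
  refine fun B => ⟨B, fun f hf L hL => ?_⟩
  rw [lowering_coeff]
  refine finsum_eq_zero_of_forall_eq_zero fun k => ?_
  rw [hf, mul_zero]
  intro j
  have := hL j
  simp only [diagExp, Prod.snd_add, Pi.add_apply]
  omega

/-- Going up the diagonal eventually exceeds the bound on the order. The series defining `lowering`
thus become finite sums, with as many terms as one likes. -/
theorem coeff_add_diagExp_eq_zero (f : PsiDif n) (L : MonExp n) (i : Fin n) :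
    ∃ K : ℕ, ∀ k, K ≤ k → f.1 (L + diagExp (Pi.single i k)) = 0 := by
  obtain ⟨N, hN⟩ := f.2.1
  refine ⟨(N - L.2 i).toNat + 1, fun k hk => ?_⟩
  by_contra h
  have := hN _ h i
  simp only [diagExp, Prod.snd_add, Pi.add_apply, Pi.single_eq_same] at this
  omega

theorem lowering_coeff_eq_sum (i : Fin n) (w : MonExp n → ℕ → ℂ) (f : PsiDif n) (L : MonExp n)
    (K : ℕ) (hK : ∀ k, K ≤ k → f.1 (L + diagExp (Pi.single i (k + 1))) = 0) :
    (lowering i w f).1 L = ∑ k ∈ Finset.range K, w (L + diagExp (Pi.single i (k + 1))) (k + 1) *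
      f.1 (L + diagExp (Pi.single i (k + 1))) := by
  rw [lowering_coeff, finsum_eq_sum_of_support_subset]
  intro k hk
  rw [Finset.coe_range, Set.mem_Iio]
  by_contra h
  refine hk ?_
  change _ * f.1 _ = 0
  rw [hK k (not_lt.mp h), mul_zero]

end Continuity

end PsiDif

namespace PsiDif

variable {n : ℕ}

/-! ### The logarithms are derivations and the residue is a trace -/

section Derivations

/-- Summation by parts for the logarithmic weights `s k` = ± (-1)^(k+1) / (k + 1): the factor `k +
1` from the discrete derivative of a falling factorial cancels the denominator, and the rest
telescopes. In the applications `u` lists coefficients of `g` along a diagonal, the upper boundary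
term vanishes for large `K`, and `u 0` is the coefficient of x_i⁻¹ g or g ∂_i⁻¹. -/
theorem sum_fallFact_telescope (s : ℕ → ℂ) (ε : ℂ) (hs : ∀ k, s k * (k + 1) = ε * (-1) ^ (k + 1))
    (u : ℕ → ℂ) (b c : ℂ) (K : ℕ) :
    ∑ k ∈ Finset.range K, s k * fallFact (b + (k + 1)) (k + 1) * (u k + (c + (k + 1)) * u (k + 1)) =
      ∑ k ∈ Finset.range K, s k * fallFact (b + k) (k + 1) * u k +
        c * ∑ k ∈ Finset.range K, s k * fallFact (b + (k + 1)) (k + 1) * u (k + 1) +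
        ε * ((-1) ^ K * fallFact (b + K) K * u K - u 0) := by
  induction K with
  | zero => simp [fallFact_zero]
  | succ K ih =>
    rw [Finset.sum_range_succ, Finset.sum_range_succ, Finset.sum_range_succ, ih]
    have h1 := fallFact_add_one_sub (b + K) K
    have h2 := hs K
    push_cast
    rw [← add_assoc]
    linear_combination (s K * u K) * h1 + (fallFact (b + K) K * u K +
      fallFact (b + K + 1) (K + 1) * u (K + 1)) * h2

theorem lnX_coeff_eq_sum (i : Fin n) (f : PsiDif n) (L : MonExp n) (K : ℕ)
    (hK : ∀ k, K ≤ k → f.1 (L + diagExp (Pi.single i (k + 1))) = 0) :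
    (lnX i f).1 L = ∑ k ∈ Finset.range K, (-1 : ℂ) ^ (k + 1) / (k + 1) *
      fallFact (L.2 i + (k + 1)) (k + 1) * f.1 (L + diagExp (Pi.single i (k + 1))) := by
  rw [lnX, lowering_coeff_eq_sum i _ f L K hK]
  refine Finset.sum_congr rfl fun k _ => ?_
  simp [diagExp]

theorem lnD_coeff_eq_sum (i : Fin n) (f : PsiDif n) (L : MonExp n) (K : ℕ)
    (hK : ∀ k, K ≤ k → f.1 (L + diagExp (Pi.single i (k + 1))) = 0) :
    (lnD i f).1 L = ∑ k ∈ Finset.range K, (-1 : ℂ) ^ (k + 1 + 1) / (k + 1) *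
      fallFact (L.1 i + (k + 1)) (k + 1) * f.1 (L + diagExp (Pi.single i (k + 1))) := by
  rw [lnD, lowering_coeff_eq_sum i _ f L K hK]
  refine Finset.sum_congr rfl fun k _ => ?_
  simp [diagExp]

theorem diagExp_single_succ (i : Fin n) (k : ℕ) :
    diagExp (Pi.single i (k + 1)) =
      (Pi.single i 1, Pi.single i 1) + diagExp (Pi.single i k) := by
  rw [add_comm k, Pi.single_add, diagExp_add, diagExp_single]
  simp

theorem exists_common_bound (i : Fin n) (f g : PsiDif n) (L M N : MonExp n) :
    ∃ K : ℕ, (∀ k, K ≤ k → f.1 (L + diagExp (Pi.single i k)) = 0) ∧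
      (∀ k, K ≤ k → g.1 (M + diagExp (Pi.single i k)) = 0) ∧
      ∀ k, K ≤ k → g.1 (N + diagExp (Pi.single i k)) = 0 := by
  obtain ⟨K₁, h₁⟩ := coeff_add_diagExp_eq_zero f L i
  obtain ⟨K₂, h₂⟩ := coeff_add_diagExp_eq_zero g M i
  obtain ⟨K₃, h₃⟩ := coeff_add_diagExp_eq_zero g N i
  exact ⟨K₁ + K₂ + K₃, fun k hk => h₁ k (by omega), fun k hk => h₂ k (by omega),
    fun k hk => h₃ k (by omega)⟩

/-- The weights of `lnX` depend on the exponents of ∂ only, and left multiplication by `x_j` shifts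
exponents of x only. For `lnD` the same holds with right multiplication by `∂_j`. -/
theorem lnX_varX_mul (i j : Fin n) (g : PsiDif n) : lnX i (varX j * g) = varX j * lnX i g := by
  ext L
  obtain ⟨K, h1, h2, -⟩ := exists_common_bound i (varX j * g) g L (L - (Pi.single j 1, 0)) 0
  rw [varX_mul_coeff, lnX_coeff_eq_sum i _ _ K fun k hk => h1 _ (by omega),
    lnX_coeff_eq_sum i _ _ K fun k hk => h2 _ (by omega)]
  refine Finset.sum_congr rfl fun k _ => ?_
  rw [varX_mul_coeff, add_sub_right_comm]
  simp

theorem lnD_mul_varD (i j : Fin n) (g : PsiDif n) : lnD i (g * varD j) = lnD i g * varD j := by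
  ext L
  obtain ⟨K, h1, h2, -⟩ := exists_common_bound i (g * varD j) g L (L - (0, Pi.single j 1)) 0
  rw [mul_varD_coeff, lnD_coeff_eq_sum i _ _ K fun k hk => h1 _ (by omega),
    lnD_coeff_eq_sum i _ _ K fun k hk => h2 _ (by omega)]
  refine Finset.sum_congr rfl fun k _ => ?_
  rw [mul_varD_coeff, add_sub_right_comm]
  simp

/-- This is [ln x_i, ∂_j] = -δ_ij x_i⁻¹ in the presence of a right factor. For `i = j` the
correction is the lower boundary term of the telescoping sum; for `i ≠ j` the sums agree term by
term. -/
theorem lnX_varD_mul (i j : Fin n) (g : PsiDif n) :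
    lnX i (varD j * g) = varD j * lnX i g - if i = j then varXInv i * g else 0 := by
  ext L
  obtain ⟨K, h1, h2, h3⟩ := exists_common_bound i (varD j * g) g L (L - (0, Pi.single j 1))
    (L + (Pi.single j 1, 0))
  change _ = (varD j * lnX i g).1 L - (ite _ _ _ : PsiDif n).1 L
  rw [varD_mul_coeff, lnX_coeff_eq_sum i _ _ K fun k hk => h1 _ (by omega),
    lnX_coeff_eq_sum i _ _ K fun k hk => h2 _ (by omega),
    lnX_coeff_eq_sum i _ _ K fun k hk => h3 _ (by omega)]
  simp only [varD_mul_coeff]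
  by_cases hij : i = j
  · subst hij
    rw [if_pos rfl, varXInv, monomial_mul_coeff]
    have := sum_fallFact_telescope (fun k => (-1 : ℂ) ^ (k + 1) / (k + 1)) 1
      (fun k => by field_simp) (fun k => g.1 (L + (Pi.single i 1, 0) + diagExp (Pi.single i k)))
      (L.2 i) (L.1 i + 1) K
    rw [h3 K le_rfl] at this
    have e1 : ∀ k : ℕ, L + diagExp (Pi.single i (k + 1)) - (0, Pi.single i 1) =
        L + (Pi.single i 1, 0) + diagExp (Pi.single i k) := by
      intro k
      rw [diagExp_single_succ]; ext <;> simp <;> ring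
    have e2 : ∀ k : ℕ, L - (0, Pi.single i 1) + diagExp (Pi.single i (k + 1)) =
        L + (Pi.single i 1, 0) + diagExp (Pi.single i k) := by
      intro k
      rw [diagExp_single_succ]; ext <;> simp <;> ring
    have e3 : ∀ k : ℕ, L + diagExp (Pi.single i (k + 1)) + (Pi.single i 1, 0) =
        L + (Pi.single i 1, 0) + diagExp (Pi.single i (k + 1)) := fun k => add_right_comm _ _ _
    have e4 : L - (Pi.single i (-1), 0) = L + (Pi.single i 1, 0) + diagExp (Pi.single i 0) := by
      rw [diagExp_single, Pi.single_neg]; ext <;> simp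
    simp only [e1, e2, e3, e4]
    have e5 : ∀ k : ℕ, (((L + diagExp (Pi.single i (k + 1))).1 i : ℤ) : ℂ) + 1 =
        L.1 i + 1 + (k + 1) := fun k => by simp [diagExp]; ring
    have e6 : ∀ k : ℕ, (((L - (0, Pi.single i 1)).2 i : ℤ) : ℂ) + (k + 1) = L.2 i + k :=
      fun k => by simp
    simp only [e5, e6]
    have e7 : (L + (Pi.single i 1, 0)).2 i = L.2 i := by simp
    rw [e7, this]
    ring
  · rw [if_neg hij]
    have e1 : ∀ k : ℕ, ((L + diagExp (Pi.single i (k + 1))).1 j) = L.1 j :=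
      fun k => by simp [diagExp, Ne.symm hij]
    have e2 : (L - (0, Pi.single j 1)).2 i = L.2 i := by simp [hij]
    have e3 : (L + (Pi.single j 1, 0)).2 i = L.2 i := by simp
    simp only [e1, e2, e3, add_sub_right_comm L, add_right_comm L _ ((Pi.single j 1, 0) : MonExp n)]
    rw [Finset.mul_sum, ← Finset.sum_add_distrib]
    change _ = _ - 0
    rw [sub_zero]
    exact Finset.sum_congr rfl fun k _ => by ring

theorem lnD_mul_varX (i j : Fin n) (g : PsiDif n) :
    lnD i (g * varX j) = lnD i g * varX j + if i = j then g * varDInv i else 0 := by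
  ext L
  obtain ⟨K, h1, h2, h3⟩ := exists_common_bound i (g * varX j) g L (L - (Pi.single j 1, 0))
    (L + (0, Pi.single j 1))
  change _ = (lnD i g * varX j).1 L + (ite _ _ _ : PsiDif n).1 L
  rw [mul_varX_coeff, lnD_coeff_eq_sum i _ _ K fun k hk => h1 _ (by omega),
    lnD_coeff_eq_sum i _ _ K fun k hk => h2 _ (by omega),
    lnD_coeff_eq_sum i _ _ K fun k hk => h3 _ (by omega)]
  simp only [mul_varX_coeff]
  by_cases hij : i = j
  · subst hij
    rw [if_pos rfl, varDInv, mul_monomial_coeff]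
    have := sum_fallFact_telescope (fun k => (-1 : ℂ) ^ (k + 1 + 1) / (k + 1)) (-1)
      (fun k => by field_simp; ring)
      (fun k => g.1 (L + (0, Pi.single i 1) + diagExp (Pi.single i k)))
      (L.1 i) (L.2 i + 1) K
    rw [h3 K le_rfl] at this
    have e1 : ∀ k : ℕ, L + diagExp (Pi.single i (k + 1)) - (Pi.single i 1, 0) =
        L + (0, Pi.single i 1) + diagExp (Pi.single i k) := by
      intro k
      rw [diagExp_single_succ]; ext <;> simp <;> ring
    have e2 : ∀ k : ℕ, L - (Pi.single i 1, 0) + diagExp (Pi.single i (k + 1)) =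
        L + (0, Pi.single i 1) + diagExp (Pi.single i k) := by
      intro k
      rw [diagExp_single_succ]; ext <;> simp <;> ring
    have e3 : ∀ k : ℕ, L + diagExp (Pi.single i (k + 1)) + (0, Pi.single i 1) =
        L + (0, Pi.single i 1) + diagExp (Pi.single i (k + 1)) := fun k => add_right_comm _ _ _
    have e4 : L - (0, Pi.single i (-1)) = L + (0, Pi.single i 1) + diagExp (Pi.single i 0) := by
      rw [diagExp_single, Pi.single_neg]; ext <;> simp
    simp only [e1, e2, e3, e4]
    have e5 : ∀ k : ℕ, (((L + diagExp (Pi.single i (k + 1))).2 i : ℤ) : ℂ) + 1 =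
        L.2 i + 1 + (k + 1) := fun k => by simp [diagExp]; ring
    have e6 : ∀ k : ℕ, (((L - (Pi.single i 1, 0)).1 i : ℤ) : ℂ) + (k + 1) = L.1 i + k :=
      fun k => by simp
    simp only [e5, e6]
    have e7 : (L + (0, Pi.single i 1)).1 i = L.1 i := by simp
    rw [e7, this]
    ring
  · rw [if_neg hij]
    have e1 : ∀ k : ℕ, ((L + diagExp (Pi.single i (k + 1))).2 j) = L.2 j :=
      fun k => by simp [diagExp, Ne.symm hij]
    have e2 : (L - (Pi.single j 1, 0)).1 i = L.1 i := by simp [hij]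
    have e3 : (L + (0, Pi.single j 1)).1 i = L.1 i := by simp
    simp only [e1, e2, e3, add_sub_right_comm L, add_right_comm L _ ((0, Pi.single j 1) : MonExp n)]
    rw [Finset.mul_sum, ← Finset.sum_add_distrib]
    change _ = _ + 0
    rw [add_zero]
    exact Finset.sum_congr rfl fun k _ => by ring

theorem lnX_one (i : Fin n) : lnX i 1 = 0 := by
  ext L
  obtain ⟨K, hK⟩ := coeff_add_diagExp_eq_zero 1 L i
  rw [lnX_coeff_eq_sum i _ _ K fun k hk => hK _ (by omega)]
  refine Finset.sum_eq_zero fun k _ => ?_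
  rw [one_apply]
  split_ifs with h
  · have := congrFun (congrArg Prod.snd h) i
    simp [diagExp] at this
    have h2 : (L.2 i : ℂ) + (k + 1) = 0 := by exact_mod_cast this
    rw [h2, fallFact_zero_left _ k.succ_ne_zero]; simp
  · simp

theorem lnD_one (i : Fin n) : lnD i 1 = 0 := by
  ext L
  obtain ⟨K, hK⟩ := coeff_add_diagExp_eq_zero 1 L i
  rw [lnD_coeff_eq_sum i _ _ K fun k hk => hK _ (by omega)]
  refine Finset.sum_eq_zero fun k _ => ?_
  rw [one_apply]
  split_ifs with h
  · have := congrFun (congrArg Prod.fst h) i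
    simp [diagExp] at this
    have h2 : (L.1 i : ℂ) + (k + 1) = 0 := by exact_mod_cast this
    rw [h2, fallFact_zero_left _ k.succ_ne_zero]; simp
  · simp

theorem lnX_varX (i j : Fin n) : lnX i (varX j) = 0 := by
  have := lnX_varX_mul i j 1
  rwa [mul_one, lnX_one, mul_zero] at this

theorem lnX_varD (i j : Fin n) : lnX i (varD j) = - if i = j then varXInv i else 0 := by
  have := lnX_varD_mul i j 1
  simpa only [mul_one, lnX_one, mul_zero, zero_sub] using this

theorem lnD_varD (i j : Fin n) : lnD i (varD j) = 0 := by
  have := lnD_mul_varD i j 1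
  rwa [one_mul, lnD_one, zero_mul] at this

theorem lnD_varX (i j : Fin n) : lnD i (varX j) = if i = j then varDInv i else 0 := by
  have := lnD_mul_varX i j 1
  simpa only [one_mul, lnD_one, zero_mul, zero_add] using this

theorem isCont_lnX (i : Fin n) : IsCont (lnX i) := isCont_lowering _ _

theorem isCont_lnD (i : Fin n) : IsCont (lnD i) := isCont_lowering _ _

theorem IsCont.add {S T : PsiDif n →ₗ[ℂ] PsiDif n} (hS : IsCont S) (hT : IsCont T) :
    IsCont (S + T) := by
  have h0 : IsCont (0 : PsiDif n →ₗ[ℂ] PsiDif n) := fun B => ⟨B, fun f _ P _ => rfl⟩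
  have := hS.sub (h0.sub hT)
  simpa using this

/-- A continuous linear operator which satisfies the Leibniz rule whenever the left factor is one of
the generators `x_j`, `∂_j` is a derivation. -/
theorem leibniz_of_left (D : PsiDif n →ₗ[ℂ] PsiDif n) (hD : IsCont D) (h1 : D 1 = 0)
    (hX : ∀ j g, D (varX j * g) = D (varX j) * g + varX j * D g)
    (hV : ∀ j g, D (varD j * g) = D (varD j) * g + varD j * D g) (f g : PsiDif n) :
    D (f * g) = D f * g + f * D g := by
  have key : ∀ a b, ∀ g, D (monomial a b 1 * g) = D (monomial a b 1) * g + monomial a b 1 * D g := by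
    intro a b
    refine monomial_induction (p := fun f => ∀ g, D (f * g) = D f * g + f * D g) ?_ ?_ ?_ hX hV a b
    · intro g; simp [h1]
    · intro u v hu hv g
      rw [mul_assoc, hu, hv, hu]
      noncomm_ring
    · intro u v huv hvu hu g
      -- The Leibniz rule for `u` applied to `u * v = 1` gives the derivative of the inverse;
      -- applied to `u * (v * g)` it can be solved for `D (v * g)`.
      have e1 : D v = - (v * D u * v) := by
        have := hu v
        rw [huv, h1] at this
        have h2 : v * (D u * v + u * D v) = 0 := by rw [← this, mul_zero]
        rw [mul_add, ← mul_assoc v u, hvu, one_mul, ← mul_assoc] at h2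
        exact eq_neg_of_add_eq_zero_right h2
      have e2 := hu (v * g)
      rw [← mul_assoc, huv, one_mul] at e2
      have h2 : v * D g = v * (D u * (v * g) + u * D (v * g)) := by rw [← e2]
      rw [mul_add, ← mul_assoc v u, hvu, one_mul] at h2
      rw [e1, h2]
      noncomm_ring
  -- The defect of the Leibniz rule as a function of the left factor: it is continuous and vanishes
  -- on monomials.
  let E : PsiDif n →ₗ[ℂ] PsiDif n := D ∘ₗ LinearMap.mulRight ℂ g -
    (LinearMap.mulRight ℂ g ∘ₗ D + LinearMap.mulRight ℂ (D g))
  have hE : IsCont E := (hD.comp (isCont_mulRight g)).sub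
    (((isCont_mulRight g).comp hD).add (isCont_mulRight (D g)))
  exact sub_eq_zero.mp (hE.eq_zero (fun a b => sub_eq_zero.mpr (key a b g)) f)

/-- A continuous linear operator which satisfies the Leibniz rule whenever the right factor is one of
the generators `x_j`, `∂_j` is a derivation. -/
theorem leibniz_of_right (D : PsiDif n →ₗ[ℂ] PsiDif n) (hD : IsCont D) (h1 : D 1 = 0)
    (hX : ∀ j f, D (f * varX j) = D f * varX j + f * D (varX j))
    (hV : ∀ j f, D (f * varD j) = D f * varD j + f * D (varD j)) (f g : PsiDif n) :
    D (f * g) = D f * g + f * D g := by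
  have key : ∀ a b, ∀ f, D (f * monomial a b 1) = D f * monomial a b 1 + f * D (monomial a b 1) := by
    intro a b
    refine monomial_induction (p := fun g => ∀ f, D (f * g) = D f * g + f * D g) ?_ ?_ ?_ hX hV a b
    · intro g; simp [h1]
    · intro u v hu hv f
      rw [← mul_assoc, hv, hu, hv]
      noncomm_ring
    · intro u v huv hvu hu f
      have e1 : D v = - (v * D u * v) := by
        have := hu v
        rw [hvu, h1] at this
        have h2 : (D v * u + v * D u) * v = 0 := by rw [← this, zero_mul]
        rw [add_mul, mul_assoc (D v), huv, mul_one] at h2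
        exact eq_neg_of_add_eq_zero_left h2
      have e2 := hu (f * v)
      rw [mul_assoc, hvu, mul_one] at e2
      have h2 : D f * v = (D (f * v) * u + f * v * D u) * v := by rw [← e2]
      rw [add_mul, mul_assoc (D (f * v)), huv, mul_one] at h2
      rw [e1, h2]
      noncomm_ring
  let E : PsiDif n →ₗ[ℂ] PsiDif n := D ∘ₗ LinearMap.mulLeft ℂ f -
    (LinearMap.mulLeft ℂ (D f) + LinearMap.mulLeft ℂ f ∘ₗ D)
  have hE : IsCont E := (hD.comp (isCont_mulLeft f)).sub
    ((isCont_mulLeft (D f)).add ((isCont_mulLeft f).comp hD))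
  exact sub_eq_zero.mp (hE.eq_zero (fun a b => sub_eq_zero.mpr (key a b f)) g)

/-- Left factors suit `lnX` and right factors suit `lnD`: on these sides multiplication by `x_j` and
`∂_j` interacts with the weights only through the correction already computed. -/
theorem lnX_mul (i : Fin n) (f g : PsiDif n) : lnX i (f * g) = lnX i f * g + f * lnX i g := by
  refine leibniz_of_left _ (isCont_lnX i) (lnX_one i) (fun j g => ?_) (fun j g => ?_) f g
  · rw [lnX_varX_mul, lnX_varX, zero_mul, zero_add]
  · rw [lnX_varD_mul, lnX_varD, neg_mul, ite_mul, zero_mul]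
    abel

theorem lnD_mul (i : Fin n) (f g : PsiDif n) : lnD i (f * g) = lnD i f * g + f * lnD i g := by
  refine leibniz_of_right _ (isCont_lnD i) (lnD_one i) (fun j g => ?_) (fun j g => ?_) f g
  · rw [lnD_mul_varX, lnD_varX, mul_ite, mul_zero]
  · rw [lnD_mul_varD, lnD_varD, mul_zero, add_zero]

/-- A continuous derivation is determined by its values on the generators `x_j`, `∂_j`. -/
theorem derivation_eq_zero (E : PsiDif n →ₗ[ℂ] PsiDif n) (hE : IsCont E)
    (hmul : ∀ f g, E (f * g) = E f * g + f * E g) (hX : ∀ j, E (varX j) = 0)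
    (hV : ∀ j, E (varD j) = 0) (f : PsiDif n) : E f = 0 := by
  have h1 : E 1 = 0 := by simpa using hmul 1 1
  refine hE.eq_zero (monomial_induction (p := fun f => E f = 0) h1 ?_ ?_ hX hV) f
  · intro u v hu hv
    rw [hmul, hu, hv, zero_mul, mul_zero, add_zero]
  · intro u v huv hvu hu
    have := hmul u v
    rw [huv, h1, hu, zero_mul, zero_add] at this
    rw [← one_mul (E v), ← hvu, mul_assoc, ← this, mul_zero]

/-- For a generator, the two products differ at `L` by a multiple of `L.1 j + 1` or `L.2 j + 1`,
which is zero at the exponent -1. Products, inverses and limits then follow. -/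
theorem residue_mul_comm (f g : PsiDif n) : residue (f * g) = residue (g * f) := by
  have hX : ∀ j (g : PsiDif n), residue (varX j * g) = residue (g * varX j) := by
    intro j g
    change (varX j * g).1 _ = (g * varX j).1 _
    rw [varX_mul_coeff, mul_varX_coeff]
    simp
  have hV : ∀ j (g : PsiDif n), residue (varD j * g) = residue (g * varD j) := by
    intro j g
    change (varD j * g).1 _ = (g * varD j).1 _
    rw [varD_mul_coeff, mul_varD_coeff]
    simp
  have key : ∀ a b, ∀ g : PsiDif n, residue (monomial a b 1 * g) = residue (g * monomial a b 1) := by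
    intro a b
    refine monomial_induction (p := fun f => ∀ g, residue (f * g) = residue (g * f)) ?_ ?_ ?_
      hX hV a b
    · intro g; simp
    · intro u v hu hv g
      rw [mul_assoc, hu, mul_assoc, hv, mul_assoc]
    · intro u v huv hvu hu g
      -- Commuting `u` past `v * g * v` under the residue leaves `g * v` on one side and `v * g` on
      -- the other.
      have := hu (v * g * v)
      rwa [mul_assoc (v * g), hvu, mul_one, ← mul_assoc, ← mul_assoc, huv, one_mul, eq_comm]
        at this
  have hcont : ∀ T : PsiDif n →ₗ[ℂ] PsiDif n, IsCont T → ∃ B, ∀ f, IsLow B f → residue (T f) = 0 :=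
    fun T hT => hT.coeff (-1, -1)
  have := linearForm_eq_zero (residue ∘ₗ (LinearMap.mulRight ℂ g - LinearMap.mulLeft ℂ g))
    (hcont _ ((isCont_mulRight g).sub (isCont_mulLeft g)))
    (fun a b => by simp [key a b g]) f
  simpa [sub_eq_zero] using this

/-- In the term of index `k` the coefficient at exponent -1 carries the falling factorial of `k` of
length `k + 1`, which contains the factor 0. -/
theorem residue_lnX (i : Fin n) (f : PsiDif n) : residue (lnX i f) = 0 := by
  change (lnX i f).1 _ = 0
  obtain ⟨K, hK⟩ := coeff_add_diagExp_eq_zero f (-1, -1) i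
  rw [lnX_coeff_eq_sum i _ _ K fun k hk => hK _ (by omega)]
  refine Finset.sum_eq_zero fun k _ => ?_
  have : ((((-1 : Fin n → ℤ) i : ℤ) : ℂ)) + (k + 1) = (k : ℂ) := by simp
  rw [this, fallFact_natCast_of_lt k.lt_succ_self, mul_zero, zero_mul]

theorem residue_lnD (i : Fin n) (f : PsiDif n) : residue (lnD i f) = 0 := by
  change (lnD i f).1 _ = 0
  obtain ⟨K, hK⟩ := coeff_add_diagExp_eq_zero f (-1, -1) i
  rw [lnD_coeff_eq_sum i _ _ K fun k hk => hK _ (by omega)]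
  refine Finset.sum_eq_zero fun k _ => ?_
  have : ((((-1 : Fin n → ℤ) i : ℤ) : ℂ)) + (k + 1) = (k : ℂ) := by simp
  rw [this, fallFact_natCast_of_lt k.lt_succ_self, mul_zero, zero_mul]

end Derivations

end PsiDif

namespace PsiDif

variable {n : ℕ}

/-! ### Commutators of the logarithms and the curvature `Q` -/

section Commutators

theorem derivation_inverse (D : PsiDif n →ₗ[ℂ] PsiDif n)
    (hD : ∀ f g, D (f * g) = D f * g + f * D g) {u v : PsiDif n} (huv : u * v = 1)
    (hvu : v * u = 1) : D v = -(v * D u * v) := by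
  have h1 : D 1 = 0 := by simpa using hD 1 1
  have h2 := hD v u
  rw [hvu, h1] at h2
  have h3 : (D v * u + v * D u) * v = 0 := by rw [← h2, zero_mul]
  rw [add_mul, mul_assoc (D v), huv, mul_one] at h3
  exact eq_neg_of_add_eq_zero_left h3

theorem lnX_varXInv (i j : Fin n) : lnX i (varXInv j) = 0 := by
  rw [derivation_inverse _ (lnX_mul i) (varX_mul_varXInv j) (varXInv_mul_varX j), lnX_varX]
  simp

theorem lnX_varDInv (i j : Fin n) :
    lnX i (varDInv j) = if i = j then varDInv i * varXInv i * varDInv i else 0 := by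
  rw [derivation_inverse _ (lnX_mul i) (varD_mul_varDInv j) (varDInv_mul_varD j), lnX_varD]
  split_ifs with h
  · rw [h]; simp
  · simp

theorem lnD_varDInv (i j : Fin n) : lnD i (varDInv j) = 0 := by
  rw [derivation_inverse _ (lnD_mul i) (varD_mul_varDInv j) (varDInv_mul_varD j), lnD_varD]
  simp

theorem lnD_varXInv (i j : Fin n) :
    lnD i (varXInv j) = -if i = j then varXInv i * varDInv i * varXInv i else 0 := by
  rw [derivation_inverse _ (lnD_mul i) (varX_mul_varXInv j) (varXInv_mul_varX j), lnD_varX]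
  split_ifs with h
  · rw [h]
  · simp

/-- The commutator of two continuous derivations is the inner derivation `ad Q` as soon as this holds
on the generators. -/
theorem commutator_eq_ad {D E : PsiDif n →ₗ[ℂ] PsiDif n} (hD : IsCont D) (hE : IsCont E)
    (mD : ∀ f g, D (f * g) = D f * g + f * D g) (mE : ∀ f g, E (f * g) = E f * g + f * E g)
    (Q : PsiDif n) (hX : ∀ j, D (E (varX j)) - E (D (varX j)) = Q * varX j - varX j * Q)
    (hV : ∀ j, D (E (varD j)) - E (D (varD j)) = Q * varD j - varD j * Q) (f : PsiDif n) :
    D (E f) - E (D f) = Q * f - f * Q := by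
  have := derivation_eq_zero
    (D ∘ₗ E - E ∘ₗ D - (LinearMap.mulLeft ℂ Q - LinearMap.mulRight ℂ Q))
    (((hD.comp hE).sub (hE.comp hD)).sub ((isCont_mulLeft Q).sub (isCont_mulRight Q)))
    (fun f g => by
      simp only [LinearMap.sub_apply, LinearMap.comp_apply, LinearMap.mulLeft_apply,
        LinearMap.mulRight_apply, mD, mE, map_add]
      noncomm_ring)
    (fun j => sub_eq_zero.mpr (hX j)) (fun j => sub_eq_zero.mpr (hV j)) f
  exact sub_eq_zero.mp this

/-- The series `∑_{m ≥ 1} ((m - 1)! / m) x_i ^ (-m) ∂_i ^ (-m)`, which represents the commutator of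
`ln ∂_i` and `ln x_i`. -/
def logCommutator (i : Fin n) : PsiDif n :=
  lowering i (fun _ m => ((m - 1).factorial : ℂ) / m) 1

theorem logCommutator_coeff (i : Fin n) (k : ℕ) :
    (logCommutator i).1 (-diagExp (Pi.single i (k + 1))) = (k.factorial : ℂ) / (k + 1) := by
  rw [logCommutator, lowering_coeff, finsum_eq_single _ k]
  · simp [one_apply]
  · intro l hl
    rw [one_apply, if_neg, mul_zero]
    intro h
    have := congrFun (congrArg Prod.fst h) i
    simp [diagExp] at this
    omega

theorem exists_of_logCommutator_coeff_ne_zero {i : Fin n} {L : MonExp n}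
    (h : (logCommutator i).1 L ≠ 0) : ∃ k : ℕ, L = -diagExp (Pi.single i (k + 1)) := by
  by_contra! h0
  refine h ?_
  rw [logCommutator, lowering_coeff]
  refine finsum_eq_zero_of_forall_eq_zero fun k => ?_
  rw [one_apply, if_neg, mul_zero]
  exact fun h1 => h0 k (eq_neg_of_add_eq_zero_left h1)

/-- The recursion that the coefficients (m - 1)! / m solve. It expresses the commutators of the
series with `x_i` and `∂_i` after one multiplication by a generator; the right-hand side starts it
at x_i⁻¹ ∂_i⁻¹. -/
theorem logCommutator_coeff_rec (i : Fin n) (L : MonExp n) :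
    L.1 i * (logCommutator i).1 L +
      (L.1 i + 1) * (L.2 i + 1) * (logCommutator i).1 (L + (Pi.single i 1, Pi.single i 1)) =
      -if L = (Pi.single i (-1), Pi.single i (-1)) then 1 else 0 := by
  have e1 : ((Pi.single i (-1), Pi.single i (-1)) : MonExp n) = -diagExp (Pi.single i (0 + 1)) := by
    rw [diagExp_single, Pi.single_neg]; ext <;> simp
  have hz : (logCommutator i).1 0 = 0 := by
    by_contra h0
    obtain ⟨k, hk⟩ := exists_of_logCommutator_coeff_ne_zero h0
    have := congrFun (congrArg Prod.fst hk) i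
    simp [diagExp] at this
    omega
  have e2 : ∀ k : ℕ, -diagExp (Pi.single i (k + 1)) + (Pi.single i 1, Pi.single i 1) =
      -diagExp (Pi.single i k) := by
    intro k
    rw [diagExp_single_succ]; abel
  by_cases hL : (logCommutator i).1 L = 0
  · rw [hL, mul_zero, zero_add, if_neg]
    · by_cases hL' : (logCommutator i).1 (L + (Pi.single i 1, Pi.single i 1)) = 0
      · rw [hL', mul_zero, neg_zero]
      · obtain ⟨k, hk⟩ := exists_of_logCommutator_coeff_ne_zero hL'
        rw [← e2, add_left_inj] at hk
        rw [hk, logCommutator_coeff] at hL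
        exact absurd hL (div_ne_zero (Nat.cast_ne_zero.mpr (Nat.factorial_ne_zero _))
          (Nat.cast_add_one_ne_zero _))
    · rintro rfl
      rw [e1, logCommutator_coeff] at hL
      simp at hL
  · obtain ⟨k, rfl⟩ := exists_of_logCommutator_coeff_ne_zero hL
    rw [e2, logCommutator_coeff]
    rcases k with _ | k
    · have : diagExp (Pi.single i 0 : Fin n → ℕ) = 0 := by simp [diagExp_zero]
      rw [this, neg_zero, hz, if_pos e1.symm]
      simp [diagExp]
    · rw [logCommutator_coeff, if_neg]
      · have h1 : (k : ℂ) + 1 ≠ 0 := Nat.cast_add_one_ne_zero k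
        have h2 : (k : ℂ) + 1 + 1 ≠ 0 := by exact_mod_cast Nat.cast_add_one_ne_zero (R := ℂ) (k + 1)
        simp only [diagExp, Prod.fst_neg, Prod.snd_neg, Pi.neg_apply, Pi.single_eq_same,
          Nat.factorial_succ]
        push_cast
        field_simp
        ring
      · intro h
        have := congrFun (congrArg Prod.fst h) i
        simp [diagExp] at this
        omega

theorem logCommutator_coeff_symm (i : Fin n) (L : MonExp n) :
    L.1 i * (logCommutator i).1 L = L.2 i * (logCommutator i).1 L := by
  by_cases hL : (logCommutator i).1 L = 0
  · rw [hL, mul_zero, mul_zero]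
  · obtain ⟨k, rfl⟩ := exists_of_logCommutator_coeff_ne_zero hL
    simp [diagExp]

theorem varXInv_mul_varDInv_coeff (i : Fin n) (L : MonExp n) :
    (varXInv i * varDInv i).1 L = if L = (Pi.single i (-1), Pi.single i (-1)) then 1 else 0 := by
  rw [varXInv, varDInv, (monomial_mul_monomial _ _ _ 0 _).1, monomial_coeff, add_zero]

/-- The right-hand side is an infinite series in normal order, but becomes the monomial -x_i⁻¹ ∂_i⁻¹
after left multiplication by ∂_i; in this form the claim is the recursion for the coefficients. The
next lemma multiplies by `x_i` on the right for the same reason. -/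
theorem varX_logCommutator (i : Fin n) :
    logCommutator i * varX i - varX i * logCommutator i = -(varDInv i * varXInv i * varDInv i) := by
  have h : varD i * (logCommutator i * varX i - varX i * logCommutator i) =
      -(varXInv i * varDInv i) := by
    ext L
    change _ = -(varXInv i * varDInv i).1 L
    have e : ∀ M, (logCommutator i * varX i - varX i * logCommutator i).1 M =
        (M.2 i + 1) * (logCommutator i).1 (M + (0, Pi.single i 1)) := by
      intro M
      change (logCommutator i * varX i).1 M - (varX i * logCommutator i).1 M = _
      rw [varX_mul_coeff, mul_varX_coeff]; ring
    have e1 : L + (Pi.single i 1, 0) + (0, Pi.single i 1) = L + (Pi.single i 1, Pi.single i 1) := by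
      ext <;> simp
    rw [varD_mul_coeff, e, e, varXInv_mul_varDInv_coeff, ← logCommutator_coeff_rec, e1,
      sub_add_cancel, logCommutator_coeff_symm]
    simp
    ring
  have h2 := congrArg (varDInv i * ·) h
  simp only [← mul_assoc, varDInv_mul_varD, one_mul, mul_neg] at h2
  exact h2

theorem varD_logCommutator (i : Fin n) :
    logCommutator i * varD i - varD i * logCommutator i = varXInv i * varDInv i * varXInv i := by
  have h : (logCommutator i * varD i - varD i * logCommutator i) * varX i =
      varXInv i * varDInv i := by
    ext L
    have e : ∀ M, (logCommutator i * varD i - varD i * logCommutator i).1 M =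
        -((M.1 i + 1) * (logCommutator i).1 (M + (Pi.single i 1, 0))) := by
      intro M
      change (logCommutator i * varD i).1 M - (varD i * logCommutator i).1 M = _
      rw [varD_mul_coeff, mul_varD_coeff]; ring
    have e1 : L + (0, Pi.single i 1) + (Pi.single i 1, 0) = L + (Pi.single i 1, Pi.single i 1) := by
      ext <;> simp
    rw [mul_varX_coeff, e, e, varXInv_mul_varDInv_coeff, e1, sub_add_cancel,
      ← neg_neg (ite _ _ _), ← logCommutator_coeff_rec]
    simp
    ring
  have h2 := congrArg (· * varXInv i) h
  simpa only [mul_assoc, varX_mul_varXInv, mul_one] using h2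

theorem varX_logCommutator_of_ne {i j : Fin n} (hij : i ≠ j) :
    logCommutator i * varX j - varX j * logCommutator i = 0 := by
  ext L
  change (logCommutator i * varX j).1 L - (varX j * logCommutator i).1 L = 0
  rw [varX_mul_coeff, mul_varX_coeff, add_sub_cancel_left]
  by_cases h : (logCommutator i).1 (L + (0, Pi.single j 1)) = 0
  · rw [h, mul_zero]
  · obtain ⟨k, hk⟩ := exists_of_logCommutator_coeff_ne_zero h
    have := congrFun (congrArg Prod.snd hk) j
    simp [diagExp, hij.symm] at this
    have h2 : (L.2 j : ℂ) + 1 = 0 := by exact_mod_cast this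
    rw [h2, zero_mul]

theorem varD_logCommutator_of_ne {i j : Fin n} (hij : i ≠ j) :
    logCommutator i * varD j - varD j * logCommutator i = 0 := by
  ext L
  change (logCommutator i * varD j).1 L - (varD j * logCommutator i).1 L = 0
  rw [mul_varD_coeff, varD_mul_coeff, sub_add_cancel_left]
  by_cases h : (logCommutator i).1 (L + (Pi.single j 1, 0)) = 0
  · rw [h, mul_zero, neg_zero]
  · obtain ⟨k, hk⟩ := exists_of_logCommutator_coeff_ne_zero h
    have := congrFun (congrArg Prod.fst hk) j
    simp [diagExp, hij.symm] at this
    have h2 : (L.1 j : ℂ) + 1 = 0 := by exact_mod_cast this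
    rw [h2, zero_mul, neg_zero]

/-- The series does not involve `∂_j`, and a falling factorial of 0 of positive length vanishes.
This is what makes condition (iii) hold. -/
theorem lnX_logCommutator_of_ne {i j : Fin n} (hij : i ≠ j) : lnX j (logCommutator i) = 0 := by
  ext L
  obtain ⟨K, hK⟩ := coeff_add_diagExp_eq_zero (logCommutator i) L j
  rw [lnX_coeff_eq_sum j _ _ K fun k hk => hK _ (by omega)]
  refine Finset.sum_eq_zero fun k _ => ?_
  by_cases h : (logCommutator i).1 (L + diagExp (Pi.single j (k + 1))) = 0
  · rw [h, mul_zero]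
  · obtain ⟨l, hl⟩ := exists_of_logCommutator_coeff_ne_zero h
    have := congrFun (congrArg Prod.snd hl) j
    simp [diagExp, hij.symm] at this
    have h2 : (L.2 j : ℂ) + (k + 1) = 0 := by exact_mod_cast this
    rw [h2, fallFact_zero_left _ k.succ_ne_zero, mul_zero, zero_mul]

theorem lnD_logCommutator_of_ne {i j : Fin n} (hij : i ≠ j) : lnD j (logCommutator i) = 0 := by
  ext L
  obtain ⟨K, hK⟩ := coeff_add_diagExp_eq_zero (logCommutator i) L j
  rw [lnD_coeff_eq_sum j _ _ K fun k hk => hK _ (by omega)]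
  refine Finset.sum_eq_zero fun k _ => ?_
  by_cases h : (logCommutator i).1 (L + diagExp (Pi.single j (k + 1))) = 0
  · rw [h, mul_zero]
  · obtain ⟨l, hl⟩ := exists_of_logCommutator_coeff_ne_zero h
    have := congrFun (congrArg Prod.fst hl) j
    simp [diagExp, hij.symm] at this
    have h2 : (L.1 j : ℂ) + (k + 1) = 0 := by exact_mod_cast this
    rw [h2, fallFact_zero_left _ k.succ_ne_zero, mul_zero, zero_mul]

/-- On the generators: for `i = j`, x_i goes to -∂_i⁻¹ x_i⁻¹ ∂_i⁻¹ and ∂_i to x_i⁻¹ ∂_i⁻¹ x_i⁻¹, the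
commutators of `logCommutator i` with them; all other values are zero. -/
theorem lnD_lnX_commutator (i j : Fin n) (f : PsiDif n) :
    lnD i (lnX j f) - lnX j (lnD i f) =
      (if i = j then logCommutator i else 0) * f - f * (if i = j then logCommutator i else 0) := by
  refine commutator_eq_ad (isCont_lnD i) (isCont_lnX j) (lnD_mul i) (lnX_mul j) _ (fun k => ?_)
    (fun k => ?_) f
  · rw [lnX_varX, map_zero, lnD_varX, zero_sub]
    by_cases hij : i = j
    · subst hij
      by_cases hik : i = k
      · subst hik
        rw [if_pos rfl, if_pos rfl, varX_logCommutator, lnX_varDInv, if_pos rfl]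
      · rw [if_neg hik, if_pos rfl, varX_logCommutator_of_ne hik, map_zero, neg_zero]
    · rw [if_neg hij, zero_mul, mul_zero, sub_zero]
      split_ifs
      · rw [lnX_varDInv, if_neg (Ne.symm hij), neg_zero]
      · rw [map_zero, neg_zero]
  · rw [lnD_varD, map_zero, lnX_varD, sub_zero]
    by_cases hij : i = j
    · subst hij
      by_cases hik : i = k
      · subst hik
        rw [if_pos rfl, if_pos rfl, varD_logCommutator, map_neg, lnD_varXInv, if_pos rfl, neg_neg]
      · rw [if_neg hik, if_pos rfl, varD_logCommutator_of_ne hik, neg_zero, map_zero]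
    · rw [if_neg hij, zero_mul, mul_zero, sub_zero, map_neg]
      split_ifs
      · rw [lnD_varXInv, if_neg hij, neg_zero, neg_zero]
      · rw [map_zero, neg_zero]

theorem lnD_lnD_commutator (i j : Fin n) (f : PsiDif n) :
    lnD i (lnD j f) - lnD j (lnD i f) = 0 := by
  have := commutator_eq_ad (isCont_lnD i) (isCont_lnD j) (lnD_mul i) (lnD_mul j) 0 (fun k => ?_)
    (fun k => ?_) f
  · simpa using this
  · rw [lnD_varX, lnD_varX]
    split_ifs <;> simp [lnD_varDInv]
  · simp [lnD_varD]

theorem lnX_lnX_commutator (i j : Fin n) (f : PsiDif n) :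
    lnX i (lnX j f) - lnX j (lnX i f) = 0 := by
  have := commutator_eq_ad (isCont_lnX i) (isCont_lnX j) (lnX_mul i) (lnX_mul j) 0 (fun k => ?_)
    (fun k => ?_) f
  · simpa using this
  · simp [lnX_varX]
  · rw [lnX_varD, lnX_varD]
    split_ifs <;> simp [lnX_varXInv]

/-- Elements `Q i j` for the derivations `ln ∂₁, ln x₁, ln ∂₂, ln x₂`. -/
def logCurvature : Fin 4 → Fin 4 → PsiDif 2 :=
  ![![0, logCommutator 0, 0, 0], ![-logCommutator 0, 0, 0, 0],
    ![0, 0, 0, logCommutator 1], ![0, 0, -logCommutator 1, 0]]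

theorem liftingConditions_logCurvature :
    LiftingConditions residue logDerivations logCurvature where
  trace_comm := residue_mul_comm
  leibniz i f g := by
    fin_cases i <;> simp [logDerivations, lnD_mul, lnX_mul]
  trace_deriv i f := by
    fin_cases i <;> simp [logDerivations, residue_lnX, residue_lnD]
  commutator i j f := by
    have h (i j : Fin 2) : lnX j (lnD i f) - lnD i (lnX j f) =
        f * (if i = j then logCommutator i else 0) - (if i = j then logCommutator i else 0) * f := by
      rw [← neg_sub, lnD_lnX_commutator, neg_sub]
    fin_cases i <;> fin_cases j <;>
      simp [logDerivations, logCurvature, lnD_lnX_commutator, lnD_lnD_commutator,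
        lnX_lnX_commutator, h]
    all_goals abel
  -- If two indices coincide, the alternated expression cancels formally. If they are distinct, the
  -- third index belongs to the other variable than the only pair with nonzero curvature, and its
  -- logarithm kills that curvature.
  alt_deriv i j k := by
    have h1 : ∀ l, logDerivations l (0 : PsiDif 2) = 0 := fun l => map_zero _
    fin_cases i <;> fin_cases j <;> fin_cases k <;>
      simp [logDerivations, logCurvature, lnD_logCommutator_of_ne, lnX_logCommutator_of_ne]

end Commutators

end PsiDif

theorem sum_perm_three {α M : Type*} [AddCommGroup M] (F : (Fin 3 → α) → M) (a b c : α) :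
    ∑ σ : Equiv.Perm (Fin 3), Equiv.Perm.sign σ • F (![a, b, c] ∘ σ) =
      F ![a, b, c] - F ![b, a, c] - F ![c, b, a] - F ![a, c, b] + F ![b, c, a] + F ![c, a, b] := by
  have h : (Finset.univ : Finset (Equiv.Perm (Fin 3))) =
      {1, Equiv.swap 0 1, Equiv.swap 0 2, Equiv.swap 1 2, finRotate 3, finRotate 3 * finRotate 3} := by
    decide
  have e1 : ![a, b, c] ∘ (1 : Equiv.Perm (Fin 3)) = ![a, b, c] := rfl
  have e2 : ![a, b, c] ∘ Equiv.swap (0 : Fin 3) 1 = ![b, a, c] := by ext i; fin_cases i <;> rfl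
  have e3 : ![a, b, c] ∘ Equiv.swap (0 : Fin 3) 2 = ![c, b, a] := by ext i; fin_cases i <;> rfl
  have e4 : ![a, b, c] ∘ Equiv.swap (1 : Fin 3) 2 = ![a, c, b] := by ext i; fin_cases i <;> rfl
  have e5 : ![a, b, c] ∘ finRotate 3 = ![b, c, a] := by ext i; fin_cases i <;> rfl
  have e6 : ![a, b, c] ∘ (finRotate 3 * finRotate 3) = ![c, a, b] := by
    ext i; fin_cases i <;> rfl
  have s2 : Equiv.Perm.sign (Equiv.swap (0 : Fin 3) 1) = -1 := by decide
  have s3 : Equiv.Perm.sign (Equiv.swap (0 : Fin 3) 2) = -1 := by decide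
  have s4 : Equiv.Perm.sign (Equiv.swap (1 : Fin 3) 2) = -1 := by decide
  have s5 : Equiv.Perm.sign (finRotate 3) = 1 := by decide
  have s6 : Equiv.Perm.sign (finRotate 3 * finRotate 3) = 1 := by decide
  rw [h, Finset.sum_insert (by decide), Finset.sum_insert (by decide),
    Finset.sum_insert (by decide), Finset.sum_insert (by decide), Finset.sum_insert (by decide),
    Finset.sum_singleton, e1, e2, e3, e4, e5, e6, s2, s3, s4, s5, s6, Equiv.Perm.sign_one]
  simp only [one_smul, Units.neg_smul]
  abel

namespace PsiDif

variable {n : ℕ}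

/-! ### Commutation relations and residues of products -/

section Relations

theorem commute_of_inverse {f u v : PsiDif n} (huv : u * v = 1) (hvu : v * u = 1)
    (h : Commute f u) : Commute f v := by
  have : v * (f * u) * v = v * (u * f) * v := by rw [h.eq]
  rw [← mul_assoc v u, hvu, one_mul, mul_assoc, mul_assoc, huv, mul_one] at this
  exact this.symm

theorem varX_varD_commutator (i j : Fin n) :
    varX i * varD j - varD j * varX i = if i = j then -1 else 0 := by
  ext L
  change (varX i * varD j).1 L - (varD j * varX i).1 L = _
  have e1 : (varX i * varD j).1 L = (varX i).1 (L - (0, Pi.single j 1)) := mul_varD_coeff _ _ _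
  rw [e1, varD_mul_coeff, sub_add_cancel_left]
  rw [varX, monomial_coeff]
  by_cases hij : i = j
  · subst hij
    rw [if_pos rfl]
    change _ = -(1 : PsiDif n).1 L
    rw [one_apply]
    have : L + (Pi.single i 1, 0) = (Pi.single i 1, 0) ↔ L = 0 := by simp
    simp only [this]
    split_ifs with h
    · simp [h]
    · simp
  · rw [if_neg hij]
    change _ = (0 : ℂ)
    split_ifs with h
    · have := congrFun (congrArg Prod.fst h) j
      simp [Ne.symm hij] at this
      have h2 : (L.1 j : ℂ) + 1 = 0 := by exact_mod_cast this
      rw [h2, zero_mul, neg_zero]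
    · simp

theorem commute_varX_varX (i j : Fin n) : Commute (varX i) (varX j) := by
  change _ = _
  rw [varX, varX, (monomial_mul_monomial _ _ _ 0 _).1, (monomial_mul_monomial _ _ _ 0 _).1,
    add_comm]

theorem commute_varD_varD (i j : Fin n) : Commute (varD i) (varD j) := by
  change _ = _
  rw [varD, varD, (monomial_mul_monomial _ 0 _ _ _).2, (monomial_mul_monomial _ 0 _ _ _).2,
    add_comm]

theorem commute_varX_varD {i j : Fin n} (hij : i ≠ j) : Commute (varX i) (varD j) := by
  have := varX_varD_commutator i j
  rw [if_neg hij] at this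
  exact sub_eq_zero.mp this

theorem commute_varXInv {f : PsiDif n} {i : Fin n} (h : Commute f (varX i)) :
    Commute f (varXInv i) :=
  commute_of_inverse (varX_mul_varXInv i) (varXInv_mul_varX i) h

theorem commute_varDInv {f : PsiDif n} {i : Fin n} (h : Commute f (varD i)) :
    Commute f (varDInv i) :=
  commute_of_inverse (varD_mul_varDInv i) (varDInv_mul_varD i) h

/-- An operator commutes with `x_i` and `∂_i`. -/
def CommutesAt (i : Fin n) (f : PsiDif n) : Prop := Commute f (varX i) ∧ Commute f (varD i)

theorem CommutesAt.varXInv {i : Fin n} {f : PsiDif n} (h : CommutesAt i f) :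
    Commute f (varXInv i) := commute_varXInv h.1

theorem CommutesAt.varDInv {i : Fin n} {f : PsiDif n} (h : CommutesAt i f) :
    Commute f (varDInv i) := commute_varDInv h.2

theorem commutesAt_varXInv {i j : Fin n} (hij : i ≠ j) : CommutesAt j (PsiDif.varXInv i) :=
  ⟨(commute_varXInv (commute_varX_varX j i)).symm,
    (commute_varXInv (commute_varX_varD hij).symm).symm⟩

theorem commutesAt_varDInv {i j : Fin n} (hij : i ≠ j) : CommutesAt j (PsiDif.varDInv i) :=
  ⟨(commute_varDInv (commute_varX_varD hij.symm)).symm,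
    (commute_varDInv (commute_varD_varD j i)).symm⟩

theorem CommutesAt.mul {i : Fin n} {f g : PsiDif n} (hf : CommutesAt i f) (hg : CommutesAt i g) :
    CommutesAt i (f * g) :=
  ⟨hf.1.mul_left hg.1, hf.2.mul_left hg.2⟩

/-- If `f` commutes with `x_i` and `∂_i`, and `[P, ∂_i]` is a multiple of `x_i⁻¹ ∂_i⁻¹ x_i⁻¹`, then
the residue of `f P` is that of a multiple of `f x_i⁻¹ ∂_i⁻¹`. -/
theorem residue_mul_of_commutator {i : Fin n} {f P : PsiDif n} {c : ℂ} (hf : CommutesAt i f)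
    (hP : P * varD i - varD i * P = c • (varXInv i * varDInv i * varXInv i)) :
    residue (f * P) = c * residue (f * (varXInv i * varDInv i)) := by
  -- The trick is to insert 1 = -[x_i, ∂_i] and to move ∂_i around the trace: as it commutes with
  -- `f`, only its commutator with `P` survives.
  have h1 : f * P = -((varX i * varD i - varD i * varX i) * (f * P)) := by
    rw [varX_varD_commutator, if_pos rfl, neg_one_mul, neg_neg]
  have h2 : residue (varD i * (varX i * (f * P))) = residue (varX i * (f * P) * varD i) :=
    residue_mul_comm _ _
  have h3 : varX i * (f * P) * varD i - varX i * (varD i * (f * P)) =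
      c • (varX i * (f * (varXInv i * varDInv i * varXInv i))) := by
    have e : varX i * (f * P) * varD i - varX i * (varD i * (f * P)) =
        varX i * (f * (P * varD i - varD i * P)) := by
      rw [← mul_assoc (varD i) f, ← hf.2.eq]
      noncomm_ring
    rw [e, hP, mul_smul_comm, mul_smul_comm]
  have h4 : residue (varX i * (f * (varXInv i * varDInv i * varXInv i))) =
      residue (f * (varXInv i * varDInv i)) := by
    rw [residue_mul_comm]
    congr 1
    rw [mul_assoc, mul_assoc, varXInv_mul_varX, mul_one]
  have h5 := congrArg residue h3
  rw [map_sub, map_smul, h4, smul_eq_mul] at h5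
  rw [h1, sub_mul, mul_assoc (varX i) (varD i), mul_assoc (varD i) (varX i), map_neg, map_sub, h2,
    neg_sub, h5]

theorem residue_mul_varDInv_varXInv {i : Fin n} {f : PsiDif n} (hf : CommutesAt i f) :
    residue (f * (varDInv i * varXInv i)) = residue (f * (varXInv i * varDInv i)) := by
  rw [← mul_assoc, residue_mul_comm, ← mul_assoc, ← mul_assoc, hf.varXInv.eq]

theorem residue_product {s t : Fin 2} (hst : s ≠ t) :
    residue (varXInv s * varDInv s * (varXInv t * varDInv t)) = 1 := by
  have h : varXInv s * varDInv s * (varXInv t * varDInv t) =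
      monomial (Pi.single s (-1) + Pi.single t (-1)) (Pi.single s (-1) + Pi.single t (-1)) 1 := by
    rw [mul_assoc, ← mul_assoc (varDInv s), (commutesAt_varDInv hst).varXInv.eq, mul_assoc,
      ← mul_assoc, varXInv, varXInv, varDInv, varDInv, (monomial_mul_monomial _ _ _ 0 _).1,
      (monomial_mul_monomial 0 0 _ _ _).2, (monomial_mul_monomial _ 0 _ 0 _).1, add_zero]
  have h2 : (Pi.single s (-1) + Pi.single t (-1) : Fin 2 → ℤ) = -1 := by
    ext i
    fin_cases s <;> fin_cases t <;> fin_cases i <;> simp at hst ⊢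
  rw [h, h2]
  have h3 : residue (monomial (-1 : Fin 2 → ℤ) (-1) 1) = (monomial (-1 : Fin 2 → ℤ) (-1) 1).1 (-1, -1) := rfl
  rw [h3, monomial_coeff]
  exact if_pos rfl

theorem residue_product_rev {s t : Fin 2} (hst : s ≠ t) :
    residue (varDInv s * varXInv s * (varXInv t * varDInv t)) = 1 := by
  rw [residue_mul_comm, residue_mul_varDInv_varXInv, residue_product hst.symm]
  exact (commutesAt_varXInv hst.symm).mul (commutesAt_varDInv hst.symm)

end Relations

/-! ### Values of the transgression and of α* on the generators -/

section Evaluation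

/-- The index of `ln ∂_t` among the four derivations. -/
def dIdx : Fin 2 → Fin 4 := ![0, 2]

/-- The index of `ln x_t` among the four derivations. -/
def xIdx : Fin 2 → Fin 4 := ![1, 3]

theorem logDerivations_one (a : Fin 4) : logDerivations a (1 : PsiDif 2) = 0 := by
  fin_cases a <;> simp [logDerivations, lnD_one, lnX_one]

theorem logDerivations_varX (a : Fin 4) (t : Fin 2) :
    logDerivations a (varX t) = (if a = dIdx t then 1 else 0 : ℂ) • varDInv t := by
  fin_cases a <;> fin_cases t <;> simp [logDerivations, dIdx, lnD_varX, lnX_varX]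

theorem logDerivations_varD (a : Fin 4) (t : Fin 2) :
    logDerivations a (varD t) = -(if a = xIdx t then 1 else 0 : ℂ) • varXInv t := by
  fin_cases a <;> fin_cases t <;> simp [logDerivations, xIdx, lnD_varD, lnX_varD]

theorem logDerivations_varXInv (a : Fin 4) (t : Fin 2) : logDerivations a (varXInv t) =
    -(if a = dIdx t then 1 else 0 : ℂ) • (varXInv t * varDInv t * varXInv t) := by
  fin_cases a <;> fin_cases t <;> simp [logDerivations, dIdx, lnD_varXInv, lnX_varXInv]

theorem logDerivations_varDInv (a : Fin 4) (t : Fin 2) : logDerivations a (varDInv t) =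
    (if a = xIdx t then 1 else 0 : ℂ) • (varDInv t * varXInv t * varDInv t) := by
  fin_cases a <;> fin_cases t <;> simp [logDerivations, xIdx, lnD_varDInv, lnX_varDInv]

/-- The sign of `(i, j)` as an ordering of the pair of indices of `ln ∂_t` and `ln x_t`. -/
def pairSign (t : Fin 2) (i j : Fin 4) : ℤ :=
  (if i = dIdx t then 1 else 0) * (if j = xIdx t then 1 else 0) -
    (if i = xIdx t then 1 else 0) * (if j = dIdx t then 1 else 0)

variable {Q : Fin 4 → Fin 4 → PsiDif 2}

/-- Condition (ii) determines the commutators of any admissible `Q i j` with the generators.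
Together with the trace property they determine all residues needed below, so these do not depend on
the choice of `Q`. -/
theorem curvature_varD (h : LiftingConditions residue logDerivations Q) (i j : Fin 4) (t : Fin 2) :
    Q i j * varD t - varD t * Q i j =
      (pairSign t i j : ℂ) • (varXInv t * varDInv t * varXInv t) := by
  rw [← h.commutator, logDerivations_varD, logDerivations_varD, map_smul, map_smul,
    logDerivations_varXInv, logDerivations_varXInv, smul_smul, smul_smul, ← sub_smul]
  congr 1
  simp only [pairSign]
  push_cast
  ring

theorem curvature_varX (h : LiftingConditions residue logDerivations Q) (i j : Fin 4) (t : Fin 2) :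
    Q i j * varX t - varX t * Q i j =
      -(pairSign t i j : ℂ) • (varDInv t * varXInv t * varDInv t) := by
  rw [← h.commutator, logDerivations_varX, logDerivations_varX, map_smul, map_smul,
    logDerivations_varDInv, logDerivations_varDInv, smul_smul, smul_smul, ← sub_smul]
  congr 1
  simp only [pairSign]
  push_cast
  ring

theorem commutesAt_curvature (h : LiftingConditions residue logDerivations Q) {i j : Fin 4}
    {t : Fin 2} (ht : pairSign t i j = 0) : CommutesAt t (Q i j) := by
  have h1 := curvature_varX h i j t
  have h2 := curvature_varD h i j t
  rw [ht, Int.cast_zero] at h1 h2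
  rw [neg_zero, zero_smul] at h1
  rw [zero_smul] at h2
  exact ⟨sub_eq_zero.mp h1, sub_eq_zero.mp h2⟩

/-- The factor x_s⁻¹ ∂_s⁻¹ commutes with the variable `t`, so the residue is read off from [Q, ∂_t].
-/
theorem residue_varXInv_varDInv_curvature (h : LiftingConditions residue logDerivations Q)
    {s t : Fin 2} (hst : s ≠ t) (i j : Fin 4) :
    residue (varXInv s * varDInv s * Q i j) = pairSign t i j := by
  rw [residue_mul_of_commutator ((commutesAt_varXInv hst).mul (commutesAt_varDInv hst))
    (curvature_varD h i j t), residue_product hst, mul_one]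

theorem residue_varDInv_varXInv_curvature (h : LiftingConditions residue logDerivations Q)
    {s t : Fin 2} (hst : s ≠ t) (i j : Fin 4) :
    residue (varDInv s * varXInv s * Q i j) = pairSign t i j := by
  rw [residue_mul_of_commutator ((commutesAt_varDInv hst).mul (commutesAt_varXInv hst))
    (curvature_varD h i j t), residue_product_rev hst, mul_one]

theorem residue_curvature_mul_curvature_of_eq_zero
    (h : LiftingConditions residue logDerivations Q) {s t : Fin 2} (hst : s ≠ t) {i j : Fin 4}
    (k l : Fin 4) (ht : pairSign t i j = 0) :
    residue (Q i j * Q k l) = pairSign s i j * pairSign t k l := by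
  rw [residue_mul_of_commutator (commutesAt_curvature h ht) (curvature_varD h k l t),
    residue_mul_comm, residue_varXInv_varDInv_curvature h hst.symm, mul_comm]

theorem residue_curvature_mul_curvature (h : LiftingConditions residue logDerivations Q)
    {s t : Fin 2} (hst : s ≠ t) (τ : Equiv.Perm (Fin 4)) :
    residue (Q (τ 0) (τ 1) * Q (τ 2) (τ 3)) = ((pairSign s (τ 0) (τ 1) * pairSign t (τ 2) (τ 3) +
      pairSign t (τ 0) (τ 1) * pairSign s (τ 2) (τ 3) : ℤ) : ℂ) := by
  -- The two index pairs are disjoint, so at most one of them is the pair of the variable `t`; the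
  -- other curvature commutes with `x_t` and `∂_t`.
  have key : ∀ (t : Fin 2) (τ : Equiv.Perm (Fin 4)),
      pairSign t (τ 0) (τ 1) = 0 ∨ pairSign t (τ 2) (τ 3) = 0 := by
    decide
  rcases key t τ with h0 | h0
  · rw [residue_curvature_mul_curvature_of_eq_zero h hst _ _ h0, h0]
    simp
  · rw [residue_mul_comm, residue_curvature_mul_curvature_of_eq_zero h hst _ _ h0, h0]
    push_cast
    ring

/-- In each of the three products four permutations contribute, and for each the sign of `τ` agrees
with the product of the pair signs: 3 (4 + 4) + 2 · 4 = 32. -/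
theorem sum_sign_pairSign {s t : Fin 2} (hst : s ≠ t) :
    ∑ τ : Equiv.Perm (Fin 4), Equiv.Perm.sign τ •
      (3 * (pairSign s (τ 0) (τ 1) * pairSign t (τ 2) (τ 3) +
        pairSign t (τ 0) (τ 1) * pairSign s (τ 2) (τ 3) ) +
      2 * (pairSign s (τ 0) (τ 3) * pairSign t (τ 1) (τ 2))) = 32 := by
  revert s t
  decide

/-- These are the values to which the coboundary of the transgression reduces on the generators. The
residues found above turn each ordering of the indices into products of pair signs, and -8 = -32 /
4. -/
theorem residue_alt_transgression (h : LiftingConditions residue logDerivations Q)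
    {s t : Fin 2} (hst : s ≠ t) :
    residue (alt (fun τ => transgression logDerivations Q τ) ![1, varX s, varD s]) = -8 := by
  rw [trace_alt, sum_perm_three (fun v => altTrace residue fun d => transgression logDerivations Q d v)]
  simp only [← altTrace_add, ← altTrace_sub]
  have key : ∀ τ : Equiv.Perm (Fin 4), residue
      (transgression logDerivations Q τ ![1, varX s, varD s] -
      transgression logDerivations Q τ ![varX s, 1, varD s] -
      transgression logDerivations Q τ ![varD s, varX s, 1] -
      transgression logDerivations Q τ ![1, varD s, varX s] +
      transgression logDerivations Q τ ![varX s, varD s, 1] +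
      transgression logDerivations Q τ ![varD s, 1, varX s]) =
      (-1 / 4 : ℂ) * ((3 * (pairSign s (τ 0) (τ 1) * pairSign t (τ 2) (τ 3) +
        pairSign t (τ 0) (τ 1) * pairSign s (τ 2) (τ 3) ) +
      2 * (pairSign s (τ 0) (τ 3) * pairSign t (τ 1) (τ 2)) : ℤ) : ℂ) := by
    intro τ
    have e1 : ∀ i j k l, residue (logDerivations i (varX s) * logDerivations j (varD s) * Q k l) =
        -((if i = dIdx s then 1 else 0) * (if j = xIdx s then 1 else 0) * pairSign t k l) := by
      intro i j k l
      rw [logDerivations_varX, logDerivations_varD, smul_mul_smul_comm, smul_mul_assoc, map_smul,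
        residue_varDInv_varXInv_curvature h hst, smul_eq_mul]
      ring
    have e2 : ∀ i j k l, residue (logDerivations i (varD s) * logDerivations j (varX s) * Q k l) =
        -((if i = xIdx s then 1 else 0) * (if j = dIdx s then 1 else 0) * pairSign t k l) := by
      intro i j k l
      rw [logDerivations_varX, logDerivations_varD, smul_mul_smul_comm, smul_mul_assoc, map_smul,
        residue_varXInv_varDInv_curvature h hst, smul_eq_mul]
      ring
    have e3 : ∀ a b c : PsiDif 2, residue (a * b * c) = residue (c * a * b) := by
      intro a b c
      rw [residue_mul_comm, mul_assoc]
    set a : Fin 4 → PsiDif 2 := fun i => logDerivations i (varX s) with ha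
    set b : Fin 4 → PsiDif 2 := fun i => logDerivations i (varD s) with hb
    -- Derivations kill 1, so in the words with one curvature the argument 1 must stand beside `Q`.
    -- In the word with two curvatures the terms with 1 in one of the first two places cancel, and
    -- those with 1 in the last place form [x_s, ∂_s].
    have e4 : transgression logDerivations Q τ ![1, varX s, varD s] -
        transgression logDerivations Q τ ![varX s, 1, varD s] -
        transgression logDerivations Q τ ![varD s, varX s, 1] -
        transgression logDerivations Q τ ![1, varD s, varX s] +
        transgression logDerivations Q τ ![varX s, varD s, 1] +
        transgression logDerivations Q τ ![varD s, 1, varX s] =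
        (1 / 2 : ℂ) • (a (τ 0) * b (τ 1) * Q (τ 2) (τ 3) - b (τ 0) * a (τ 1) * Q (τ 2) (τ 3)) +
        (1 / 2 : ℂ) • (a (τ 0) * Q (τ 1) (τ 2) * b (τ 3) - b (τ 0) * Q (τ 1) (τ 2) * a (τ 3)) +
        (1 / 2 : ℂ) • (Q (τ 0) (τ 1) * a (τ 2) * b (τ 3) - Q (τ 0) (τ 1) * b (τ 2) * a (τ 3)) +
        (1 / 4 : ℂ) • (Q (τ 0) (τ 1) * (varX s * varD s - varD s * varX s) * Q (τ 2) (τ 3)) := by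
      simp [transgression, prod3_apply, logDerivations_one, ha, hb, mul_sub, sub_mul, smul_sub,
        mul_assoc]
      abel
    rw [e4, varX_varD_commutator, if_pos rfl, mul_neg_one, neg_mul]
    simp only [map_add, map_sub, map_smul, map_neg]
    rw [e3 (a _) _ (b _), e3 (b _) _ (a _), ← e3 (a _) (b _), ← e3 (b _) (a _), e1, e1, e1, e2, e2, e2,
      residue_curvature_mul_curvature h hst]
    simp only [pairSign, smul_eq_mul]
    push_cast
    ring
  have := sum_sign_pairSign hst
  rw [altTrace, Finset.sum_congr rfl fun τ _ => congrArg _ (key τ)]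
  simp only [← mul_smul_comm]
  rw [← Finset.mul_sum]
  have h2 := congrArg (Int.cast : ℤ → ℂ) this
  rw [Int.cast_sum] at h2
  have h3 : ∀ (u : ℤˣ) (m : ℤ), ((u • m : ℤ) : ℂ) = u • (m : ℂ) := by
    intro u m
    rcases Int.units_eq_one_or u with rfl | rfl <;> simp
  simp only [h3] at h2
  rw [h2]
  norm_num

/-- The operators `x₁, ∂₁, x₂, ∂₂`. -/
def generators : Fin 4 → PsiDif 2 := ![varX 0, varD 0, varX 1, varD 1]

/-- The images of `x₁, ∂₁, x₂, ∂₂` under `ln ∂₁, ln x₁, ln ∂₂, ln x₂`. -/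
def logValues : Fin 4 → PsiDif 2 := ![varDInv 0, -varXInv 0, varDInv 1, -varXInv 1]

theorem logDerivations_generators (a b : Fin 4) :
    logDerivations a (generators b) = if a = b then logValues a else 0 := by
  fin_cases a <;> fin_cases b <;>
    simp [logDerivations, generators, logValues, lnD_varX, lnD_varD, lnX_varX, lnX_varD]

/-- A cyclically invariant function of the orderings of `{0, 1, 2, 3}` which does not change when
neighbours from `{0, 1}` and `{2, 3}` are interchanged is constant. -/
theorem eq_of_rotate_of_swap (T : Fin 4 → Fin 4 → Fin 4 → Fin 4 → ℂ) (r : ℂ)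
    (rot : ∀ a b c d, T a b c d = T b c d a)
    (sw : ∀ a b c d : Fin 4, a.val / 2 ≠ b.val / 2 → T a b c d = T b a c d) (h1 : T 0 1 2 3 = r)
    (τ : Equiv.Perm (Fin 4)) : T (τ 0) (τ 1) (τ 2) (τ 3) = r := by
  -- Rotated to begin with 0, the orderings are the six cyclic orders; each is reached from 0, 1, 2,
  -- 3 by rotations and permitted exchanges.
  have h2 : T 0 2 1 3 = r := by rw [rot, sw 2 1 3 0 (by decide), ← rot, h1]
  have h3 : T 0 1 3 2 = r := by rw [rot, rot, rot, sw 2 0 1 3 (by decide), h2]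
  have h4 : T 0 3 1 2 = r := by rw [sw 0 3 1 2 (by decide), rot, h1]
  have h5 : T 0 2 3 1 = r := by rw [sw 0 2 3 1 (by decide), rot, h4]
  have h6 : T 0 3 2 1 = r := by rw [sw 0 3 2 1 (by decide), rot, h2]
  have key : ∀ a b c d : Fin 4, [a, b, c, d].Nodup → a = 0 → T a b c d = r := by
    rintro a b c d h rfl
    fin_cases b <;> fin_cases c <;> fin_cases d <;>
      first
      | exact absurd h (by decide)
      | exact h1
      | exact h2
      | exact h3
      | exact h4
      | exact h5
      | exact h6
  have hτ : ∀ τ : Equiv.Perm (Fin 4), [τ 0, τ 1, τ 2, τ 3].Nodup ∧ [τ 1, τ 2, τ 3, τ 0].Nodup ∧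
      [τ 2, τ 3, τ 0, τ 1].Nodup ∧ [τ 3, τ 0, τ 1, τ 2].Nodup ∧
      (τ 0 = 0 ∨ τ 1 = 0 ∨ τ 2 = 0 ∨ τ 3 = 0) := by
    decide
  obtain ⟨n0, n1, n2, n3, h | h | h | h⟩ := hτ τ
  · exact key _ _ _ _ n0 h
  · rw [rot, key _ _ _ _ n1 h]
  · rw [rot, rot, key _ _ _ _ n2 h]
  · rw [rot, rot, rot, key _ _ _ _ n3 h]

/-- The trace gives invariance under rotation, and values belonging to different variables commute.
So all orderings have the residue of ∂₁⁻¹ x₁⁻¹ ∂₂⁻¹ x₂⁻¹; the two minus signs cancel. -/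
theorem residue_logValues (τ : Equiv.Perm (Fin 4)) :
    residue (logValues (τ 0) * logValues (τ 1) * logValues (τ 2) * logValues (τ 3)) = 1 := by
  let T (a b c d : Fin 4) : ℂ :=
    residue (logValues a * logValues b * logValues c * logValues d)
  have rot : ∀ a b c d, T a b c d = T b c d a := by
    intro a b c d
    simp only [T]
    rw [mul_assoc, mul_assoc, residue_mul_comm, mul_assoc, mul_assoc, mul_assoc, mul_assoc]
  have hc : ∀ a b, a.val / 2 ≠ b.val / 2 → Commute (logValues a) (logValues b) := by
    have h01 : (0 : Fin 2) ≠ 1 := by decide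
    intro a b hab
    have c1 := (commutesAt_varXInv h01)
    have c2 := (commutesAt_varDInv h01)
    fin_cases a <;> fin_cases b <;> simp [logValues] at hab ⊢
    · exact c2.varDInv
    · exact c2.varXInv
    · exact c1.varDInv
    · exact c1.varXInv
    · exact c2.varDInv.symm
    · exact c1.varDInv.symm
    · exact c2.varXInv.symm
    · exact c1.varXInv.symm
  have sw : ∀ a b c d, a.val / 2 ≠ b.val / 2 → T a b c d = T b a c d := by
    intro a b c d h
    simp only [T]
    rw [(hc a b h).eq]
  have h0123 : T 0 1 2 3 = 1 := by
    simp only [T, logValues]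
    have := residue_product_rev (s := 0) (t := 1) (by decide)
    rw [← residue_mul_varDInv_varXInv ((commutesAt_varDInv (by decide)).mul
      (commutesAt_varXInv (by decide)))] at this
    simpa [mul_assoc] using this
  exact eq_of_rotate_of_swap T 1 rot sw h0123 τ

/-- The generators are listed so that the matrix of values of the four derivations on them is
diagonal. In the double sum over `σ` and `τ` only `τ = σ` survives, the signs cancel, and each of
the 24 terms is a residue equal to 1. -/
theorem alphaStar_generators :
    alphaStar residue logDerivations generators 1 = 24 := by
  rw [alphaStar_eq_traceDual_alt, traceDual_apply, mul_one, trace_alt fun d =>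
    prod4 ![logDerivations (d 0), logDerivations (d 1), logDerivations (d 2), logDerivations (d 3)]]
  have key : ∀ σ : Equiv.Perm (Fin 4), Equiv.Perm.sign σ • altTrace residue (fun d =>
      prod4 ![logDerivations (d 0), logDerivations (d 1), logDerivations (d 2), logDerivations (d 3)]
        (generators ∘ σ)) = 1 := by
    intro σ
    rw [altTrace, Finset.sum_eq_single σ]
    · simp [prod4_apply, logDerivations_generators, residue_logValues, smul_smul]
    · intro τ _ hτ
      have : τ 0 ≠ σ 0 ∨ τ 1 ≠ σ 1 ∨ τ 2 ≠ σ 2 ∨ τ 3 ≠ σ 3 := by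
        by_contra! h
        obtain ⟨h0, h1, h2, h3⟩ := h
        exact hτ (Equiv.ext fun i => by fin_cases i <;> assumption)
      rcases this with h | h | h | h <;> simp [prod4_apply, logDerivations_generators, h]
    · simp
  rw [Finset.sum_congr rfl fun σ _ => key σ]
  simp [Finset.card_univ, Fintype.card_perm, Nat.factorial]

end Evaluation

end PsiDif

namespace PsiDif

/-! ### Evaluation of Ψ₅ and vanishing of coboundaries -/

section NonTriviality

variable {n : ℕ}

theorem lie_varX_varD (i j : Fin n) : ⁅varX i, varD j⁆ = if i = j then -1 else 0 := by
  rw [Ring.lie_def, varX_varD_commutator]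

theorem lie_varX_varX (i j : Fin n) : ⁅varX i, varX j⁆ = 0 := by
  rw [Ring.lie_def, (commute_varX_varX i j).eq, sub_self]

theorem lie_varD_varD (i j : Fin n) : ⁅varD i, varD j⁆ = 0 := by
  rw [Ring.lie_def, (commute_varD_varD i j).eq, sub_self]

theorem lie_varD_varX (i j : Fin n) : ⁅varD i, varX j⁆ = if j = i then 1 else 0 := by
  rw [Ring.lie_def, ← neg_sub, varX_varD_commutator]
  split_ifs <;> simp

/-- 1 is central; evaluating at 1 therefore removes the module action from the differential and
leaves the brackets. -/
theorem coadjoint_apply_one (a : PsiDif n) (φ : Module.Dual ℂ (PsiDif n)) :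
    coadjoint a φ 1 = 0 := by
  change φ (1 * a - a * 1) = 0
  rw [one_mul, mul_one, sub_self, map_zero]

theorem ceDiff_coadjoint_four (g : PsiDif n [⋀^Fin 3]→ₗ[ℂ] Module.Dual ℂ (PsiDif n))
    (a b c d : PsiDif n) :
    ceDiff coadjoint g ![a, b, c, d] 1 =
      -g ![⁅a, b⁆, c, d] 1 - g ![b, ⁅a, c⁆, d] 1 - g ![b, c, ⁅a, d⁆] 1 + g ![a, ⁅b, c⁆, d] 1 +
        g ![a, c, ⁅b, d⁆] 1 - g ![a, b, ⁅c, d⁆] 1 := by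
  have i0 : Finset.Ioi (0 : Fin 4) = {1, 2, 3} := by decide
  have i1 : Finset.Ioi (1 : Fin 4) = {2, 3} := by decide
  have i2 : Finset.Ioi (2 : Fin 4) = {3} := by decide
  have i3 : Finset.Ioi (3 : Fin 4) = ∅ := by decide
  have e01 : ∀ x, (0 : Fin 4).removeNth (Function.update ![a, b, c, d] 1 x) = ![x, c, d] := by
    intro x; ext i; fin_cases i <;> rfl
  have e02 : ∀ x, (0 : Fin 4).removeNth (Function.update ![a, b, c, d] 2 x) = ![b, x, d] := by
    intro x; ext i; fin_cases i <;> rfl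
  have e03 : ∀ x, (0 : Fin 4).removeNth (Function.update ![a, b, c, d] 3 x) = ![b, c, x] := by
    intro x; ext i; fin_cases i <;> rfl
  have e12 : ∀ x, (1 : Fin 4).removeNth (Function.update ![a, b, c, d] 2 x) = ![a, x, d] := by
    intro x; ext i; fin_cases i <;> rfl
  have e13 : ∀ x, (1 : Fin 4).removeNth (Function.update ![a, b, c, d] 3 x) = ![a, c, x] := by
    intro x; ext i; fin_cases i <;> rfl
  have e23 : ∀ x, (2 : Fin 4).removeNth (Function.update ![a, b, c, d] 3 x) = ![a, b, x] := by
    intro x; ext i; fin_cases i <;> rfl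
  rw [ceDiff, Fin.sum_univ_four, i0, i1, i2, i3, Finset.sum_insert (by decide),
    Finset.sum_insert (by decide), Finset.sum_singleton, Finset.sum_insert (by decide),
    Finset.sum_singleton, Finset.sum_singleton, Finset.sum_empty, e01, e02, e03, e12, e13, e23]
  simp only [LinearMap.add_apply, LinearMap.smul_apply, LinearMap.sub_apply, LinearMap.zero_apply,
    coadjoint_apply_one, smul_eq_mul, Matrix.cons_val]
  simp
  ring

/-- Of the six brackets only [x₁, ∂₁] and [x₂, ∂₂] are nonzero, both -1; the rotation of three
arguments that moves 1 to the front is even. -/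
theorem ceDiff_coadjoint_generators (g : PsiDif 2 [⋀^Fin 3]→ₗ[ℂ] Module.Dual ℂ (PsiDif 2)) :
    ceDiff coadjoint g generators 1 =
      g ![1, varX 0, varD 0] 1 + g ![1, varX 1, varD 1] 1 := by
  have h1 : ∀ a b, g ![0, a, b] = 0 := fun a b => g.map_coord_zero 0 rfl
  have h2 : ∀ a b, g ![a, 0, b] = 0 := fun a b => g.map_coord_zero 1 rfl
  have h3 : ∀ a b, g ![a, b, 0] = 0 := fun a b => g.map_coord_zero 2 rfl
  have h4 : ∀ a b, g ![-1, a, b] = -g ![1, a, b] := fun a b => by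
    have e : ∀ x, Function.update ![1, a, b] 0 x = ![x, a, b] := fun x => by
      ext i; fin_cases i <;> rfl
    simpa only [e] using g.map_update_neg ![1, a, b] 0 1
  have h5 : ∀ a b c, g ![a, b, c] = g ![c, a, b] := fun a b c => by
    have e : ![c, a, b] ∘ finRotate 3 = ![a, b, c] := by ext i; fin_cases i <;> rfl
    rw [← e, g.map_perm, show Equiv.Perm.sign (finRotate 3) = 1 by decide, one_smul]
  have h01 : (0 : Fin 2) ≠ 1 := by decide
  rw [generators, ceDiff_coadjoint_four, lie_varX_varD, lie_varX_varX, lie_varX_varD,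
    lie_varD_varX, lie_varD_varD, lie_varX_varD, if_pos rfl, if_pos rfl, if_neg h01,
    if_neg h01.symm, h5 _ _ (-1), h4, h4, h2, h2, h3, h3]
  simp [add_comm]

variable {Q : Fin 4 → Fin 4 → PsiDif 2}

/-- 5 · 24 from α*, and 5 · (-8) from the transgression for each of the two variables. -/
theorem theta_psi5_generators (h : LiftingConditions residue logDerivations Q) :
    theta (psi5 residue logDerivations Q) generators 1 = 40 := by
  have h1 := congrArg (fun φ : Module.Dual ℂ (PsiDif 2) => φ 1)
    (theta_psi5_sub_alphaStar h generators)
  simp only [ceDiff_coadjoint_generators] at h1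
  simp only [AlternatingMap.sub_apply, AlternatingMap.smul_apply, LinearMap.sub_apply,
    LinearMap.smul_apply, traceDual_apply, mul_one, alphaStar_generators,
    residue_alt_transgression h (show (0 : Fin 2) ≠ 1 by decide),
    residue_alt_transgression h (show (1 : Fin 2) ≠ 0 by decide)] at h1
  rw [sub_eq_iff_eq_add] at h1
  rw [h1]
  norm_num

theorem psi5_apply_eq (h : LiftingConditions residue logDerivations Q) :
    psi5 residue logDerivations Q ![1, varX 0, varX 1, varD 0, varD 1] = -40 := by
  -- The reordering of (x₁, ∂₁, x₂, ∂₂, 1) into the order of the statement is odd, which gives -40.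
  let ρ : Equiv.Perm (Fin 5) := Equiv.swap 1 3 * Equiv.swap 0 1 * Equiv.swap 0 4
  have hρ : Equiv.Perm.sign ρ = -1 := by decide
  have e : (Fin.snoc generators 1 : Fin 5 → PsiDif 2) ∘ ρ =
      ![1, varX 0, varX 1, varD 0, varD 1] := by
    ext i; fin_cases i <;> rfl
  rw [← e, AlternatingMap.map_perm, hρ, ← theta_apply, theta_psi5_generators h]
  simp

/-- The operators `1`, `x_j`, `∂_j`. -/
def IsGenerator (f : PsiDif n) : Prop := f = 1 ∨ (∃ j, f = varX j) ∨ ∃ j, f = varD j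

theorem IsGenerator.exists_lie {f g : PsiDif n} (hf : IsGenerator f) (hg : IsGenerator g) :
    ∃ c : ℂ, ⁅f, g⁆ = c • (1 : PsiDif n) := by
  rcases hf with rfl | ⟨i, rfl⟩ | ⟨i, rfl⟩
  · exact ⟨0, by rw [Ring.lie_def]; simp⟩
  · rcases hg with rfl | ⟨j, rfl⟩ | ⟨j, rfl⟩
    · exact ⟨0, by rw [Ring.lie_def]; simp⟩
    · exact ⟨0, by rw [lie_varX_varX, zero_smul]⟩
    · exact ⟨if i = j then -1 else 0, by rw [lie_varX_varD]; split_ifs <;> simp⟩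
  · rcases hg with rfl | ⟨j, rfl⟩ | ⟨j, rfl⟩
    · exact ⟨0, by rw [Ring.lie_def]; simp⟩
    · exact ⟨if j = i then 1 else 0, by rw [lie_varD_varX]; split_ifs <;> simp⟩
    · exact ⟨0, by rw [lie_varD_varD, zero_smul]⟩

/-- The coboundaries with trivial coefficients vanish on families of generators that contain `1`. -/
theorem ceDiff_trivialAction_eq_zero {m : ℕ} (g : PsiDif n [⋀^Fin (m + 1)]→ₗ[ℂ] ℂ)
    (v : Fin (m + 2) → PsiDif n) (h0 : v 0 = 1) (hv : ∀ i, IsGenerator (v i)) :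
    ceDiff trivialAction g v = 0 := by
  refine Finset.sum_eq_zero fun i _ => ?_
  rw [show trivialAction (v i) (g (i.removeNth v)) = 0 from rfl, zero_sub,
    Finset.sum_eq_zero fun j hj => ?_, neg_zero, smul_zero]
  rw [Finset.mem_Ioi] at hj
  obtain ⟨k, rfl⟩ := Fin.exists_succAbove_eq hj.ne'
  have hk : i.removeNth (Function.update v (i.succAbove k) ⁅v i, v (i.succAbove k)⁆) =
      Function.update (i.removeNth v) k ⁅v i, v (i.succAbove k)⁆ := by
    rw [Fin.removeNth_update_succAbove]
  rw [hk]
  -- If the bracket involves `v 0 = 1`, it is zero. Otherwise it is a multiple of 1, placed at `k ≠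
  -- 0`, while 1 still stands at place 0, so that the alternating form vanishes.
  rcases Fin.eq_zero_or_eq_succ i with rfl | ⟨i, rfl⟩
  · rw [h0, Ring.lie_def, one_mul, mul_one, sub_self]
    exact g.map_update_zero _ _
  · obtain ⟨c, hc⟩ := (hv i.succ).exists_lie (hv (i.succ.succAbove k))
    have hk0 : k ≠ 0 := by
      rintro rfl
      simp at hj
    have h1 : (i.succ.removeNth v) 0 = 1 := by
      rw [Fin.removeNth_apply, Fin.succ_succAbove_zero, h0]
    rw [hc, g.map_update_smul, ← h1, g.map_update_self _ hk0, smul_zero]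

theorem not_isCoboundary_psi5 (h : LiftingConditions residue logDerivations Q) :
    ¬IsCoboundary trivialAction (psi5 residue logDerivations Q) := by
  rintro ⟨g, hg⟩
  have h1 := hg ![1, varX 0, varX 1, varD 0, varD 1]
  rw [psi5_apply_eq h, ceDiff_trivialAction_eq_zero g _ rfl] at h1
  · norm_num at h1
  · intro i
    fin_cases i
    · exact Or.inl rfl
    · exact Or.inr (Or.inl ⟨0, rfl⟩)
    · exact Or.inr (Or.inl ⟨1, rfl⟩)
    · exact Or.inr (Or.inr ⟨0, rfl⟩)
    · exact Or.inr (Or.inr ⟨1, rfl⟩)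

end NonTriviality

end PsiDif

end LiftingFormula

end

/-! ### The theorem -/

theorem theorem3p1 :
    (∀ (A : Type*) [NonUnitalRing A] [Module ℂ A] [IsScalarTower ℂ A A] [SMulCommClass ℂ A A]
      (Tr : A →ₗ[ℂ] ℂ) (D : Fin 4 → A →ₗ[ℂ] A) (Q : Fin 4 → Fin 4 → A),
      LiftingFormula.LiftingConditions Tr D Q →
        LiftingFormula.IsCocycle LiftingFormula.trivialAction (LiftingFormula.psi5 Tr D Q) ∧
        LiftingFormula.IsCocycle LiftingFormula.coadjoint (LiftingFormula.alphaStar Tr D) ∧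
        LiftingFormula.Cohomologous LiftingFormula.coadjoint
          (LiftingFormula.theta (LiftingFormula.psi5 Tr D Q))
          ((5 : ℂ) • LiftingFormula.alphaStar Tr D)) ∧
    (∃ Q : Fin 4 → Fin 4 → LiftingFormula.PsiDif 2,
      LiftingFormula.LiftingConditions LiftingFormula.PsiDif.residue
        LiftingFormula.PsiDif.logDerivations Q) ∧
    (∀ Q : Fin 4 → Fin 4 → LiftingFormula.PsiDif 2,
      LiftingFormula.LiftingConditions LiftingFormula.PsiDif.residue
        LiftingFormula.PsiDif.logDerivations Q →
        LiftingFormula.psi5 LiftingFormula.PsiDif.residue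
          LiftingFormula.PsiDif.logDerivations Q
          ![1, LiftingFormula.PsiDif.varX 0, LiftingFormula.PsiDif.varX 1,
            LiftingFormula.PsiDif.varD 0, LiftingFormula.PsiDif.varD 1] ≠ 0 ∧
        ¬ LiftingFormula.IsCoboundary LiftingFormula.trivialAction
          (LiftingFormula.psi5 LiftingFormula.PsiDif.residue
            LiftingFormula.PsiDif.logDerivations Q)) := by
  refine ⟨fun A _ _ _ _ Tr D Q h => ⟨LiftingFormula.isCocycle_psi5 h,
    LiftingFormula.isCocycle_alphaStar h, LiftingFormula.cohomologous_theta_psi5 h⟩,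
    ⟨_, LiftingFormula.PsiDif.liftingConditions_logCurvature⟩, fun Q h => ⟨?_,
    LiftingFormula.PsiDif.not_isCoboundary_psi5 h⟩⟩
  rw [LiftingFormula.PsiDif.psi5_apply_eq h]
  norm_num
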